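/- **Setting ($K$-armed bandits with knapsacks).** There are $T\ge 2$ rounds, $m\ge 1$ resources, $K\ge 1$ arms, one of which, $\varnothing\in[K]$, is void, and a per-round budget $0<\rho\le 1$; every resource has total budget $B=\rho T$. A request is a pair $(f,c)$ with $f:[K]\to[0,1]$, $c:[K]\to[0,1]^m$, $f(\varnothing)=0$ and $c(\varnothing)=0$. Mixtures are probability vectors on $[K]$. Put $\alpha=1/\rho$ and let $\delta>0$. **Algorithm.** Let $B_{i,1}=B$ for all $i$. In round $t$ the primal minimizer gives a mixture $\xi_t$ and the dual minimizer a vector $\lambda_t\in\mathcal D=\{\lambda\in\mathbb R^m_{\ge 0}:\|\lambda\|_1\le 1/\rho\}$. The arm $x_t$ is drawn from $\xi_t$ (with fresh randomness) if $B_{i,t}\ge 1$ for all $i$, and $x_t=\varnothing$ otherwise. Then $B_{i,t+1}=B_{i,t}-c_t(x_t)[i]$. * *Primal minimizer: EXP3.P* with exploration rate $\beta=\min\{3/5,\,2\sqrt{\tfrac35 K\ln K/T}\}$ and confidence parameter $a=2\sqrt{\ln(KT/\delta)}$. The weights start at $w_1(j)=\exp(\tfrac{a\beta}{3}\sqrt{T/K})$,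 the mixture is $\xi_t(j)=(1-\beta)\frac{w_t(j)}{\sum_k w_t(k)}+\frac{\beta}{K}$, and $w_{t+1}(j)=w_t(j)\exp\Big(\frac{\beta}{3K}\Big(\frac{\mathbb 1\{j=x_t\}\,r_t}{\xi_t(j)}+\frac{a}{\xi_t(j)\sqrt{KT}}\Big)\Big)$. Here $r_t=\frac{f_t(x_t)-\langle\lambda_t,c_t(x_t)\rangle+1/\rho}{1+1/\rho}\in[0,1]$ is the rescaled bandit feedback. * *Dual minimizer: online mirror descent with negative entropy on $\mathcal D$*, where a slack coordinate $\lambda[0]=1/\rho-\|\lambda\|_1$ is added. The step size is $\eta=\sqrt{\ln(m+1)/T}$, the start is $\lambda_1[i]=\frac{1}{\rho(m+1)}$, and $\lambda_{t+1}[i]=\frac1\rho\,\frac{\lambda_t[i]e^{\eta g_t[i]}}{\lambda_t[0]+\sum_{j=1}^m\lambda_t[j]e^{\eta g_t[j]}}$ for $i\in[m]$. Here $g_t=\hat c_t-\rho\mathbf 1$ is the gradient of the dual utility $\lambda\mapsto-\langle\lambda,\rho\mathbf 1-\hat c_t\rangle$, and either $\hat c_t=\mathbb E_{x\sim\xi_t}[c_t(x)]$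 in all rounds or $\hat c_t=c_t(x_t)$ in all rounds. The result holds for both choices. Let $\mathrm{REW}_\gamma=\sum_{t=1}^T f_t(x_t)$ be the reward of the algorithm on the sequence of requests $\gamma=(f_t,c_t)_{t\le T}$. **Baselines.** A strategy that plays arms $y_1,\dots,y_T$ earns $\sum_t f_t(y_t)$, summed over the rounds $t$ with $\sum_{s\le t}c_s(y_s)[i]\le B$ for all $i$. $\mathrm{OPT}^{FD}_\gamma$ is the supremum, over fixed mixtures $\xi$, of the expected amount earned on $\gamma$ when $y_1,\dots,y_T$ are i.i.d. with law $\xi$. For a probability distribution $D$ on requests, $\mathrm{OPT}^{DP}$ is the supremum, over dynamic policies (which choose the mixture for $y_t$ as a measurable function of $(f_s,c_s,y_s)_{s<t}$), of the expected amount earned when the requests are i.i.d. with law $D$. **Claim.** There is a universal constant $C>0$ such that, for all $K,m,T,\rho,\delta$ as above: 1. (Adversarial.) For every fixed sequence of requests $\gamma$, with probability at least $1-\delta$, $$\mathrm{OPT}^{FD}_\gamma-\alpha\,\mathrm{REW}_\gamma\le C\,\alpha^2\sqrt{KT\log(Tm/\delta)} .$$ 2. (Stochastic.) For every probability distribution $D$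 on requests, if the requests are i.i.d. with law $D$, then, with probability at least $1-\delta$ over the requests and the algorithm's randomness, $$\mathrm{OPT}^{DP}-\mathrm{REW}_\gamma\le \frac{C}{\rho}\sqrt{KT\log(Tm/\delta)} .$$ -/

import Mathlib

open MeasureTheory
open scoped BigOperators

namespace BwK

noncomputable section

/-! ### Inputs, mixtures, strategies -/

/-- A request `(f, c)` of a `K`-armed bandit problem with `m` resources and void arm `v`:
rewards `f : [K] → [0,1]`, costs `c : [K] → [0,1]^m`, and the void arm has reward and costs `0`. -/
def Input (K m : ℕ) (v : Fin K) : Type :=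
  {p : (Fin K → ℝ) × (Fin K → Fin m → ℝ) //
    (∀ x, p.1 x ∈ Set.Icc (0 : ℝ) 1) ∧ (∀ x i, p.2 x i ∈ Set.Icc (0 : ℝ) 1) ∧
      p.1 v = 0 ∧ ∀ i, p.2 v i = 0}

/-- The Borel structure inherited from the Euclidean space of all pairs `(f, c)`. -/
instance instMeasurableSpaceInput (K m : ℕ) (v : Fin K) : MeasurableSpace (Input K m v) :=
  Subtype.instMeasurableSpace

/-- `f(x)`. -/
def Input.reward {K m : ℕ} {v : Fin K} (g : Input K m v) (x : Fin K) : ℝ := g.1.1 x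

/-- `c(x)[i]`. -/
def Input.cost {K m : ℕ} {v : Fin K} (g : Input K m v) (x : Fin K) (i : Fin m) : ℝ := g.1.2 x i

/-- Strategy mixtures: probability vectors on the `K` arms. -/
abbrev Mixture (K : ℕ) : Type := stdSimplex ℝ (Fin K)

/-- The expectation of `h(x)` for `x ∼ ξ`. -/
def expect {K : ℕ} (ξ : Mixture K) (h : Fin K → ℝ) : ℝ := ∑ x, ξ.1 x * h x

/-- The mixture that plays `v` with probability one. -/
def point {K : ℕ} (v : Fin K) : Mixture K := ⟨Pi.single v 1, single_mem_stdSimplex ℝ v⟩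

/-- A randomized strategy: after `t` rounds it selects a mixture as a function of the `t` past
requests and the `t` past arms. -/
abbrev Strategy (K m : ℕ) (v : Fin K) : Type :=
  ∀ t : ℕ, (Fin t → Input K m v) → (Fin t → Fin K) → Mixture K

/-- The entries of a `T`-round sequence that precede round `t` (rounds are numbered from `0`). -/
def past {T : ℕ} {A : Type*} (w : Fin T → A) (t : Fin T) : Fin t → A :=
  fun s => w (Fin.castLE t.isLt.le s)

/-- The probability that the strategy `ψ` plays exactly the arms `x` against the requests `γ`. -/
def weight {K m T : ℕ} {v : Fin K} (ψ : Strategy K m v) (γ : Fin T → Input K m v)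
    (x : Fin T → Fin K) : ℝ :=
  ∏ t : Fin T, (ψ t (past γ t) (past x t)).1 (x t)

/-- The law of the sequence of arms played by the strategy `ψ` against the requests `γ`. -/
def law {K m T : ℕ} {v : Fin K} (ψ : Strategy K m v) (γ : Fin T → Input K m v) :
    Measure (Fin T → Fin K) :=
  ∑ x : Fin T → Fin K, ENNReal.ofReal (weight ψ γ x) • Measure.dirac x

/-- `∑ₜ fₜ(xₜ)`. -/
def totalReward {K m T : ℕ} {v : Fin K} (γ : Fin T → Input K m v) (x : Fin T → Fin K) : ℝ :=
  ∑ t, (γ t).reward (x t)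

open Classical in
/-- The reward collected until the process stops: round `t` counts as long as, for every resource,
the total consumption up to and including round `t` does not exceed the budget `ρ T`. -/
def stoppedReward {K m T : ℕ} {v : Fin K} (ρ : ℝ) (γ : Fin T → Input K m v)
    (x : Fin T → Fin K) : ℝ :=
  ∑ t : Fin T,
    if ∀ i : Fin m, ∑ s ∈ Finset.Iic t, (γ s).cost (x s) i ≤ ρ * T then (γ t).reward (x t) else 0

/-! ### Baselines -/

/-- The value of the best fixed mixture for the requests `γ`. -/
def optFD {K m T : ℕ} {v : Fin K} (ρ : ℝ) (γ : Fin T → Input K m v) : ℝ :=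
  ⨆ ξ : Mixture K, ∫ x, stoppedReward ρ γ x ∂(law (fun _ _ _ => ξ) γ)

/-- Dynamic policies: strategies that depend measurably on the past requests. -/
def DynamicPolicy (K m : ℕ) (v : Fin K) : Type :=
  {ψ : Strategy K m v // ∀ (t : ℕ) (x : Fin t → Fin K), Measurable fun γ => ψ t γ x}

/-- The value of the best dynamic policy when the `T` requests are i.i.d. with law `D`. -/
def optDP {K m : ℕ} {v : Fin K} (T : ℕ) (ρ : ℝ) (D : Measure (Input K m v)) : ℝ :=
  ⨆ ψ : DynamicPolicy K m v,
    ∫ γ : Fin T → Input K m v, (∫ x, stoppedReward ρ γ x ∂(law ψ.1 γ)) ∂(Measure.pi fun _ => D)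

/-! ### The primal regret minimizer: EXP3.P -/

/-- The exploration rate of EXP3.P, `γ = min {3/5, 2 √((3/5) K ln K / T)}`. -/
def exp3pGamma (K T : ℕ) : ℝ := min (3 / 5) (2 * √(3 / 5 * (K * Real.log K) / T))

/-- The confidence parameter of EXP3.P, `α = 2 √(ln (K T / δ))`. -/
def exp3pAlpha (K T : ℕ) (δ : ℝ) : ℝ := 2 * √(Real.log (K * T / δ))

/-- The logarithms of the initial weights `exp ((α γ / 3) √(T / K))`. -/
def exp3pInit (K T : ℕ) (δ : ℝ) : Fin K → ℝ :=
  fun _ => exp3pAlpha K T δ * exp3pGamma K T / 3 * √(T / K)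

lemma exp3pGamma_nonneg (K T : ℕ) : 0 ≤ exp3pGamma K T := by
  unfold exp3pGamma; positivity

lemma exp3pGamma_le (K T : ℕ) : exp3pGamma K T ≤ 3 / 5 := min_le_left _ _

/-- The mixture selected by EXP3.P with log-weights `w`:
`p j = (1 - γ) exp (w j) / ∑ k, exp (w k) + γ / K`. The argument `v` only witnesses `0 < K`. -/
def exp3pMix {K : ℕ} (v : Fin K) (T : ℕ) (w : Fin K → ℝ) : Mixture K :=
  ⟨fun j => (1 - exp3pGamma K T) * (Real.exp (w j) / ∑ k, Real.exp (w k)) + exp3pGamma K T / K, by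
    have hK : (K : ℝ) ≠ 0 := by
      have := v.pos
      positivity
    have hS : 0 < ∑ k, Real.exp (w k) :=
      Finset.sum_pos (fun _ _ => Real.exp_pos _) ⟨v, Finset.mem_univ v⟩
    have h0 := exp3pGamma_nonneg K T
    have h1 := exp3pGamma_le K T
    refine ⟨fun j => ?_, ?_⟩
    · have : 0 ≤ 1 - exp3pGamma K T := by linarith
      positivity
    · rw [Finset.sum_add_distrib, ← Finset.mul_sum, ← Finset.sum_div, div_self hS.ne']
      simp
      field_simp
      ring⟩

/-- The update of the log-weights after EXP3.P selected the mixture `p`, the arm `x` was played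
and the reward `r ∈ [0,1]` was received:
`w j ← w j + γ / (3 K) * (1{j = x} r / p j + α / (p j √(K T)))`. -/
def exp3pUpdate {K : ℕ} (T : ℕ) (δ : ℝ) (p : Mixture K) (w : Fin K → ℝ) (x : Fin K) (r : ℝ) :
    Fin K → ℝ :=
  fun j => w j + exp3pGamma K T / (3 * K) *
    ((if j = x then r / p.1 j else 0) + exp3pAlpha K T δ / (p.1 j * √(K * T)))

/-! ### The dual regret minimizer: online mirror descent with negative entropy -/

/-- The set of dual variables `{l ∈ ℝ^m : l ≥ 0, ‖l‖₁ ≤ 1/ρ}`. -/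
def dualSet (m : ℕ) (ρ : ℝ) : Set (Fin m → ℝ) := {l | (∀ i, 0 ≤ l i) ∧ ∑ i, l i ≤ 1 / ρ}

/-- The slack coordinate `1/ρ - ‖l‖₁`, which identifies `dualSet m ρ` with the simplex of
nonnegative vectors with `m + 1` coordinates and total mass `1/ρ`. -/
def slack {m : ℕ} (ρ : ℝ) (l : Fin m → ℝ) : ℝ := 1 / ρ - ∑ i, l i

/-- The Bregman divergence of the negative entropy `∑ᵢ lᵢ log lᵢ` (slack coordinate included)
on the dual set. -/
def entropyDiv {m : ℕ} (ρ : ℝ) (l l' : Fin m → ℝ) : ℝ :=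
  ∑ i, l i * Real.log (l i / l' i) + slack ρ l * Real.log (slack ρ l / slack ρ l')

/-- The initial point of mirror descent: the minimizer of the negative entropy. -/
def omdInit (m : ℕ) (ρ : ℝ) : Fin m → ℝ := fun _ => 1 / (ρ * (m + 1))

/-- One step of entropic mirror descent with step size `η` for the linear utility
`l ↦ ∑ i, l i * g i`; see `isMaxOn_omdStep`. -/
def omdStep {m : ℕ} (ρ η : ℝ) (l g : Fin m → ℝ) : Fin m → ℝ :=
  fun i => 1 / ρ * (l i * Real.exp (η * g i)) /
    (slack ρ l + ∑ j, l j * Real.exp (η * g j))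

/-- The step size `√(log (m+1) / T)`. -/
def omdRate (m T : ℕ) : ℝ := √(Real.log (m + 1) / T)

/-! ### The meta-algorithm -/

/-- What the dual minimizer is told about the costs of the current round: the expected costs of
the mixture `ξₜ` of the primal minimizer, or the realized costs of the arm `xₜ` that was played. -/
inductive DualFeedback where
  | expected
  | realized

/-- The cost vector on which the dual update of the current round is based. -/
def dualCost {K m : ℕ} {v : Fin K} (fb : DualFeedback) (ξ : Mixture K) (g : Input K m v)
    (x : Fin K) (i : Fin m) : ℝ :=
  match fb with
  | .expected => expect ξ fun y => g.cost y i
  | .realized => g.cost x i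

/-- The state of the meta-algorithm at the beginning of a round. -/
structure State (K m : ℕ) where
  /-- the log-weights of EXP3.P -/
  logW : Fin K → ℝ
  /-- the dual variables chosen by mirror descent -/
  dual : Fin m → ℝ
  /-- the remaining budgets -/
  budget : Fin m → ℝ

/-- The utility `f(x) - ⟨l, c(x)⟩ ∈ [-1/ρ, 1]` of the primal player, mapped affinely to `[0,1]`. -/
def primalReward {K m : ℕ} {v : Fin K} (ρ : ℝ) (l : Fin m → ℝ) (g : Input K m v)
    (x : Fin K) : ℝ :=
  (g.reward x - ∑ i, l i * g.cost x i + 1 / ρ) / (1 + 1 / ρ)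

/-- The initial state, with the budget `ρ T` for every resource. -/
def initState (K m T : ℕ) (ρ δ : ℝ) : State K m where
  logW := exp3pInit K T δ
  dual := omdInit m ρ
  budget := fun _ => ρ * T

/-- The state after a round with request `g` in which the arm `x` was played. -/
def step {K m : ℕ} {v : Fin K} (T : ℕ) (ρ δ : ℝ) (fb : DualFeedback) (s : State K m)
    (g : Input K m v) (x : Fin K) : State K m where
  logW := exp3pUpdate T δ (exp3pMix v T s.logW) s.logW x (primalReward ρ s.dual g x)
  dual := omdStep ρ (omdRate m T) s.dual
    fun i => dualCost fb (exp3pMix v T s.logW) g x i - ρ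
  budget := fun i => s.budget i - g.cost x i

/-- The state after `t` rounds with requests `γ` and played arms `x`. -/
def stateAfter {K m : ℕ} {v : Fin K} (T : ℕ) (ρ δ : ℝ) (fb : DualFeedback) :
    ∀ t : ℕ, (Fin t → Input K m v) → (Fin t → Fin K) → State K m
  | 0, _, _ => initState K m T ρ δ
  | t + 1, γ, x =>
      step T ρ δ fb (stateAfter T ρ δ fb t (fun s => γ s.castSucc) fun s => x s.castSucc)
        (γ (Fin.last t)) (x (Fin.last t))

open Classical in
/-- The meta-algorithm with EXP3.P and entropic mirror descent: draw the arm from the EXP3.P mixture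
if every remaining budget is at least `1`, and play the void arm otherwise. -/
def metaAlgorithm {K m : ℕ} {v : Fin K} (T : ℕ) (ρ δ : ℝ) (fb : DualFeedback) : Strategy K m v :=
  fun t γ x =>
    if ∀ i, 1 ≤ (stateAfter T ρ δ fb t γ x).budget i then
      exp3pMix v T (stateAfter T ρ δ fb t γ x).logW
    else point v

/-! ### Consistency of the definitions -/

lemma weight_nonneg {K m T : ℕ} {v : Fin K} (ψ : Strategy K m v) (γ : Fin T → Input K m v)
    (x : Fin T → Fin K) : 0 ≤ weight ψ γ x :=
  Finset.prod_nonneg fun t _ => (ψ t (past γ t) (past x t)).2.1 (x t)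

lemma sum_weight {K m : ℕ} {v : Fin K} (ψ : Strategy K m v) :
    ∀ (T : ℕ) (γ : Fin T → Input K m v), ∑ x : Fin T → Fin K, weight ψ γ x = 1
  | 0, γ => by simp [weight]
  | T + 1, γ => by
      rw [← (Fin.snocEquiv fun _ : Fin (T + 1) => Fin K).sum_comp, Fintype.sum_prod_type,
        Finset.sum_comm]
      rw [← sum_weight ψ T fun s => γ s.castSucc]
      refine Finset.sum_congr rfl fun x _ => ?_
      have key : ∀ a : Fin K, weight ψ γ (Fin.snocEquiv (fun _ : Fin (T + 1) => Fin K) (a, x)) =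
          weight ψ (fun s => γ s.castSucc) x * (ψ T (fun s => γ s.castSucc) x).1 a := by
        intro a
        have hp : ∀ t : Fin T, (past (Fin.snoc (α := fun _ => Fin K) x a) t.castSucc) = past x t := by
          intro t
          funext s
          exact Fin.snoc_castSucc (α := fun _ => Fin K) a x (Fin.castLE t.isLt.le s)
        have hl : (past (Fin.snoc (α := fun _ => Fin K) x a) (Fin.last T)) = x := by
          funext s
          exact Fin.snoc_castSucc (α := fun _ => Fin K) a x s
        change weight ψ γ (Fin.snoc (α := fun _ => Fin K) x a) = _
        simp only [weight]
        rw [Fin.prod_univ_castSucc]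
        congr 1
        · refine Finset.prod_congr rfl fun t _ => ?_
          rw [hp, Fin.snoc_castSucc (α := fun _ => Fin K)]
          rfl
        · rw [hl, Fin.snoc_last (α := fun _ => Fin K)]
          rfl
      rw [Finset.sum_congr rfl fun a _ => key a, ← Finset.mul_sum,
        (ψ T (fun s => γ s.castSucc) x).2.2, mul_one]

instance isProbabilityMeasure_law {K m T : ℕ} {v : Fin K} (ψ : Strategy K m v)
    (γ : Fin T → Input K m v) : IsProbabilityMeasure (law ψ γ) := by
  constructor
  simp only [law, Measure.coe_finsetSum, Finset.sum_apply, Measure.smul_apply, measure_univ,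
    smul_eq_mul, mul_one]
  rw [← ENNReal.ofReal_sum_of_nonneg fun x _ => weight_nonneg ψ γ x, sum_weight, ENNReal.ofReal_one]

lemma slack_omdStep {m : ℕ} {ρ η : ℝ} {l g : Fin m → ℝ}
    (hZ : 0 < slack ρ l + ∑ j, l j * Real.exp (η * g j)) :
    slack ρ (omdStep ρ η l g) =
      1 / ρ * slack ρ l / (slack ρ l + ∑ j, l j * Real.exp (η * g j)) := by
  have h : ∑ i, omdStep ρ η l g i = 1 / ρ * (∑ j, l j * Real.exp (η * g j)) /
      (slack ρ l + ∑ j, l j * Real.exp (η * g j)) := by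
    simp only [omdStep]
    rw [← Finset.sum_div, ← Finset.mul_sum]
  rw [slack, h]
  generalize ∑ j, l j * Real.exp (η * g j) = S at *
  have := hZ.ne'
  rw [eq_div_iff this, sub_mul, div_mul_cancel₀ _ this]
  ring

/-- Mirror descent stays in the relative interior of the dual set. -/
lemma omdStep_pos {m : ℕ} {ρ η : ℝ} {l g : Fin m → ℝ} (hρ : 0 < ρ) (hl : ∀ i, 0 < l i)
    (hs : 0 < slack ρ l) :
    (∀ i, 0 < omdStep ρ η l g i) ∧ 0 < slack ρ (omdStep ρ η l g) := by
  have hZ : 0 < slack ρ l + ∑ j, l j * Real.exp (η * g j) :=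
    add_pos_of_pos_of_nonneg hs
      (Finset.sum_nonneg fun j _ => mul_nonneg (hl j).le (Real.exp_pos _).le)
  refine ⟨fun i => ?_, ?_⟩
  · have := hl i
    unfold omdStep
    positivity
  · rw [slack_omdStep hZ]
    positivity

lemma omdInit_pos {m : ℕ} {ρ : ℝ} (hρ : 0 < ρ) :
    (∀ i, 0 < omdInit m ρ i) ∧ 0 < slack ρ (omdInit m ρ) := by
  refine ⟨fun i => by unfold omdInit; positivity, ?_⟩
  have : slack ρ (omdInit m ρ) = 1 / (ρ * (m + 1)) := by
    simp only [slack, omdInit, Finset.sum_const, Finset.card_univ, Fintype.card_fin, nsmul_eq_mul]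
    field_simp
    ring
  rw [this]
  positivity

lemma sub_le_mul_log_div {u w : ℝ} (hu : 0 ≤ u) (hw : 0 < w) : u - w ≤ u * Real.log (u / w) := by
  rcases hu.eq_or_lt with rfl | hu
  · simp [hw.le]
  · have h := Real.log_le_sub_one_of_pos (div_pos hw hu)
    have h2 : Real.log (u / w) = -Real.log (w / u) := by rw [← Real.log_inv, inv_div]
    have h3 : u * (w / u) = w := by field_simp
    rw [h2]
    nlinarith [mul_le_mul_of_nonneg_left h hu.le]

lemma entropyDiv_nonneg {m : ℕ} {ρ : ℝ} {u l : Fin m → ℝ} (hu : u ∈ dualSet m ρ)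
    (hl : ∀ i, 0 < l i) (hs : 0 < slack ρ l) : 0 ≤ entropyDiv ρ u l := by
  have h1 : ∑ i, (u i - l i) ≤ ∑ i, u i * Real.log (u i / l i) :=
    Finset.sum_le_sum fun i _ => sub_le_mul_log_div (hu.1 i) (hl i)
  have hus : 0 ≤ slack ρ u := sub_nonneg.2 hu.2
  have h2 := sub_le_mul_log_div hus hs
  have h3 : ∑ i, (u i - l i) + (slack ρ u - slack ρ l) = 0 := by
    rw [Finset.sum_sub_distrib]
    simp only [slack]
    ring
  unfold entropyDiv
  linarith

/-- `omdStep` is the mirror-descent update: it maximizes `η ⟨u, g⟩ - D(u, l)` over the dual set,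
where `D` is the Bregman divergence of the negative entropy. -/
lemma isMaxOn_omdStep {m : ℕ} {ρ η : ℝ} {l g : Fin m → ℝ} (hρ : 0 < ρ) (hl : ∀ i, 0 < l i)
    (hs : 0 < slack ρ l) :
    omdStep ρ η l g ∈ dualSet m ρ ∧
      IsMaxOn (fun u => η * ∑ i, u i * g i - entropyDiv ρ u l) (dualSet m ρ)
        (omdStep ρ η l g) := by
  obtain ⟨hp, hsp⟩ := omdStep_pos (η := η) (g := g) hρ hl hs
  have hmem : omdStep ρ η l g ∈ dualSet m ρ := ⟨fun i => (hp i).le, (sub_pos.1 hsp).le⟩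
  refine ⟨hmem, ?_⟩
  have hZ : 0 < slack ρ l + ∑ j, l j * Real.exp (η * g j) :=
    add_pos_of_pos_of_nonneg hs
      (Finset.sum_nonneg fun j _ => mul_nonneg (hl j).le (Real.exp_pos _).le)
  have hslack := slack_omdStep (ρ := ρ) hZ
  have hstep : ∀ i, omdStep ρ η l g i = 1 / ρ * (l i * Real.exp (η * g i)) /
    (slack ρ l + ∑ j, l j * Real.exp (η * g j)) := fun _ => rfl
  generalize omdStep ρ η l g = n at *
  generalize slack ρ l + ∑ j, l j * Real.exp (η * g j) = Z at *
  have key : ∀ u ∈ dualSet m ρ, η * ∑ i, u i * g i - entropyDiv ρ u l =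
      Real.log (ρ * Z) / ρ - entropyDiv ρ u n := by
    intro u hu
    have hi : ∀ i, u i * Real.log (u i / n i) =
        u i * Real.log (u i / l i) + (Real.log (ρ * Z) * u i - η * (u i * g i)) := by
      intro i
      rcases (hu.1 i).eq_or_lt with h | h
      · simp [← h]
      · have e : u i / n i = u i / l i * ((ρ * Z) / Real.exp (η * g i)) := by
          rw [hstep i]
          have := (hl i).ne'
          have := (Real.exp_pos (η * g i)).ne'
          field_simp
        rw [e, Real.log_mul (div_pos h (hl i)).ne' (by positivity),
          Real.log_div (mul_pos hρ hZ).ne' (Real.exp_pos _).ne', Real.log_exp]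
        ring
    have h0 : slack ρ u * Real.log (slack ρ u / slack ρ n) =
        slack ρ u * Real.log (slack ρ u / slack ρ l) + Real.log (ρ * Z) * slack ρ u := by
      have hus : 0 ≤ slack ρ u := sub_nonneg.2 hu.2
      rcases hus.eq_or_lt with h | h
      · simp [← h]
      · have e : slack ρ u / slack ρ n = slack ρ u / slack ρ l * (ρ * Z) := by
          rw [hslack]
          field_simp
        rw [e, Real.log_mul (div_pos h hs).ne' (by positivity)]
        ring
    have hsum : ∑ i, u i + slack ρ u = 1 / ρ := by simp [slack]
    simp only [entropyDiv]
    rw [h0, Finset.sum_congr rfl fun i _ => hi i, Finset.sum_add_distrib, Finset.sum_sub_distrib,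
      ← Finset.mul_sum, ← Finset.mul_sum]
    have : Real.log (ρ * Z) / ρ =
        Real.log (ρ * Z) * ∑ i, u i + Real.log (ρ * Z) * slack ρ u := by
      rw [← mul_add, hsum]
      ring
    rw [this]
    ring
  intro u hu
  have hself : entropyDiv ρ n n = 0 := by
    simp only [entropyDiv]
    rw [div_self hsp.ne', Real.log_one, mul_zero, add_zero]
    refine Finset.sum_eq_zero fun i _ => ?_
    rw [div_self (hp i).ne', Real.log_one, mul_zero]
  have := entropyDiv_nonneg hu hp hsp
  simp only [Set.mem_ofPred_eq]
  rw [key u hu, key n hmem, hself]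
  linarith

end

end BwK

namespace BwK

noncomputable section

/-! ### Elementary inequalities -/

/-! The algorithm plays the Lagrangian game with payoff f(x) + ⟨λ, ρ - c(x)⟩: EXP3.P chooses arms,
mirror descent chooses λ. Let τ be the number of active rounds; budgets only decrease, so these form
an initial segment. Three estimates hold on good runs, each with error of order rate/ρ, where rate
is `bwkRate`. EXP3.P makes the realized sum of f - ⟨λ, c⟩ over active rounds almost as large as that
of any mixture ξ (`exp3p_regret`). Mirror descent competes with the vertices of the dual set
(`omd_regret`). The realized costs stay close to the costs reported to the dual player.

Stopping is paid for by the dual comparator (`exists_stop`). If the run stops early, some resource i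
has consumed more than ρT - 1, and the vertex eᵢ/ρ gains at least T - τ - 1/ρ; otherwise the origin
serves. Hence, for every ξ, the reward is at least the sum of the Lagrangians of ξ over active
rounds, plus 1 for each inactive round, minus O(rate/ρ): `lagrangian_le_totalReward`. Since a round
never earns more than 1, the inactive rounds cost nothing.

Adversarial case: insert ρξ + (1 - ρ)∅. Its expected cost is at most ρ in every round, so its
Lagrangian is at least ρ f(ξ) for every λ (`le_lagrangian_diluted`). Division by ρ gives the factor
α, and the benchmark is bounded by its reward without any budget.

Stochastic case: the occupation vector of a near-optimal dynamic policy, suitably rescaled, is a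
fixed mixture with mean cost at most ρ that loses only 1/ρ + 1 (`exists_mixture_optDP_le`). Its
Lagrangian has conditional mean at least its mean reward, because each λ is determined before the
request is drawn.

All deviations are controlled by exponential supermartingales whose increments vanish in inactive
rounds. Their normalized sum (`badness`, plus one term for random requests) has expectation at most
δ, and the estimates hold wherever it is below 1 (`le_law_of_forall`). The argument runs under
`Regime`, where T is at least 100 K log(Tm/δ); this keeps every tuning parameter in its admissible
range. For shorter horizons the claimed bounds exceed T. -/

lemma exp_le_one_add_add_sq {z : ℝ} (hz : z ≤ 1) : Real.exp z ≤ 1 + z + z ^ 2 := by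
  rcases le_total (-1) z with h | h
  · have := (abs_le.1 (Real.abs_exp_sub_one_sub_id_le (abs_le.2 ⟨h, hz⟩))).2
    linarith
  -- Here z + z² = z (z + 1) is nonnegative. No lower bound on z is needed, which matters for
  -- importance-weighted estimates.
  · have : Real.exp z ≤ 1 := Real.exp_le_one_iff.2 (by linarith)
    nlinarith

/-- The exponential moment of a variable that is bounded above by `1` and has mean `≤ 0`. -/
lemma sum_mul_exp_le {ι : Type*} [Fintype ι] {p z : ι → ℝ} {q : ℝ} (hp : ∀ i, 0 ≤ p i)
    (hp1 : ∑ i, p i = 1) (hz : ∀ i, z i ≤ 1) (hm : ∑ i, p i * z i ≤ 0)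
    (hq : ∑ i, p i * z i ^ 2 ≤ q) : ∑ i, p i * Real.exp (z i) ≤ Real.exp q := by
  have h1 : ∑ i, p i * Real.exp (z i) ≤ ∑ i, (p i + p i * z i + p i * z i ^ 2) :=
    Finset.sum_le_sum fun i _ => by
      have := mul_le_mul_of_nonneg_left (exp_le_one_add_add_sq (hz i)) (hp i)
      linarith
  rw [Finset.sum_add_distrib, Finset.sum_add_distrib, hp1] at h1
  have := Real.add_one_le_exp q
  linarith

/-! ### Regret of EXP3.P -/

/-- The increment of the log-weights of EXP3.P in units of `γ / (3 K)`: the importance-weighted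
reward plus the confidence bonus. -/
def exp3pScore {K : ℕ} (T : ℕ) (δ : ℝ) (p : Mixture K) (x : Fin K) (r : ℝ) (j : Fin K) : ℝ :=
  (if j = x then r / p.1 j else 0) + exp3pAlpha K T δ / (p.1 j * √(K * T))

lemma exp3pUpdate_eq {K : ℕ} (T : ℕ) (δ : ℝ) (p : Mixture K) (w : Fin K → ℝ) (x : Fin K) (r : ℝ)
    (j : Fin K) :
    exp3pUpdate T δ p w x r j = w j + exp3pGamma K T / (3 * K) * exp3pScore T δ p x r j := rfl

lemma exp3pAlpha_nonneg (K T : ℕ) (δ : ℝ) : 0 ≤ exp3pAlpha K T δ := by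
  unfold exp3pAlpha; positivity

lemma exp3pGamma_div_le {K : ℕ} (v : Fin K) (T : ℕ) (w : Fin K → ℝ) (j : Fin K) :
    exp3pGamma K T / K ≤ (exp3pMix v T w).1 j := by
  have h1 := exp3pGamma_le K T
  have : 0 ≤ (1 - exp3pGamma K T) * (Real.exp (w j) / ∑ k, Real.exp (w k)) :=
    mul_nonneg (by linarith)
      (div_nonneg (Real.exp_pos _).le (Finset.sum_nonneg fun _ _ => (Real.exp_pos _).le))
  change _ ≤ _ + _
  linarith

lemma exp3pMix_pos {K : ℕ} (v : Fin K) (T : ℕ) (w : Fin K → ℝ) (j : Fin K) :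
    0 < (exp3pMix v T w).1 j := by
  have h0 := exp3pGamma_nonneg K T
  have h1 := exp3pGamma_le K T
  have hS : 0 < ∑ k, Real.exp (w k) :=
    Finset.sum_pos (fun _ _ => Real.exp_pos _) ⟨v, Finset.mem_univ v⟩
  have : 0 < (1 - exp3pGamma K T) * (Real.exp (w j) / ∑ k, Real.exp (w k)) :=
    mul_pos (by linarith) (div_pos (Real.exp_pos _) hS)
  change 0 < _ + _
  positivity

lemma exp3pScore_nonneg {K : ℕ} (T : ℕ) (δ : ℝ) (p : Mixture K) (x : Fin K) {r : ℝ} (hr : 0 ≤ r)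
    (j : Fin K) : 0 ≤ exp3pScore T δ p x r j := by
  have := p.2.1 j
  have := exp3pAlpha_nonneg K T δ
  unfold exp3pScore
  split_ifs <;> positivity

/-- The estimate and the bonus are each at most 1/p, and the exploration floor p ≥ γ/K makes the
increment at most 2/3. This admits the quadratic bound on the exponential in the potential argument.
-/
lemma exp3pUpdate_le_one {K T : ℕ} (v : Fin K) {δ r : ℝ} (hγ : 0 < exp3pGamma K T)
    (hT : 0 < T) (ha : exp3pAlpha K T δ ≤ √(K * T)) (hr1 : r ≤ 1)
    (w : Fin K → ℝ) (x j : Fin K) :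
    exp3pGamma K T / (3 * K) * exp3pScore T δ (exp3pMix v T w) x r j ≤ 1 := by
  have hK : (0 : ℝ) < K := by exact_mod_cast v.pos
  have hT' : (0 : ℝ) < T := by exact_mod_cast hT
  have hp := exp3pMix_pos v T w j
  have hp' := exp3pGamma_div_le v T w j
  have hs : 0 < √((K : ℝ) * T) := by positivity
  have ha0 := exp3pAlpha_nonneg K T δ
  unfold exp3pScore
  generalize (exp3pMix v T w).1 j = p at *
  have h1 : (if j = x then r / p else 0) ≤ 1 / p := by
    split_ifs
    · gcongr
    · positivity
  have h2 : exp3pAlpha K T δ / (p * √(K * T)) ≤ 1 / p := by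
    rw [div_le_div_iff₀ (by positivity) hp]
    nlinarith
  have h3 : exp3pGamma K T / K / p ≤ 1 := (div_le_one hp).2 hp'
  calc _ ≤ exp3pGamma K T / (3 * K) * (1 / p + 1 / p) := by gcongr
    _ = 2 / 3 * (exp3pGamma K T / K / p) := by field_simp; ring
    _ ≤ 1 := by linarith

/-- The importance weight cancels the probability of the played arm, so the first-order term of the
potential is the received reward itself and not an expectation. -/
lemma sum_exp3pMix_mul_ite {K T : ℕ} (v : Fin K) (w : Fin K → ℝ) (x : Fin K) (r : ℝ) :
    ∑ j, (exp3pMix v T w).1 j * (if j = x then r / (exp3pMix v T w).1 j else 0) = r := by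
  have hp := (exp3pMix_pos v T w x).ne'
  simp only [mul_ite, mul_zero, Finset.sum_ite_eq', Finset.mem_univ, if_true]
  field_simp

/-- One step of the potential argument for EXP3.P. -/
lemma log_sum_exp_exp3pUpdate_le {K T : ℕ} (v : Fin K) {δ r : ℝ} (hγ : 0 < exp3pGamma K T)
    (hT : 0 < T) (ha : exp3pAlpha K T δ ≤ √(K * T)) (hr0 : 0 ≤ r) (hr1 : r ≤ 1)
    (w : Fin K → ℝ) (x : Fin K) :
    (1 - exp3pGamma K T) *
        (Real.log (∑ j, Real.exp (exp3pUpdate T δ (exp3pMix v T w) w x r j)) -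
          Real.log (∑ j, Real.exp (w j))) ≤
      exp3pGamma K T / (3 * K) * (r + exp3pAlpha K T δ * √(K * T) / T +
        2 / 3 * exp3pGamma K T / K * ∑ j, exp3pScore T δ (exp3pMix v T w) x r j +
          2 / 3 * exp3pAlpha K T δ ^ 2 / T) := by
  have hK : (0 : ℝ) < K := by exact_mod_cast v.pos
  have hT' : (0 : ℝ) < T := by exact_mod_cast hT
  have ha0 := exp3pAlpha_nonneg K T δ
  have hγ1 := exp3pGamma_le K T
  have hS : 0 < ∑ k, Real.exp (w k) :=
    Finset.sum_pos (fun _ _ => Real.exp_pos _) ⟨v, Finset.mem_univ v⟩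
  have hz1 := exp3pUpdate_le_one v hγ hT ha hr1 w x
  have hz0 : ∀ j, 0 ≤ exp3pGamma K T / (3 * K) * exp3pScore T δ (exp3pMix v T w) x r j :=
    fun j => mul_nonneg (by positivity) (exp3pScore_nonneg T δ _ x hr0 j)
  have hpp := exp3pMix_pos v T w
  have hpl := exp3pGamma_div_le v T w
  have hmean := sum_exp3pMix_mul_ite (T := T) v w x r
  have hs : 0 < √((K : ℝ) * T) := by positivity
  have hss : √((K : ℝ) * T) ^ 2 = K * T := Real.sq_sqrt (by positivity)
  have hq : ∀ j, (1 - exp3pGamma K T) * (Real.exp (w j) / ∑ k, Real.exp (w k)) ≤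
      (exp3pMix v T w).1 j := fun j => by
    change _ ≤ _ + _
    have : 0 ≤ exp3pGamma K T / K := by positivity
    linarith
  simp only [exp3pUpdate_eq, Real.exp_add]
  set z : Fin K → ℝ := fun j =>
    exp3pGamma K T / (3 * K) * exp3pScore T δ (exp3pMix v T w) x r j with hz
  change (1 - exp3pGamma K T) * (Real.log (∑ j, Real.exp (w j) * Real.exp (z j)) - _) ≤ _
  have hS2 : 0 < ∑ j, Real.exp (w j) * Real.exp (z j) :=
    Finset.sum_pos (fun _ _ => by positivity) ⟨v, Finset.mem_univ v⟩
  have hlog : Real.log (∑ j, Real.exp (w j) * Real.exp (z j)) - Real.log (∑ j, Real.exp (w j)) ≤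
      ∑ j, Real.exp (w j) / (∑ k, Real.exp (w k)) * (z j + z j ^ 2) := by
    rw [← Real.log_div hS2.ne' hS.ne']
    refine (Real.log_le_sub_one_of_pos (div_pos hS2 hS)).trans ?_
    have h1 : (1 : ℝ) = ∑ j, Real.exp (w j) / (∑ k, Real.exp (w k)) := by
      rw [← Finset.sum_div, div_self hS.ne']
    rw [Finset.sum_div]
    conv_lhs => rw [h1]
    rw [← Finset.sum_sub_distrib]
    refine Finset.sum_le_sum fun j _ => ?_
    have := exp_le_one_add_add_sq (hz1 j)
    have h0 : 0 ≤ Real.exp (w j) / (∑ k, Real.exp (w k)) := by positivity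
    calc _ = Real.exp (w j) / (∑ k, Real.exp (w k)) * (Real.exp (z j) - 1) := by ring
      _ ≤ _ := mul_le_mul_of_nonneg_left (by linarith) h0
  have hstep : (1 - exp3pGamma K T) * ∑ j, Real.exp (w j) / (∑ k, Real.exp (w k)) * (z j + z j ^ 2)
      ≤ ∑ j, (exp3pMix v T w).1 j * (z j + z j ^ 2) := by
    rw [Finset.mul_sum]
    refine Finset.sum_le_sum fun j _ => ?_
    rw [← mul_assoc]
    exact mul_le_mul_of_nonneg_right (hq j) (add_nonneg (hz0 j) (sq_nonneg _))
  have hfirst : ∀ j, (exp3pMix v T w).1 j * (z j + z j ^ 2) ≤ exp3pGamma K T / (3 * K) *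
      ((exp3pMix v T w).1 j * (if j = x then r / (exp3pMix v T w).1 j else 0) +
        exp3pAlpha K T δ * √(K * T) / T / K +
        2 / 3 * exp3pGamma K T / K * exp3pScore T δ (exp3pMix v T w) x r j +
        2 / 3 * exp3pAlpha K T δ ^ 2 / T / K) := by
    intro j
    have hx0 : 0 ≤ (if j = x then r / (exp3pMix v T w).1 j else 0) := by
      have := (hpp j).le
      split_ifs <;> positivity
    have hx1 : (exp3pMix v T w).1 j * (if j = x then r / (exp3pMix v T w).1 j else 0) ≤ 1 := by
      have := (hpp j).ne'
      split_ifs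
      · field_simp; exact hr1
      · simp
    have hpj := hpp j
    have hplj := hpl j
    simp only [hz, exp3pScore]
    generalize (if j = x then r / (exp3pMix v T w).1 j else 0) = X at *
    generalize (exp3pMix v T w).1 j = p at *
    generalize exp3pAlpha K T δ = a at *
    generalize exp3pGamma K T = β at *
    generalize √((K : ℝ) * T) = s at *
    have e1 : s / T / K = 1 / s := by field_simp; linarith
    have e2 : p * (β / (3 * K) * (X + a / (p * s))) =
        β / (3 * K) * (p * X + a * (s / T / K)) := by rw [e1]; field_simp
    have e3 : p * (β / (3 * K) * (X + a / (p * s))) ^ 2 ≤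
        β / (3 * K) * (2 / 3 * β / K * X + 2 / 3 * a ^ 2 / T / K) := by
      -- One factor p X ≤ 1 absorbs the importance weight in the quadratic term. For the bonus, the
      -- next bound uses the exploration floor instead.
      have t1 : p * X ^ 2 ≤ X := by nlinarith
      have t2 : p * (a / (p * s)) ^ 2 * β ≤ a ^ 2 / T := by
        have : p * (a / (p * s)) ^ 2 * β = a ^ 2 / T * (β / K / p) := by
          rw [div_pow, mul_pow, hss]; field_simp
        rw [this]
        exact mul_le_of_le_one_right (by positivity) ((div_le_one hpj).2 hplj)
      have t3 : (X + a / (p * s)) ^ 2 ≤ 2 * X ^ 2 + 2 * (a / (p * s)) ^ 2 := by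
        nlinarith [sq_nonneg (X - a / (p * s))]
      calc p * (β / (3 * K) * (X + a / (p * s))) ^ 2
          = β / (3 * K) * (1 / (3 * K)) * (β * (p * (X + a / (p * s)) ^ 2)) := by ring
        _ ≤ β / (3 * K) * (1 / (3 * K)) * (β * (p * (2 * X ^ 2 + 2 * (a / (p * s)) ^ 2))) := by
            gcongr
        _ = β / (3 * K) * (1 / (3 * K)) *
            (2 * β * (p * X ^ 2) + 2 * (p * (a / (p * s)) ^ 2 * β)) := by ring
        _ ≤ β / (3 * K) * (1 / (3 * K)) * (2 * β * X + 2 * (a ^ 2 / T)) := by gcongr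
        _ = _ := by field_simp
    -- The quadratic term yields only the estimate `X`; this nonnegative multiple of the bonus
    -- completes it to the full score, which can then be accumulated over rounds.
    have e4 : 0 ≤ β / (3 * K) * (2 / 3 * β / K * (a / (p * s))) := by positivity
    calc p * (β / (3 * K) * (X + a / (p * s)) + (β / (3 * K) * (X + a / (p * s))) ^ 2)
        = p * (β / (3 * K) * (X + a / (p * s))) +
          p * (β / (3 * K) * (X + a / (p * s))) ^ 2 := by ring
      _ ≤ β / (3 * K) * (p * X + a * (s / T / K)) +
          β / (3 * K) * (2 / 3 * β / K * X + 2 / 3 * a ^ 2 / T / K) +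
          β / (3 * K) * (2 / 3 * β / K * (a / (p * s))) := by rw [e2]; linarith
      _ = _ := by ring
  have hsum := Finset.sum_le_sum fun j (_ : j ∈ Finset.univ) => hfirst j
  rw [← Finset.mul_sum, Finset.sum_add_distrib, Finset.sum_add_distrib, Finset.sum_add_distrib,
    hmean, ← Finset.mul_sum] at hsum
  simp only [Finset.sum_const, Finset.card_univ, Fintype.card_fin, nsmul_eq_mul] at hsum
  rw [mul_div_cancel₀ _ hK.ne', mul_div_cancel₀ _ hK.ne'] at hsum
  calc _ ≤ (1 - exp3pGamma K T) *
        ∑ j, Real.exp (w j) / (∑ k, Real.exp (w k)) * (z j + z j ^ 2) :=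
        mul_le_mul_of_nonneg_left hlog (by linarith)
    _ ≤ _ := hstep
    _ ≤ _ := hsum

/-- The regret of EXP3.P against quantities `G j` that are dominated by the accumulated scores. -/
lemma exp3p_regret {K T : ℕ} (v : Fin K) {δ : ℝ} (hγ : 0 < exp3pGamma K T)
    (hT : 0 < T) (ha : exp3pAlpha K T δ ≤ √(K * T)) {w : ℕ → Fin K → ℝ} {x : ℕ → Fin K}
    {r : ℕ → ℝ} (hr0 : ∀ t, 0 ≤ r t) (hr1 : ∀ t, r t ≤ 1) (hw0 : w 0 = exp3pInit K T δ)
    (hw : ∀ t, w (t + 1) = exp3pUpdate T δ (exp3pMix v T (w t)) (w t) (x t) (r t))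
    {n : ℕ} (hn : n ≤ T) {G : Fin K → ℝ} (hGT : ∀ j, G j ≤ T)
    (hG : ∀ j, G j ≤ ∑ t ∈ Finset.range n, exp3pScore T δ (exp3pMix v T (w t)) (x t) (r t) j +
      exp3pAlpha K T δ * √(K * T) / 4) (j : Fin K) :
    G j - ∑ t ∈ Finset.range n, r t ≤
      5 / 4 * (exp3pAlpha K T δ * √(K * T)) + 2 / 3 * exp3pAlpha K T δ ^ 2 +
        3 * K * Real.log K / exp3pGamma K T + 5 / 3 * exp3pGamma K T * T := by
  have hK : (0 : ℝ) < K := by exact_mod_cast v.pos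
  have hK1 : (1 : ℝ) ≤ K := by exact_mod_cast v.pos
  have hT' : (0 : ℝ) < T := by exact_mod_cast hT
  have hn' : (n : ℝ) ≤ T := by exact_mod_cast hn
  have ha0 := exp3pAlpha_nonneg K T δ
  have hγ1 := exp3pGamma_le K T
  have hlogK : 0 ≤ Real.log K := Real.log_nonneg hK1
  set Y : Fin K → ℝ := fun j =>
    ∑ t ∈ Finset.range n, exp3pScore T δ (exp3pMix v T (w t)) (x t) (r t) j with hY
  -- The initial log-weights do not depend on the arm, so `v` is an arbitrary index. They cancel in
  -- the final comparison.
  have hwn : ∀ n j, w n j = exp3pInit K T δ v + exp3pGamma K T / (3 * K) *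
      ∑ t ∈ Finset.range n, exp3pScore T δ (exp3pMix v T (w t)) (x t) (r t) j := by
    intro n j
    induction n with
    | zero => simp [hw0, exp3pInit]
    | succ n ih => rw [hw, exp3pUpdate_eq, ih, Finset.sum_range_succ]; ring
  have hpot : ∀ n, (1 - exp3pGamma K T) *
      (Real.log (∑ j, Real.exp (w n j)) - Real.log (∑ j, Real.exp (w 0 j))) ≤
      exp3pGamma K T / (3 * K) * (∑ t ∈ Finset.range n, r t +
        n * (exp3pAlpha K T δ * √(K * T) / T) + 2 / 3 * exp3pGamma K T / K *
          ∑ j, ∑ t ∈ Finset.range n, exp3pScore T δ (exp3pMix v T (w t)) (x t) (r t) j +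
        n * (2 / 3 * exp3pAlpha K T δ ^ 2 / T)) := by
    intro n
    induction n with
    | zero => simp
    | succ n ih =>
      have := log_sum_exp_exp3pUpdate_le v hγ hT ha (hr0 n) (hr1 n) (w n) (x n)
      rw [← hw] at this
      simp only [Finset.sum_range_succ, Finset.sum_add_distrib]
      push_cast
      linarith
  -- The arm with the largest accumulated score bounds the log-sum-exp potential from below and the
  -- sum of all scores from above, so the second-order term can be absorbed into the left side.
  obtain ⟨i, -, hi⟩ := Finset.exists_max_image Finset.univ Y ⟨v, Finset.mem_univ v⟩
  have hYsum : ∑ j, Y j ≤ K * Y i := by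
    have := Finset.sum_le_card_nsmul Finset.univ Y (Y i) fun j hj => hi j hj
    simpa using this
  have hlow : exp3pInit K T δ v + exp3pGamma K T / (3 * K) * Y i ≤
      Real.log (∑ j, Real.exp (w n j)) := by
    rw [← hwn n i, Real.le_log_iff_exp_le
      (Finset.sum_pos (fun _ _ => Real.exp_pos _) ⟨v, Finset.mem_univ v⟩)]
    exact Finset.single_le_sum (f := fun j => Real.exp (w n j)) (fun j _ => (Real.exp_pos _).le)
      (Finset.mem_univ i)
  have hup : Real.log (∑ j, Real.exp (w 0 j)) = Real.log K + exp3pInit K T δ v := by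
    have : ∑ j, Real.exp (w 0 j) = K * Real.exp (exp3pInit K T δ v) := by
      rw [hw0]; simp [exp3pInit]
    rw [this, Real.log_mul hK.ne' (Real.exp_pos _).ne', Real.log_exp]
  have hmain := hpot n
  have hij : Y j ≤ Y i := hi j (Finset.mem_univ j)
  have hj : G j ≤ Y j + exp3pAlpha K T δ * √(K * T) / 4 := hG j
  have hjT := hGT j
  have hs0 : 0 ≤ exp3pAlpha K T δ * √(K * T) := by positivity
  change _ ≤ _ * (_ + _ + _ * ∑ j, Y j + _) at hmain
  rw [hup] at hmain
  generalize Real.log (∑ j, Real.exp (w n j)) = W at *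
  generalize exp3pInit K T δ v = w0 at *
  generalize exp3pAlpha K T δ * √(K * T) = A at *
  generalize exp3pAlpha K T δ = a at *
  generalize exp3pGamma K T = β at *
  generalize ∑ t ∈ Finset.range n, r t = R at *
  have h1 : n * (A / T) ≤ A := by
    rw [mul_div_assoc', div_le_iff₀ hT']; nlinarith
  have h2 : n * (2 / 3 * a ^ 2 / T) ≤ 2 / 3 * a ^ 2 := by
    rw [mul_div_assoc', div_le_iff₀ hT']; nlinarith [sq_nonneg a]
  have h3 : 2 / 3 * β / K * ∑ j, Y j ≤ 2 / 3 * β * Y i := by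
    calc _ ≤ 2 / 3 * β / K * (K * Y i) := by gcongr
      _ = _ := by field_simp
  have h4 : (1 - β) * (β / (3 * K) * Y i - Real.log K) ≤
      β / (3 * K) * (R + A + 2 / 3 * β * Y i + 2 / 3 * a ^ 2) := by
    calc _ ≤ (1 - β) * (W - (Real.log K + w0)) :=
          mul_le_mul_of_nonneg_left (by linarith) (by linarith)
      _ ≤ _ := hmain
      _ ≤ _ := by gcongr
  have h5 : (1 - β) * Y i ≤ R + A + 2 / 3 * β * Y i + 2 / 3 * a ^ 2 + 3 * K * Real.log K / β := by
    have : β / (3 * K) * ((1 - β) * Y i) ≤ β / (3 * K) * (R + A + 2 / 3 * β * Y i + 2 / 3 * a ^ 2 +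
        3 * K * Real.log K / β) := by
      have e : β / (3 * K) * (3 * K * Real.log K / β) = Real.log K := by field_simp
      rw [mul_add (β / (3 * K)), e]
      nlinarith
    exact le_of_mul_le_mul_left this (by positivity)
  -- The factor collects 1 - β and the absorbed 2β/3; it is nonnegative because of the cap 3/5 on
  -- the exploration rate.
  have h6 : (1 - 5 / 3 * β) * (G j - A / 4) ≤ (1 - 5 / 3 * β) * Y i :=
    mul_le_mul_of_nonneg_left (by linarith) (by linarith)
  -- The multiplicative loss becomes additive because the comparator earns at most T.
  have h7 : β * G j ≤ β * T := by gcongr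
  have h8 : 0 ≤ β * A := by positivity
  linarith

/-! ### Regret of entropic mirror descent -/

/-- The vertices of the dual set: the origin and the multiples `eᵢ / ρ` of the basis vectors. -/
def dualVertex {m : ℕ} (ρ : ℝ) : Option (Fin m) → Fin m → ℝ
  | none => 0
  | some i => Pi.single i (1 / ρ)

lemma dualVertex_nonneg {m : ℕ} {ρ : ℝ} (hρ : 0 < ρ) (o : Option (Fin m)) (i : Fin m) :
    0 ≤ dualVertex ρ o i := by
  cases o with
  | none => simp [dualVertex]
  | some k =>
    simp only [dualVertex, Pi.single_apply]
    split_ifs <;> positivity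

lemma sum_dualVertex_le {m : ℕ} {ρ : ℝ} (hρ : 0 < ρ) (o : Option (Fin m)) :
    ∑ i, dualVertex ρ o i ≤ 1 / ρ := by
  cases o with
  | none => simp [dualVertex, hρ.le]
  | some k => simp [dualVertex]

/-- Expand each exponential to second order. The total mass, slack included, is 1/ρ, so after
multiplication by ρ the constant term is 1 and log y ≤ y - 1 removes it. The slack coordinate has
gain 0. -/
lemma log_partition_le {m : ℕ} {ρ η : ℝ} {l g : Fin m → ℝ} (hρ : 0 < ρ) (hη : 0 < η) (hη1 : η ≤ 1)
    (hl : ∀ i, 0 < l i) (hs : 0 < slack ρ l) (hg : ∀ i, |g i| ≤ 1) :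
    Real.log (ρ * (slack ρ l + ∑ j, l j * Real.exp (η * g j))) ≤
      η * ρ * ∑ j, l j * g j + η ^ 2 := by
  have hZ : 0 < slack ρ l + ∑ j, l j * Real.exp (η * g j) :=
    add_pos_of_pos_of_nonneg hs
      (Finset.sum_nonneg fun j _ => mul_nonneg (hl j).le (Real.exp_pos _).le)
  have h1 : ∑ j, l j * Real.exp (η * g j) ≤ ∑ j, (l j + η * (l j * g j) + η ^ 2 * l j) := by
    refine Finset.sum_le_sum fun j _ => ?_
    have hb := abs_le.1 (hg j)
    have h2 : Real.exp (η * g j) ≤ 1 + η * g j + (η * g j) ^ 2 :=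
      exp_le_one_add_add_sq (by nlinarith)
    have h3 : (η * g j) ^ 2 ≤ η ^ 2 := by
      rw [mul_pow]
      exact mul_le_of_le_one_right (sq_nonneg _) ((sq_le_one_iff_abs_le_one _).2 (hg j))
    have := mul_le_mul_of_nonneg_left (h2.trans (add_le_add_right h3 _)) (hl j).le
    linarith
  rw [Finset.sum_add_distrib, Finset.sum_add_distrib, ← Finset.mul_sum, ← Finset.mul_sum] at h1
  have h4 : ρ * (slack ρ l + ∑ j, l j) = 1 := by
    simp only [slack]; field_simp; ring
  have h5 : ρ * ∑ j, l j ≤ 1 := by nlinarith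
  refine (Real.log_le_sub_one_of_pos (mul_pos hρ hZ)).trans ?_
  have h6 := mul_le_mul_of_nonneg_left h1 hρ.le
  have h7 : η ^ 2 * (ρ * ∑ j, l j) ≤ η ^ 2 * 1 := by gcongr
  linarith

/-- The regret of entropic mirror descent against the vertices of the dual set. -/
lemma omd_regret {m : ℕ} {ρ η : ℝ} (hρ : 0 < ρ) (hη : 0 < η) (hη1 : η ≤ 1) {l g : ℕ → Fin m → ℝ}
    (hl0 : l 0 = omdInit m ρ) (hl : ∀ t, l (t + 1) = omdStep ρ η (l t) (g t))
    (hg : ∀ t i, |g t i| ≤ 1) (n : ℕ) (o : Option (Fin m)) :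
    ∑ t ∈ Finset.range n, ∑ i, (dualVertex ρ o i - l t i) * g t i ≤
      1 / ρ * (Real.log (m + 1) / η + n * η) := by
  have hpos : ∀ t, (∀ i, 0 < l t i) ∧ 0 < slack ρ (l t) := by
    intro t
    induction t with
    | zero => rw [hl0]; exact omdInit_pos hρ
    | succ t ih => rw [hl]; exact omdStep_pos hρ ih.1 ih.2
  have hZ : ∀ t, 0 < slack ρ (l t) + ∑ j, l t j * Real.exp (η * g t j) := fun t =>
    add_pos_of_pos_of_nonneg (hpos t).2
      (Finset.sum_nonneg fun j _ => mul_nonneg ((hpos t).1 j).le (Real.exp_pos _).le)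
  have hm : (0 : ℝ) < m + 1 := by positivity
  have hlog : ∑ t ∈ Finset.range n,
      Real.log (ρ * (slack ρ (l t) + ∑ j, l t j * Real.exp (η * g t j))) ≤
      η * ρ * ∑ t ∈ Finset.range n, ∑ j, l t j * g t j + n * η ^ 2 := by
    have := Finset.sum_le_sum fun t (_ : t ∈ Finset.range n) =>
      log_partition_le hρ hη hη1 (hpos t).1 (hpos t).2 (hg t)
    rw [Finset.sum_add_distrib, ← Finset.mul_sum] at this
    simpa using this
  -- The normalized mass of the coordinate belonging to the vertex starts at 1/(m+1). Each update
  -- multiplies it by exp(η g) and divides it by the partition function, with g = 0 for the slack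
  -- coordinate. It never exceeds 1, so its logarithm gives the bound.
  have hmain : η * (ρ * ∑ t ∈ Finset.range n, ∑ i, dualVertex ρ o i * g t i) ≤ Real.log (m + 1) +
      ∑ t ∈ Finset.range n,
        Real.log (ρ * (slack ρ (l t) + ∑ j, l t j * Real.exp (η * g t j))) := by
    cases o with
    | none =>
      have h : ∀ n, Real.log (ρ * slack ρ (l n)) = -Real.log (m + 1) - ∑ t ∈ Finset.range n,
          Real.log (ρ * (slack ρ (l t) + ∑ j, l t j * Real.exp (η * g t j))) := by
        intro n
        induction n with
        | zero =>
          have : ρ * slack ρ (l 0) = ((m : ℝ) + 1)⁻¹ := by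
            rw [hl0]
            simp only [slack, omdInit, Finset.sum_const, Finset.card_univ, Fintype.card_fin,
              nsmul_eq_mul]
            field_simp
            ring
          rw [this, Real.log_inv]; simp
        | succ n ih =>
          have e : ρ * slack ρ (l (n + 1)) = ρ * slack ρ (l n) /
              (ρ * (slack ρ (l n) + ∑ j, l n j * Real.exp (η * g n j))) := by
            rw [hl, slack_omdStep (hZ n)]; field_simp
          rw [e, Real.log_div (mul_pos hρ (hpos n).2).ne' (mul_pos hρ (hZ n)).ne', ih,
            Finset.sum_range_succ]
          ring
      have h1 : ρ * slack ρ (l n) ≤ 1 := by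
        have : 0 ≤ ∑ i, l n i := Finset.sum_nonneg fun i _ => ((hpos n).1 i).le
        simp only [slack]
        rw [mul_sub, mul_one_div_cancel hρ.ne']
        nlinarith
      have h2 := Real.log_nonpos (mul_pos hρ (hpos n).2).le h1
      rw [h] at h2
      simp only [dualVertex, Pi.zero_apply, zero_mul, Finset.sum_const_zero, mul_zero]
      linarith
    | some i =>
      have h : ∀ n, Real.log (ρ * l n i) = -Real.log (m + 1) + η * ∑ t ∈ Finset.range n, g t i -
          ∑ t ∈ Finset.range n,
            Real.log (ρ * (slack ρ (l t) + ∑ j, l t j * Real.exp (η * g t j))) := by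
        intro n
        induction n with
        | zero =>
          have : ρ * l 0 i = ((m : ℝ) + 1)⁻¹ := by rw [hl0]; simp only [omdInit]; field_simp
          rw [this, Real.log_inv]; simp
        | succ n ih =>
          have e : ρ * l (n + 1) i = ρ * l n i * Real.exp (η * g n i) /
              (ρ * (slack ρ (l n) + ∑ j, l n j * Real.exp (η * g n j))) := by
            rw [hl]; simp only [omdStep]; have := (hZ n).ne'; field_simp
          have hli := mul_pos hρ ((hpos n).1 i)
          rw [e, Real.log_div (mul_pos hli (Real.exp_pos _)).ne' (mul_pos hρ (hZ n)).ne',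
            Real.log_mul hli.ne' (Real.exp_pos _).ne', Real.log_exp, ih,
            Finset.sum_range_succ, Finset.sum_range_succ]
          ring
      have h1 : ρ * l n i ≤ 1 := by
        have h2 : l n i ≤ ∑ i, l n i :=
          Finset.single_le_sum (f := l n) (fun i _ => ((hpos n).1 i).le) (Finset.mem_univ i)
        have h3 := (hpos n).2
        simp only [slack] at h3
        have h4 : l n i ≤ 1 / ρ := by linarith
        rw [le_div_iff₀ hρ] at h4
        linarith
      have h2 := Real.log_nonpos (mul_pos hρ ((hpos n).1 i)).le h1
      rw [h] at h2
      have e : ρ * ∑ t ∈ Finset.range n, ∑ k, dualVertex ρ (some i) k * g t k =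
          ∑ t ∈ Finset.range n, g t i := by
        rw [Finset.mul_sum]
        refine Finset.sum_congr rfl fun t _ => ?_
        simp only [dualVertex, Pi.single_apply, ite_mul, zero_mul, Finset.sum_ite_eq',
          Finset.mem_univ, if_true]
        field_simp
      rw [e]
      linarith
  simp only [sub_mul, Finset.sum_sub_distrib]
  generalize ∑ t ∈ Finset.range n, ∑ i, dualVertex ρ o i * g t i = U at *
  generalize ∑ t ∈ Finset.range n, ∑ i, l t i * g t i = V at *
  have h1 : η * (ρ * (U - V)) ≤ Real.log (m + 1) + n * η ^ 2 := by linarith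
  have h2 : U - V = 1 / ρ * (η * (ρ * (U - V)) / η) := by field_simp
  rw [h2]
  have h3 : Real.log (m + 1) / η + n * η = (Real.log (m + 1) + n * η ^ 2) / η := by field_simp
  rw [h3]
  gcongr

/-! ### Adding one round -/

section Snoc

variable {A : Type*} {n : ℕ}

lemma past_snoc_castSucc (w : Fin n → A) (a : A) (t : Fin n) :
    past (Fin.snoc (α := fun _ => A) w a) t.castSucc = past w t := by
  funext s
  exact Fin.snoc_castSucc (α := fun _ => A) a w (Fin.castLE t.isLt.le s)

lemma past_snoc_last (w : Fin n → A) (a : A) :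
    past (Fin.snoc (α := fun _ => A) w a) (Fin.last n) = w := by
  funext s
  exact Fin.snoc_castSucc (α := fun _ => A) a w s

lemma sum_fin_snoc {M : Type*} [AddCommMonoid M] [Fintype A] (F : (Fin (n + 1) → A) → M) :
    ∑ x, F x = ∑ x : Fin n → A, ∑ a, F (Fin.snoc (α := fun _ => A) x a) := by
  rw [← (Fin.snocEquiv fun _ : Fin (n + 1) => A).sum_comp, Fintype.sum_prod_type,
    Finset.sum_comm]
  rfl

end Snoc

variable {K m : ℕ} {v : Fin K}

lemma weight_snoc {n : ℕ} (ψ : Strategy K m v) (γ : Fin n → Input K m v) (g : Input K m v)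
    (x : Fin n → Fin K) (a : Fin K) :
    weight ψ (Fin.snoc (α := fun _ => Input K m v) γ g) (Fin.snoc (α := fun _ => Fin K) x a) =
      weight ψ γ x * (ψ n γ x).1 a := by
  simp only [weight]
  rw [Fin.prod_univ_castSucc]
  simp only [past_snoc_castSucc, Fin.snoc_castSucc, past_snoc_last, Fin.snoc_last]
  rfl

/-- Conditioning on the first `n` rounds: the earlier weights and the last mixture do not depend on
the last request. -/
lemma sum_weight_snoc {n : ℕ} (ψ : Strategy K m v) (γ : Fin n → Input K m v) (g : Input K m v)
    (F : (Fin (n + 1) → Fin K) → ℝ) :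
    ∑ x, weight ψ (Fin.snoc (α := fun _ => Input K m v) γ g) x * F x =
      ∑ x, weight ψ γ x * ∑ a, (ψ n γ x).1 a * F (Fin.snoc (α := fun _ => Fin K) x a) := by
  rw [sum_fin_snoc]
  refine Finset.sum_congr rfl fun x _ => ?_
  rw [Finset.mul_sum]
  refine Finset.sum_congr rfl fun a _ => ?_
  rw [weight_snoc, mul_assoc]

lemma integral_law {T : ℕ} (ψ : Strategy K m v) (γ : Fin T → Input K m v)
    (F : (Fin T → Fin K) → ℝ) : ∫ x, F x ∂(law ψ γ) = ∑ x, weight ψ γ x * F x := by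
  rw [law, integral_finsetSum_measure fun x _ =>
    (integrable_dirac (by simp)).smul_measure ENNReal.ofReal_ne_top]
  refine Finset.sum_congr rfl fun x _ => ?_
  rw [integral_smul_measure, integral_dirac, ENNReal.toReal_ofReal (weight_nonneg ψ γ x),
    smul_eq_mul]

/-- A union bound: an event contains every path on which `B < 1`, so that its probability is at
least `1 - E[B]`. -/
lemma le_law_of_forall {T : ℕ} (ψ : Strategy K m v) (γ : Fin T → Input K m v)
    {S : Set (Fin T → Fin K)} {B : (Fin T → Fin K) → ℝ} (hB0 : ∀ x, 0 ≤ B x)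
    (hB : ∀ x, B x < 1 → x ∈ S) :
    ENNReal.ofReal (1 - ∑ x, weight ψ γ x * B x) ≤ law ψ γ S := by
  classical
  have hS : law ψ γ S = ENNReal.ofReal (∑ x, weight ψ γ x * S.indicator (fun _ => (1 : ℝ)) x) := by
    rw [← integral_law, integral_indicator_const _ (Set.toFinite S).measurableSet]
    simp
  rw [hS]
  refine ENNReal.ofReal_le_ofReal ?_
  have e : 1 - ∑ x, weight ψ γ x * B x = ∑ x, weight ψ γ x * (1 - B x) := by
    simp only [mul_sub, mul_one, Finset.sum_sub_distrib, sum_weight]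
  rw [e]
  refine Finset.sum_le_sum fun x _ => ?_
  refine mul_le_mul_of_nonneg_left ?_ (weight_nonneg ψ γ x)
  by_cases h : x ∈ S
  · rw [Set.indicator_of_mem h]
    linarith [hB0 x]
  · rw [Set.indicator_of_notMem h]
    linarith [not_lt.1 fun hb => h (hB x hb)]

/-! ### Functionals of the run of the meta-algorithm -/

/-- The meta-algorithm can afford every arm. -/
def State.Active (s : State K m) : Prop := ∀ i, 1 ≤ s.budget i

/-- The dual variables lie in the relative interior of the dual set. -/
def State.Valid (ρ : ℝ) (s : State K m) : Prop := (∀ i, 0 < s.dual i) ∧ 0 < slack ρ s.dual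

lemma valid_stateAfter {ρ : ℝ} (hρ : 0 < ρ) (T : ℕ) (δ : ℝ) (fb : DualFeedback) :
    ∀ (n : ℕ) (γ : Fin n → Input K m v) (x : Fin n → Fin K),
      (stateAfter T ρ δ fb n γ x).Valid ρ
  | 0, _, _ => omdInit_pos hρ
  | n + 1, _, _ =>
    have h := valid_stateAfter hρ T δ fb n _ _
    omdStep_pos hρ h.1 h.2

open Classical in
/-- The sum of `h` over the rounds in which the meta-algorithm is active. -/
def runSum (T : ℕ) (ρ δ : ℝ) (fb : DualFeedback) (h : State K m → Input K m v → Fin K → ℝ) {n : ℕ}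
    (γ : Fin n → Input K m v) (x : Fin n → Fin K) : ℝ :=
  ∑ t : Fin n, if (stateAfter T ρ δ fb t (past γ t) (past x t)).Active then
    h (stateAfter T ρ δ fb t (past γ t) (past x t)) (γ t) (x t) else 0

open Classical in
lemma runSum_snoc (T : ℕ) (ρ δ : ℝ) (fb : DualFeedback)
    (h : State K m → Input K m v → Fin K → ℝ) {n : ℕ} (γ : Fin n → Input K m v) (g : Input K m v)
    (x : Fin n → Fin K) (a : Fin K) :
    runSum T ρ δ fb h (Fin.snoc (α := fun _ => Input K m v) γ g)
        (Fin.snoc (α := fun _ => Fin K) x a) =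
      runSum T ρ δ fb h γ x + if (stateAfter T ρ δ fb n γ x).Active then
        h (stateAfter T ρ δ fb n γ x) g a else 0 := by
  simp only [runSum]
  rw [Fin.sum_univ_castSucc]
  simp only [past_snoc_castSucc, Fin.snoc_castSucc, Fin.snoc_last]
  have e1 := past_snoc_last γ g
  have e2 := past_snoc_last x a
  congr 1
  change (if (stateAfter T ρ δ fb n (past _ (Fin.last n)) (past _ (Fin.last n))).Active then
    h (stateAfter T ρ δ fb n (past _ (Fin.last n)) (past _ (Fin.last n))) g a else 0) = _
  rw [e1, e2]

lemma metaAlgorithm_of_active {T : ℕ} {ρ δ : ℝ} {fb : DualFeedback} {n : ℕ}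
    {γ : Fin n → Input K m v} {x : Fin n → Fin K} (h : (stateAfter T ρ δ fb n γ x).Active) :
    metaAlgorithm T ρ δ fb n γ x = exp3pMix v T (stateAfter T ρ δ fb n γ x).logW :=
  if_pos h

lemma metaAlgorithm_of_not_active {T : ℕ} {ρ δ : ℝ} {fb : DualFeedback} {n : ℕ}
    {γ : Fin n → Input K m v} {x : Fin n → Fin K} (h : ¬ (stateAfter T ρ δ fb n γ x).Active) :
    metaAlgorithm T ρ δ fb n γ x = point v :=
  if_neg h

/-- An exponential supermartingale of the meta-algorithm for arbitrary requests. -/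
lemma sum_weight_mul_exp_runSum_le {T : ℕ} {ρ δ : ℝ} (hρ : 0 < ρ) {fb : DualFeedback}
    {h : State K m → Input K m v → Fin K → ℝ}
    (hh : ∀ s g, s.Valid ρ → ∑ a, (exp3pMix v T s.logW).1 a * Real.exp (h s g a) ≤ 1) :
    ∀ (n : ℕ) (γ : Fin n → Input K m v),
      ∑ x, weight (metaAlgorithm T ρ δ fb) γ x * Real.exp (runSum T ρ δ fb h γ x) ≤ 1 := by
  classical
  intro n
  induction n with
  | zero => intro γ; simp [weight, runSum]
  | succ n ih =>
    intro γ
    rw [← Fin.snoc_init_self γ]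
    generalize γ (Fin.last n) = g
    refine le_trans ?_ (ih (Fin.init γ))
    generalize Fin.init γ = γ'
    change Fin n → Input K m v at γ'
    rw [sum_weight_snoc]
    refine Finset.sum_le_sum fun x _ => mul_le_mul_of_nonneg_left ?_ (weight_nonneg _ _ _)
    simp only [runSum_snoc, Real.exp_add]
    have e : ∀ c : Fin K → ℝ, ∑ a, (metaAlgorithm T ρ δ fb n γ' x).1 a *
        (Real.exp (runSum T ρ δ fb h γ' x) * c a) = Real.exp (runSum T ρ δ fb h γ' x) *
          ∑ a, (metaAlgorithm T ρ δ fb n γ' x).1 a * c a := by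
      intro c
      rw [Finset.mul_sum]
      exact Finset.sum_congr rfl fun a _ => by ring
    rw [e]
    refine mul_le_of_le_one_right (Real.exp_pos _).le ?_
    split_ifs with hact
    · rw [metaAlgorithm_of_active hact]
      exact hh _ g (valid_stateAfter hρ T δ fb n γ' x)
    -- An inactive round has increment 0, so only the total mass of the played mixture matters.
    · simp only [Real.exp_zero, mul_one]
      exact (metaAlgorithm T ρ δ fb n γ' x).2.2.le

/-! ### Bounds for a single round -/

lemma Input.reward_mem (g : Input K m v) (x : Fin K) : g.reward x ∈ Set.Icc (0 : ℝ) 1 := g.2.1 x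

lemma Input.cost_mem (g : Input K m v) (x : Fin K) (i : Fin m) : g.cost x i ∈ Set.Icc (0 : ℝ) 1 :=
  g.2.2.1 x i

lemma Input.reward_void (g : Input K m v) : g.reward v = 0 := g.2.2.2.1

lemma Input.cost_void (g : Input K m v) (i : Fin m) : g.cost v i = 0 := g.2.2.2.2 i

lemma expect_mem {ξ : Mixture K} {h : Fin K → ℝ} (hh : ∀ x, h x ∈ Set.Icc (0 : ℝ) 1) :
    expect ξ h ∈ Set.Icc (0 : ℝ) 1 := by
  refine ⟨Finset.sum_nonneg fun x _ => mul_nonneg (ξ.2.1 x) (hh x).1, ?_⟩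
  rw [← ξ.2.2]
  exact Finset.sum_le_sum fun x _ => mul_le_of_le_one_right (ξ.2.1 x) (hh x).2

lemma dualCost_mem (fb : DualFeedback) (ξ : Mixture K) (g : Input K m v) (x : Fin K) (i : Fin m) :
    dualCost fb ξ g x i ∈ Set.Icc (0 : ℝ) 1 := by
  cases fb with
  | expected => exact expect_mem fun y => g.cost_mem y i
  | realized => exact g.cost_mem x i

/-- Together with the range `dualCost_mem`, this mean-zero property is all that the deviation and
regret estimates need to know about the feedback; it lets both choices be treated at once. -/
lemma sum_mul_dualCost_sub (fb : DualFeedback) (ξ : Mixture K) (g : Input K m v) (i : Fin m) :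
    ∑ x, ξ.1 x * (dualCost fb ξ g x i - g.cost x i) = 0 := by
  cases fb with
  | expected =>
    simp only [dualCost, mul_sub, Finset.sum_sub_distrib, ← Finset.sum_mul, ξ.2.2, one_mul]
    simp [expect]
  | realized => simp [dualCost]

lemma State.Valid.sum_dual_le {ρ : ℝ} {s : State K m} (h : s.Valid ρ) :
    ∑ i, s.dual i ≤ 1 / ρ := (sub_pos.1 h.2).le

lemma sum_mul_mem {l c : Fin m → ℝ} {B : ℝ} (hl : ∀ i, 0 ≤ l i) (hB : ∑ i, l i ≤ B)
    (hc : ∀ i, |c i| ≤ 1) : |∑ i, l i * c i| ≤ B := by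
  refine (Finset.abs_sum_le_sum_abs _ _).trans (le_trans (Finset.sum_le_sum fun i _ => ?_) hB)
  rw [abs_mul, abs_of_nonneg (hl i)]
  exact mul_le_of_le_one_right (hl i) (hc i)

lemma primalReward_mem {ρ : ℝ} (hρ : 0 < ρ) {s : State K m} (hs : s.Valid ρ) (g : Input K m v)
    (x : Fin K) : primalReward ρ s.dual g x ∈ Set.Icc (0 : ℝ) 1 := by
  have h0 : 0 ≤ ∑ i, s.dual i * g.cost x i :=
    Finset.sum_nonneg fun i _ => mul_nonneg (hs.1 i).le (g.cost_mem x i).1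
  have h1 : ∑ i, s.dual i * g.cost x i ≤ 1 / ρ :=
    (Finset.sum_le_sum fun i _ => mul_le_of_le_one_right (hs.1 i).le (g.cost_mem x i).2).trans
      hs.sum_dual_le
  have hr := g.reward_mem x
  have hp : 0 < 1 + 1 / ρ := by positivity
  unfold primalReward
  refine ⟨div_nonneg (by linarith [hr.1]) hp.le, (div_le_one hp).2 (by linarith [hr.2])⟩

/-! ### Exponential moments -/

/-- The increments that control the deviation of the importance-weighted rewards of arm `j`. -/
def estimateIncrement (T : ℕ) (ρ θ : ℝ) (j : Fin K) (s : State K m) (g : Input K m v)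
    (x : Fin K) : ℝ :=
  θ * (primalReward ρ s.dual g j - (if j = x then primalReward ρ s.dual g x /
    (exp3pMix v T s.logW).1 j else 0)) - θ ^ 2 / (exp3pMix v T s.logW).1 j

/-- The estimate is unbiased with second moment at most 1/p, which the compensator θ²/p pays for. It
is unbounded, but it enters with a negative sign, so the increment is bounded above and θ ≤ 1
suffices. -/
lemma sum_mul_exp_estimateIncrement_le {T : ℕ} {ρ θ : ℝ} (hρ : 0 < ρ)
    (hθ0 : 0 ≤ θ) (hθ1 : θ ≤ 1) (j : Fin K) (s : State K m) (g : Input K m v) (hs : s.Valid ρ) :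
    ∑ a, (exp3pMix v T s.logW).1 a * Real.exp (estimateIncrement T ρ θ j s g a) ≤ 1 := by
  have hpos := exp3pMix_pos v T s.logW
  set p := exp3pMix v T s.logW with hp
  have hr := primalReward_mem hρ hs g j
  have hpj := hpos j
  set r := primalReward ρ s.dual g j with hrdef
  have hX : ∀ a, (if j = a then primalReward ρ s.dual g a / p.1 j else 0) =
      if a = j then r / p.1 j else 0 := by
    intro a
    by_cases h : a = j
    · subst h; simp [hrdef]
    · rw [if_neg h, if_neg fun h' => h h'.symm]
  have hX0 : ∀ a, 0 ≤ (if a = j then r / p.1 j else 0) := by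
    intro a
    have := hr.1
    split_ifs <;> positivity
  have key : ∑ a, p.1 a * Real.exp (θ * (r - if a = j then r / p.1 j else 0)) ≤
      Real.exp (θ ^ 2 / p.1 j) := by
    refine sum_mul_exp_le p.2.1 p.2.2 (fun a => ?_) ?_ ?_
    · have : r - (if a = j then r / p.1 j else 0) ≤ 1 := by linarith [hX0 a, hr.2]
      nlinarith
    · have e : ∀ a, p.1 a * (θ * (r - if a = j then r / p.1 j else 0)) =
          θ * r * p.1 a - θ * (p.1 a * if a = j then r / p.1 j else 0) := fun a => by ring
      simp only [e, Finset.sum_sub_distrib, ← Finset.mul_sum, p.2.2, mul_ite, mul_zero,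
        Finset.sum_ite_eq', Finset.mem_univ, if_true]
      rw [mul_div_cancel₀ _ hpj.ne']
      simp
    · have e : ∀ a, p.1 a * (θ * (r - if a = j then r / p.1 j else 0)) ^ 2 =
          θ ^ 2 * r ^ 2 * p.1 a + p.1 a * (if a = j then
            θ ^ 2 * ((r / p.1 j) ^ 2 - 2 * r * (r / p.1 j)) else 0) := fun a => by
        split_ifs <;> ring
      simp only [e, Finset.sum_add_distrib, ← Finset.mul_sum, p.2.2, mul_ite, mul_zero,
        Finset.sum_ite_eq', Finset.mem_univ, if_true]
      have e2 : θ ^ 2 * r ^ 2 * 1 + p.1 j * (θ ^ 2 * ((r / p.1 j) ^ 2 - 2 * r * (r / p.1 j))) =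
          θ ^ 2 / p.1 j * r ^ 2 - θ ^ 2 * r ^ 2 := by field_simp; ring
      rw [e2]
      have : θ ^ 2 / p.1 j * r ^ 2 ≤ θ ^ 2 / p.1 j :=
        mul_le_of_le_one_right (by positivity) (by nlinarith [hr.1, hr.2])
      nlinarith [mul_nonneg (sq_nonneg θ) (sq_nonneg r)]
  simp only [estimateIncrement, ← hp, ← hrdef, hX, sub_eq_add_neg _ (θ ^ 2 / p.1 j), Real.exp_add]
  simp only [← mul_assoc, ← Finset.sum_mul]
  rw [Real.exp_neg, ← div_eq_mul_inv]
  exact (div_le_one (Real.exp_pos _)).2 key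

/-- The increments that control the deviation of the realized costs from the costs that are
reported to the dual minimizer. -/
def dualIncrement (T : ℕ) (ρ θ : ℝ) (fb : DualFeedback) (o : Option (Fin m)) (s : State K m)
    (g : Input K m v) (x : Fin K) : ℝ :=
  θ * ∑ i, (s.dual i - dualVertex ρ o i) *
    (dualCost fb (exp3pMix v T s.logW) g x i - g.cost x i) - θ ^ 2 * (2 / ρ) ^ 2

lemma sum_mul_exp_sub_le {ι : Type*} [Fintype ι] {p z : ι → ℝ} {θ b : ℝ} (hθ : 0 ≤ θ)
    (hθb : θ * b ≤ 1) (hp : ∀ i, 0 ≤ p i) (hp1 : ∑ i, p i = 1) (hz : ∀ i, |z i| ≤ b)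
    (hm : ∑ i, p i * z i ≤ 0) : ∑ i, p i * Real.exp (θ * z i - θ ^ 2 * b ^ 2) ≤ 1 := by
  have key : ∑ i, p i * Real.exp (θ * z i) ≤ Real.exp (θ ^ 2 * b ^ 2) := by
    refine sum_mul_exp_le hp hp1 (fun i => ?_) ?_ ?_
    · exact (mul_le_mul_of_nonneg_left ((le_abs_self _).trans (hz i)) hθ).trans hθb
    · have : ∑ i, p i * (θ * z i) = θ * ∑ i, p i * z i := by
        rw [Finset.mul_sum]; exact Finset.sum_congr rfl fun i _ => by ring
      rw [this]
      exact mul_nonpos_of_nonneg_of_nonpos hθ hm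
    · have : ∑ i, p i * (θ * z i) ^ 2 ≤ ∑ i, p i * (θ ^ 2 * b ^ 2) := by
        refine Finset.sum_le_sum fun i _ => mul_le_mul_of_nonneg_left ?_ (hp i)
        rw [mul_pow]
        exact mul_le_mul_of_nonneg_left (sq_le_sq' (by linarith [(abs_le.1 (hz i)).1])
          (abs_le.1 (hz i)).2) (sq_nonneg θ)
      rwa [← Finset.sum_mul, hp1, one_mul] at this
  simp only [sub_eq_add_neg _ (θ ^ 2 * b ^ 2), Real.exp_add, ← mul_assoc, ← Finset.sum_mul]
  rw [Real.exp_neg, ← div_eq_mul_inv]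
  exact (div_le_one (Real.exp_pos _)).2 (by simpa only [mul_assoc] using key)

/-- Both λ and the vertex lie in the dual set, so the pairing of their difference with a vector of
sup norm at most 1 is bounded by 2/ρ. Neither depends on the arm being drawn, so the mean-zero
property of the reported costs carries over. -/
lemma sum_mul_exp_dualIncrement_le {T : ℕ} {ρ θ : ℝ} (hρ : 0 < ρ) (hθ0 : 0 ≤ θ)
    (hθ1 : θ * (2 / ρ) ≤ 1) (fb : DualFeedback) (o : Option (Fin m)) (s : State K m)
    (g : Input K m v) (hs : s.Valid ρ) :
    ∑ a, (exp3pMix v T s.logW).1 a * Real.exp (dualIncrement T ρ θ fb o s g a) ≤ 1 := by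
  refine sum_mul_exp_sub_le hθ0 hθ1 (exp3pMix v T s.logW).2.1 (exp3pMix v T s.logW).2.2
    (fun a => ?_) ?_
  · have hc : ∀ i, |dualCost fb (exp3pMix v T s.logW) g a i - g.cost a i| ≤ 1 := fun i => by
      have h1 := dualCost_mem fb (exp3pMix v T s.logW) g a i
      have h2 := g.cost_mem a i
      exact abs_le.2 ⟨by linarith [h1.1, h2.2], by linarith [h1.2, h2.1]⟩
    have h1 := sum_mul_mem (fun i => (hs.1 i).le) hs.sum_dual_le hc
    have h2 := sum_mul_mem (dualVertex_nonneg hρ o) (sum_dualVertex_le hρ o) hc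
    simp only [sub_mul _ (dualVertex ρ o _), Finset.sum_sub_distrib]
    refine (abs_sub _ _).trans ?_
    have : 2 / ρ = 1 / ρ + 1 / ρ := by ring
    linarith
  · simp only [Finset.mul_sum]
    rw [Finset.sum_comm]
    refine (Finset.sum_eq_zero fun i _ => ?_).le
    have := sum_mul_dualCost_sub fb (exp3pMix v T s.logW) g i
    calc _ = (s.dual i - dualVertex ρ o i) * ∑ x, (exp3pMix v T s.logW).1 x *
        (dualCost fb (exp3pMix v T s.logW) g x i - g.cost x i) := by
          rw [Finset.mul_sum]; exact Finset.sum_congr rfl fun x _ => by ring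
      _ = 0 := by rw [this, mul_zero]

/-! ### Orders of magnitude -/

/-- The rate `√(K T log (T m / δ))`. -/
def bwkRate (K m T : ℕ) (δ : ℝ) : ℝ := √(K * T * Real.log (T * m / δ))

/-- The parameters for which the bounds of the main theorem are not trivial. -/
structure Regime (K m T : ℕ) (δ : ℝ) : Prop where
  pos_arms : 1 ≤ K
  pos_resources : 1 ≤ m
  two_le : 2 ≤ T
  conf_pos : 0 < δ
  conf_lt_one : δ < 1
  horizon : 100 * K * Real.log (T * m / δ) ≤ T

namespace Regime

variable {T : ℕ} {δ : ℝ}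

lemma log_ge (h : Regime K m T δ) {y : ℝ} (hy : 0 < y) (hyT : y ≤ T * m) :
    Real.log y ≤ Real.log (T * m / δ) := by
  refine Real.log_le_log hy (hyT.trans ?_)
  rw [le_div_iff₀ h.conf_pos]
  have := h.conf_lt_one.le
  exact mul_le_of_le_one_right (by positivity) this

lemma half_le (h : Regime K m T δ) : 1 / 2 ≤ Real.log (T * m / δ) := by
  have h1 : (2 : ℝ) ≤ T := by exact_mod_cast h.two_le
  have h2 : (1 : ℝ) ≤ m := by exact_mod_cast h.pos_resources
  have := h.log_ge (y := 2) (by norm_num) (by nlinarith)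
  linarith [Real.log_two_gt_d9]

lemma arms_le (h : Regime K m T δ) : (K : ℝ) ≤ T := by
  have h1 := h.half_le
  have h2 := h.horizon
  have h3 : (0 : ℝ) ≤ K := by positivity
  nlinarith

lemma log_arms_le (h : Regime K m T δ) : Real.log K ≤ Real.log (T * m / δ) := by
  have h2 : (1 : ℝ) ≤ m := by exact_mod_cast h.pos_resources
  have h3 : (0 : ℝ) < K := by exact_mod_cast h.pos_arms
  have h4 := h.arms_le
  exact h.log_ge h3 (by nlinarith)

lemma log_resources_le (h : Regime K m T δ) : Real.log (m + 1) ≤ Real.log (T * m / δ) := by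
  have h1 : (2 : ℝ) ≤ T := by exact_mod_cast h.two_le
  have h2 : (1 : ℝ) ≤ m := by exact_mod_cast h.pos_resources
  exact h.log_ge (by positivity) (by nlinarith)

lemma log_conf_pos (h : Regime K m T δ) : 0 < Real.log (K * T / δ) := by
  have h1 : (2 : ℝ) ≤ T := by exact_mod_cast h.two_le
  have h2 : (1 : ℝ) ≤ K := by exact_mod_cast h.pos_arms
  refine Real.log_pos ?_
  rw [lt_div_iff₀ h.conf_pos]
  nlinarith [h.conf_lt_one]

/-- The horizon condition forces K ≤ T. Thus the union over arms inside the logarithm costs only a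
factor 2, and the final rate needs no separate log K. -/
lemma log_conf_le (h : Regime K m T δ) : Real.log (K * T / δ) ≤ 2 * Real.log (T * m / δ) := by
  have h1 : (2 : ℝ) ≤ T := by exact_mod_cast h.two_le
  have h2 : (1 : ℝ) ≤ m := by exact_mod_cast h.pos_resources
  have h3 : (0 : ℝ) < K := by exact_mod_cast h.pos_arms
  have h4 := h.arms_le
  have h5 : Real.log (K * T / δ) = Real.log K + Real.log (T / δ) := by
    rw [mul_div_assoc, Real.log_mul h3.ne' (div_pos (by linarith) h.conf_pos).ne']
  have h6 : Real.log (T / δ) ≤ Real.log (T * m / δ) := by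
    refine Real.log_le_log (div_pos (by linarith) h.conf_pos) ?_
    have := h.conf_pos
    gcongr
    nlinarith
  linarith [h.log_arms_le]

lemma rate_sq (h : Regime K m T δ) :
    bwkRate K m T δ ^ 2 = K * T * Real.log (T * m / δ) := by
  have := h.half_le
  exact Real.sq_sqrt (by positivity)

lemma rate_nonneg : 0 ≤ bwkRate K m T δ := Real.sqrt_nonneg _

/-- The horizon condition bounds K T L from below by 100 K² L², where L is the logarithm in the
rate. Terms of order K L are therefore absorbed into the rate. -/
lemma rate_ge (h : Regime K m T δ) : 10 * K * Real.log (T * m / δ) ≤ bwkRate K m T δ := by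
  have h1 := h.half_le
  refine Real.le_sqrt_of_sq_le ?_
  have h2 := h.horizon
  have h3 : (0 : ℝ) ≤ K * Real.log (T * m / δ) := by positivity
  nlinarith

lemma five_le_rate (h : Regime K m T δ) : 5 ≤ bwkRate K m T δ := by
  have h1 := h.half_le
  have h2 := h.rate_ge
  have h3 : (1 : ℝ) ≤ K := by exact_mod_cast h.pos_arms
  nlinarith

lemma log_mul_le (h : Regime K m T δ) :
    T * Real.log (T * m / δ) ≤ bwkRate K m T δ ^ 2 := by
  have h1 := h.half_le
  have h3 : (1 : ℝ) ≤ K := by exact_mod_cast h.pos_arms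
  have : (0 : ℝ) ≤ T * Real.log (T * m / δ) := by positivity
  rw [h.rate_sq]
  nlinarith

lemma alpha_sq (h : Regime K m T δ) : exp3pAlpha K T δ ^ 2 = 4 * Real.log (K * T / δ) := by
  rw [exp3pAlpha, mul_pow, Real.sq_sqrt h.log_conf_pos.le]
  norm_num

lemma alpha_pos (h : Regime K m T δ) : 0 < exp3pAlpha K T δ := by
  have := h.log_conf_pos
  unfold exp3pAlpha
  positivity

lemma alpha_le (h : Regime K m T δ) : exp3pAlpha K T δ ≤ √(K * T) := by
  refine Real.le_sqrt_of_sq_le ?_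
  rw [h.alpha_sq]
  have h1 := h.log_conf_le
  have h2 := h.horizon
  have h3 : (1 : ℝ) ≤ K := by exact_mod_cast h.pos_arms
  have h4 := h.half_le
  have h5 : (0 : ℝ) ≤ T := by positivity
  nlinarith

lemma alpha_mul_sqrt_le (h : Regime K m T δ) :
    exp3pAlpha K T δ * √(K * T) ≤ 3 * bwkRate K m T δ := by
  refine (abs_le_of_sq_le_sq' ?_ (mul_nonneg (by norm_num) rate_nonneg)).2
  rw [mul_pow, mul_pow, h.alpha_sq, h.rate_sq, Real.sq_sqrt (by positivity)]
  have h1 := h.log_conf_le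
  have h2 := h.half_le
  have h3 : (0 : ℝ) ≤ K * T := by positivity
  nlinarith [mul_le_mul_of_nonneg_left h1 h3, mul_nonneg h3 (by linarith : (0 : ℝ) ≤ Real.log (T * m / δ))]

/-- Under the horizon condition K log K / T is at most 1/100, so the cap 3/5 is inactive. -/
lemma gamma_eq (h : Regime K m T δ) :
    exp3pGamma K T = 2 * √(3 / 5 * (K * Real.log K) / T) := by
  refine min_eq_right ?_
  have h1 := h.log_arms_le
  have h2 := h.horizon
  have h3 : (1 : ℝ) ≤ K := by exact_mod_cast h.pos_arms
  have hT : (0 : ℝ) < T := by linarith [h.arms_le]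
  have : √(3 / 5 * (K * Real.log K) / T) ≤ 3 / 10 := by
    refine Real.sqrt_le_iff.2 ⟨by norm_num, ?_⟩
    rw [div_le_iff₀ hT]
    nlinarith
  linarith

lemma gamma_sq (h : Regime K m T δ) :
    exp3pGamma K T ^ 2 * T = 12 / 5 * (K * Real.log K) := by
  have h3 : (1 : ℝ) ≤ K := by exact_mod_cast h.pos_arms
  have hT : (0 : ℝ) < T := by linarith [h.arms_le]
  have := Real.log_nonneg h3
  rw [h.gamma_eq, mul_pow, Real.sq_sqrt (by positivity)]
  field_simp
  ring

/-- A single arm gives log K = 0 and no exploration, hence the exclusion; that case has zero primal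
regret and is treated separately. -/
lemma gamma_pos (h : Regime K m T δ) (hK : K ≠ 1) : 0 < exp3pGamma K T := by
  have h3 : (1 : ℝ) < K := by
    have := h.pos_arms
    exact_mod_cast (by omega : 1 < K)
  have hT : (0 : ℝ) < T := by linarith [h.arms_le]
  have := Real.log_pos h3
  rw [h.gamma_eq]
  positivity

lemma exp3p_bound_le (h : Regime K m T δ) (hK : K ≠ 1) :
    5 / 4 * (exp3pAlpha K T δ * √(K * T)) + 2 / 3 * exp3pAlpha K T δ ^ 2 +
        3 * K * Real.log K / exp3pGamma K T + 5 / 3 * exp3pGamma K T * T ≤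
      10 * bwkRate K m T δ := by
  have h1 := h.alpha_mul_sqrt_le
  have h2 := h.alpha_sq
  have h3 := h.log_conf_le
  have h4 := h.rate_ge
  have hK1 : (1 : ℝ) ≤ K := by exact_mod_cast h.pos_arms
  have hl := h.half_le
  have h5 : exp3pAlpha K T δ ^ 2 ≤ bwkRate K m T δ := by
    have : (K : ℝ) * Real.log (T * m / δ) ≥ Real.log (T * m / δ) := by nlinarith
    linarith
  have hγ := h.gamma_pos hK
  have hγs := h.gamma_sq
  -- From γ² T = (12/5) K log K: the entropy term is a constant multiple of the exploration cost γ
  -- T.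
  have h6 : 3 * K * Real.log K / exp3pGamma K T = 5 / 4 * (exp3pGamma K T * T) := by
    rw [div_eq_iff hγ.ne']
    linarith
  have h7 : exp3pGamma K T * T ≤ 8 / 5 * bwkRate K m T δ := by
    refine (abs_le_of_sq_le_sq' ?_ (mul_nonneg (by norm_num) rate_nonneg)).2
    rw [mul_pow, mul_pow, h.rate_sq]
    have h8 : exp3pGamma K T ^ 2 * (T : ℝ) ^ 2 = 12 / 5 * (K * T * Real.log K) := by
      calc _ = exp3pGamma K T ^ 2 * T * T := by ring
        _ = _ := by rw [hγs]; ring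
    rw [h8]
    have h9 : (K : ℝ) * T * Real.log K ≤ K * T * Real.log (T * m / δ) :=
      mul_le_mul_of_nonneg_left h.log_arms_le (by positivity)
    have h10 : (0 : ℝ) ≤ K * T * Real.log (T * m / δ) := by positivity
    linarith
  rw [h6]
  -- The coefficients of the rate are 15/4, 2/3, 2 and 8/3, whose sum is below 10.
  linarith [rate_nonneg (K := K) (m := m) (T := T) (δ := δ)]

lemma omdRate_pos (h : Regime K m T δ) : 0 < omdRate m T := by
  have h1 : (1 : ℝ) < m + 1 := by
    have : (1 : ℝ) ≤ m := by exact_mod_cast h.pos_resources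
    linarith
  have hT : (0 : ℝ) < T := by
    have := h.two_le
    exact_mod_cast (by omega : 0 < T)
  have := Real.log_pos h1
  unfold omdRate
  positivity

lemma omdRate_sq (h : Regime K m T δ) : omdRate m T ^ 2 * T = Real.log (m + 1) := by
  have hT : (0 : ℝ) < T := by
    have := h.two_le
    exact_mod_cast (by omega : 0 < T)
  have : (1 : ℝ) ≤ (m : ℝ) + 1 := by linarith [(Nat.cast_nonneg m : (0 : ℝ) ≤ m)]
  have := Real.log_nonneg this
  rw [omdRate, Real.sq_sqrt (by positivity)]
  field_simp

lemma omdRate_le_one (h : Regime K m T δ) : omdRate m T ≤ 1 := by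
  have h1 := h.omdRate_sq
  have h2 := h.log_resources_le
  have h3 := h.horizon
  have h4 := h.half_le
  have h5 : (1 : ℝ) ≤ K := by exact_mod_cast h.pos_arms
  have hT : (0 : ℝ) < T := by linarith [h.arms_le]
  have h6 : omdRate m T ^ 2 * T ≤ 1 * T := by nlinarith
  have h7 := le_of_mul_le_mul_right h6 hT
  nlinarith [h.omdRate_pos]

lemma omd_bound_le (h : Regime K m T δ) {n : ℕ} (hn : n ≤ T) :
    Real.log (m + 1) / omdRate m T + n * omdRate m T ≤ 2 * bwkRate K m T δ := by
  have h1 := h.omdRate_sq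
  have h2 := h.log_resources_le
  have h3 := h.omdRate_pos
  have hn' : (n : ℝ) ≤ T := by exact_mod_cast hn
  have h4 : Real.log (m + 1) / omdRate m T = omdRate m T * T := by
    rw [div_eq_iff h3.ne']
    linarith
  have h5 : omdRate m T * T ≤ bwkRate K m T δ := by
    refine (abs_le_of_sq_le_sq' ?_ rate_nonneg).2
    have hT : (0 : ℝ) ≤ T := by positivity
    calc (omdRate m T * T) ^ 2 = T * (omdRate m T ^ 2 * T) := by ring
      _ ≤ T * Real.log (T * m / δ) := by rw [h1]; gcongr
      _ ≤ _ := h.log_mul_le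
  rw [h4]
  nlinarith

end Regime

/-- The parameter of the exponential supermartingales with increments bounded by `2 / ρ`. -/
def deviationParam (m T : ℕ) (ρ δ : ℝ) : ℝ := ρ / 2 * √(3 * Real.log (T * m / δ) / T)

lemma Regime.deviationParam_pos {T : ℕ} {ρ δ : ℝ} (h : Regime K m T δ) (hρ : 0 < ρ) :
    0 < deviationParam m T ρ δ := by
  have h1 := h.half_le
  have h2 := h.arms_le
  have h3 : (1 : ℝ) ≤ K := by exact_mod_cast h.pos_arms
  have hT : (0 : ℝ) < T := by linarith
  unfold deviationParam
  positivity

lemma Regime.deviationParam_mul_le {T : ℕ} {ρ δ : ℝ} (h : Regime K m T δ) (hρ : 0 < ρ) :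
    deviationParam m T ρ δ * (2 / ρ) ≤ 1 := by
  have h1 := h.half_le
  have h2 := h.arms_le
  have h3 : (1 : ℝ) ≤ K := by exact_mod_cast h.pos_arms
  have hT : (0 : ℝ) < T := by linarith
  have h4 := h.horizon
  have : deviationParam m T ρ δ * (2 / ρ) = √(3 * Real.log (T * m / δ) / T) := by
    unfold deviationParam; field_simp
  rw [this]
  refine Real.sqrt_le_one.2 ?_
  rw [div_le_one hT]
  nlinarith

/-- Write the parameter as (ρ/2) q with q² T = 3L, where L is the logarithm in the rate. The
threshold equals q² T and the accumulated compensator is at most q² T, so X ≤ 4 q T / ρ, and q T is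
at most twice the rate. -/
lemma Regime.le_of_deviation {T n : ℕ} {ρ δ X : ℝ} (h : Regime K m T δ) (hρ : 0 < ρ) (hn : n ≤ T)
    (hX : deviationParam m T ρ δ * X - n * (deviationParam m T ρ δ ^ 2 * (2 / ρ) ^ 2) ≤
      3 * Real.log (T * m / δ)) : X ≤ 8 * bwkRate K m T δ / ρ := by
  have h1 := h.half_le
  have h2 := h.arms_le
  have h3 : (1 : ℝ) ≤ K := by exact_mod_cast h.pos_arms
  have hT : (0 : ℝ) < T := by linarith
  have hn' : (n : ℝ) ≤ T := by exact_mod_cast hn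
  have hθ := h.deviationParam_pos hρ
  obtain ⟨q, hq⟩ : ∃ q, q = √(3 * Real.log (T * m / δ) / T) := ⟨_, rfl⟩
  have hq0 : 0 < q := by rw [hq]; positivity
  have hq2 : q ^ 2 * T = 3 * Real.log (T * m / δ) := by
    rw [hq, Real.sq_sqrt (by positivity)]; field_simp
  have hqT : q * T ≤ 2 * bwkRate K m T δ := by
    refine (abs_le_of_sq_le_sq' ?_ (mul_nonneg (by norm_num) rate_nonneg)).2
    have := h.log_mul_le
    calc (q * T) ^ 2 = T * (q ^ 2 * T) := by ring
      _ = 3 * (T * Real.log (T * m / δ)) := by rw [hq2]; ring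
      _ ≤ (2 * bwkRate K m T δ) ^ 2 := by nlinarith [sq_nonneg (bwkRate K m T δ)]
  have e : deviationParam m T ρ δ = ρ / 2 * q := by rw [hq]; rfl
  rw [e, ← hq2] at hX
  have e2 : (ρ / 2 * q) ^ 2 * (2 / ρ) ^ 2 = q ^ 2 := by field_simp
  rw [e2] at hX
  have h4 : ρ / 2 * q * X ≤ 2 * (q ^ 2 * T) := by nlinarith [sq_nonneg q]
  have h5 : q * (ρ * X) ≤ q * (4 * (q * T)) := by nlinarith
  have h6 := le_of_mul_le_mul_left h5 hq0
  rw [le_div_iff₀ hρ]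
  linarith

/-! ### The reward of a single run -/

/-- `f(ξ) + ⟨l, ρ - c(ξ)⟩`. -/
def lagrangian (ρ : ℝ) (l : Fin m → ℝ) (g : Input K m v) (ξ : Mixture K) : ℝ :=
  expect ξ fun y => g.reward y + ∑ i, l i * (ρ - g.cost y i)

/-- For activity of the algorithm, τ is the stopping time: once a budget falls below 1 it stays
there. -/
lemma exists_last_of_antitone {P : ℕ → Prop} (hP : ∀ t, P (t + 1) → P t) :
    ∀ T, ∃ τ ≤ T, (∀ t < τ, P t) ∧ ∀ t < T, τ ≤ t → ¬ P t
  | 0 => ⟨0, le_rfl, by simp, by simp⟩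
  | T + 1 => by
    obtain ⟨τ, hτ, h1, h2⟩ := exists_last_of_antitone hP T
    by_cases h : P T
    · refine ⟨T + 1, le_rfl, fun t ht => ?_, fun t ht ht' => by omega⟩
      exact Nat.decreasingInduction (motive := fun k _ => P k) (fun k _ hk => hP k hk) h
        (Nat.lt_succ_iff.1 ht)
    · refine ⟨τ, by omega, h1, fun t ht ht' => ?_⟩
      rcases Nat.lt_succ_iff_lt_or_eq.1 ht with h3 | rfl
      · exact h2 t h3 ht'
      · exact h

/-- The state at the beginning of round `t` for infinite sequences of requests and arms. -/
def seqState (T : ℕ) (ρ δ : ℝ) (fb : DualFeedback) (γ : ℕ → Input K m v) (x : ℕ → Fin K) (t : ℕ) :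
    State K m :=
  stateAfter T ρ δ fb t (fun s => γ s) fun s => x s

lemma seqState_succ (T : ℕ) (ρ δ : ℝ) (fb : DualFeedback) (γ : ℕ → Input K m v) (x : ℕ → Fin K)
    (t : ℕ) : seqState T ρ δ fb γ x (t + 1) =
      step T ρ δ fb (seqState T ρ δ fb γ x t) (γ t) (x t) := rfl

lemma budget_seqState (T : ℕ) (ρ δ : ℝ) (fb : DualFeedback) (γ : ℕ → Input K m v) (x : ℕ → Fin K)
    (i : Fin m) : ∀ t, (seqState T ρ δ fb γ x t).budget i =
      ρ * T - ∑ s ∈ Finset.range t, (γ s).cost (x s) i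
  | 0 => by simp [seqState, stateAfter, initState]
  | t + 1 => by
    rw [seqState_succ, Finset.sum_range_succ, ← sub_sub, ← budget_seqState T ρ δ fb γ x i t]
    rfl

/-- A run that stops early has a resource with less than 1 left. Testing its consumption with eᵢ/ρ
gives (1/ρ)(ρT - 1 - τρ), so each lost round is worth 1. The vertex depends on the run, which is why
deviations are controlled for all m + 1 vertices. -/
lemma exists_stop (T : ℕ) (ρ δ : ℝ) (fb : DualFeedback) (γ : ℕ → Input K m v) (x : ℕ → Fin K) :
    ∃ τ ≤ T, (∀ h : State K m → Input K m v → Fin K → ℝ,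
      runSum T ρ δ fb h (fun t : Fin T => γ t) (fun t => x t) =
        ∑ t ∈ Finset.range τ, h (seqState T ρ δ fb γ x t) (γ t) (x t)) ∧
      ∃ o : Option (Fin m), 0 < ρ → T - τ - 1 / ρ ≤ ∑ t ∈ Finset.range τ,
        ∑ i, dualVertex ρ o i * ((γ t).cost (x t) i - ρ) := by
  classical
  obtain ⟨τ, hτ, h1, h2⟩ := exists_last_of_antitone
    (P := fun t => (seqState T ρ δ fb γ x t).Active) (fun t ht i => by
      refine (ht i).trans ?_
      rw [seqState_succ]
      exact sub_le_self _ ((γ t).cost_mem (x t) i).1) T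
  refine ⟨τ, hτ, fun h => ?_, ?_⟩
  · change ∑ t : Fin T, (if (seqState T ρ δ fb γ x t).Active then
      h (seqState T ρ δ fb γ x t) (γ t) (x t) else 0) = _
    rw [Fin.sum_univ_eq_sum_range fun t : ℕ => if (seqState T ρ δ fb γ x t).Active then
      h (seqState T ρ δ fb γ x t) (γ t) (x t) else 0]
    rw [← Finset.sum_subset (Finset.range_mono hτ) fun t ht ht' => if_neg
      (h2 t (Finset.mem_range.1 ht) (not_lt.1 fun h => ht' (Finset.mem_range.2 h)))]
    exact Finset.sum_congr rfl fun t ht => if_pos (h1 t (Finset.mem_range.1 ht))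
  · rcases hτ.eq_or_lt with rfl | hlt
    -- Without early stopping the left side is -1/ρ, and the origin suffices.
    · refine ⟨none, fun hρ => ?_⟩
      simp [dualVertex, hρ.le]
    · have := h2 τ hlt le_rfl
      simp only [State.Active, not_forall, not_le] at this
      obtain ⟨i, hi⟩ := this
      refine ⟨some i, fun hρ => ?_⟩
      rw [budget_seqState] at hi
      simp only [dualVertex, Pi.single_apply, ite_mul, zero_mul, Finset.sum_ite_eq',
        Finset.mem_univ, if_true]
      rw [← Finset.mul_sum, Finset.sum_sub_distrib]
      simp only [Finset.sum_const, Finset.card_range, nsmul_eq_mul]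
      have e : (T : ℝ) - τ - 1 / ρ = 1 / ρ * (ρ * T - 1 - τ * ρ) := by field_simp; ring
      rw [e]
      exact mul_le_mul_of_nonneg_left (by linarith) (by positivity)

/-- On the paths on which the relevant deviations are small, the reward of the meta-algorithm is at
least the sum of the Lagrangians of any mixture, where the inactive rounds count as `1`. -/
lemma lagrangian_le_totalReward {T : ℕ} {ρ δ : ℝ} (hreg : Regime K m T δ) (hρ : 0 < ρ)
    (hρ1 : ρ ≤ 1) (fb : DualFeedback) (γ : ℕ → Input K m v) (x : ℕ → Fin K)
    (h1 : ∀ j, runSum T ρ δ fb (estimateIncrement T ρ (exp3pAlpha K T δ / √(K * T)) j)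
      (fun t : Fin T => γ t) (fun t => x t) ≤ exp3pAlpha K T δ ^ 2 / 4)
    (h2 : ∀ o, runSum T ρ δ fb (dualIncrement T ρ (deviationParam m T ρ δ) fb o)
      (fun t : Fin T => γ t) (fun t => x t) ≤ 3 * Real.log (T * m / δ)) (ξ : Mixture K) :
    runSum T ρ δ fb (fun s g _ => lagrangian ρ s.dual g ξ - 1) (fun t : Fin T => γ t)
        (fun t => x t) + T ≤
      totalReward (fun t : Fin T => γ t) (fun t => x t) + 31 * bwkRate K m T δ / ρ := by
  obtain ⟨τ, hτ, hrun, o, ho⟩ := exists_stop T ρ δ fb γ x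
  specialize ho hρ
  have hT : 0 < T := by have := hreg.two_le; omega
  have hTr : (0 : ℝ) < T := by exact_mod_cast hT
  have hK : (0 : ℝ) < K := by exact_mod_cast v.pos
  have hvalid : ∀ t, (seqState T ρ δ fb γ x t).Valid ρ := fun t => valid_stateAfter hρ T δ fb t _ _
  have hrew : ∑ t ∈ Finset.range τ, (γ t).reward (x t) ≤
      totalReward (fun t : Fin T => γ t) (fun t => x t) := by
    rw [totalReward, Fin.sum_univ_eq_sum_range fun t : ℕ => (γ t).reward (x t)]
    exact Finset.sum_le_sum_of_subset_of_nonneg (Finset.range_mono hτ)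
      fun t _ _ => ((γ t).reward_mem (x t)).1
  simp only [hrun] at h1 h2 ⊢
  have hseq := seqState_succ T ρ δ fb γ x
  have hseq0 : seqState T ρ δ fb γ x 0 = initState K m T ρ δ := rfl
  generalize seqState T ρ δ fb γ x = S at *
  have hN := hreg.five_le_rate
  have hNexp := hreg.exp3p_bound_le
  have hNomd := hreg.omd_bound_le hτ
  have hDev := fun X => hreg.le_of_deviation (X := X) hρ hτ
  -- the primal player
  have hprimal : ∀ j, ∑ t ∈ Finset.range τ, (primalReward ρ (S t).dual (γ t) j -
      primalReward ρ (S t).dual (γ t) (x t)) ≤ 10 * bwkRate K m T δ := by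
    intro j
    by_cases hK1 : K = 1
    -- With a single arm the comparator and the played arm coincide.
    · have : ∀ t, x t = j := by
        subst hK1
        exact fun t => Subsingleton.elim _ _
      simp only [this, sub_self, Finset.sum_const_zero]
      linarith
    refine le_trans ?_ (hNexp hK1)
    rw [Finset.sum_sub_distrib]
    refine exp3p_regret (w := fun t => (S t).logW) v (hreg.gamma_pos hK1) hT hreg.alpha_le
      (fun t => (primalReward_mem hρ (hvalid t) _ _).1)
      (fun t => (primalReward_mem hρ (hvalid t) _ _).2) (by rw [hseq0]; rfl)
      (fun t => by rw [hseq]; rfl) hτ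
      (G := fun j => ∑ t ∈ Finset.range τ, primalReward ρ (S t).dual (γ t) j) (fun j => ?_)
      (fun j => ?_) j
    · refine (Finset.sum_le_card_nsmul _ _ 1
        fun t _ => (primalReward_mem hρ (hvalid t) _ _).2).trans ?_
      simpa using hτ
    · have hj := h1 j
      have ha := hreg.alpha_pos
      have hs : 0 < √((K : ℝ) * T) := by positivity
      simp only [estimateIncrement, exp3pScore, Finset.sum_sub_distrib, Finset.sum_add_distrib,
        ← Finset.mul_sum] at hj ⊢
      -- With θ = α/√(KT), dividing the compensator θ²/p by θ gives exactly the confidence bonus of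
      -- EXP3.P. So the bonus pays for the deviation of the estimates and only α√(KT)/4 remains.
      have e : ∀ t, exp3pAlpha K T δ / ((exp3pMix v T (S t).logW).1 j * √(K * T)) =
          √(K * T) / exp3pAlpha K T δ * ((exp3pAlpha K T δ / √(K * T)) ^ 2 /
            (exp3pMix v T (S t).logW).1 j) := fun t => by
        have := (exp3pMix_pos v T (S t).logW j).ne'
        field_simp
      simp only [e, ← Finset.mul_sum]
      generalize ∑ t ∈ Finset.range τ, (exp3pAlpha K T δ / √(K * T)) ^ 2 /
            (exp3pMix v T (S t).logW).1 j = Q at *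
      generalize ∑ t ∈ Finset.range τ, (if j = x t then
        primalReward ρ (S t).dual (γ t) (x t) / (exp3pMix v T (S t).logW).1 j else 0) = X at *
      generalize ∑ t ∈ Finset.range τ, primalReward ρ (S t).dual (γ t) j = G at *
      generalize exp3pAlpha K T δ = a at *
      generalize √((K : ℝ) * T) = s at *
      have h3 : s / a * (a / s * (G - X) - Q) ≤ s / a * (a ^ 2 / 4) :=
        mul_le_mul_of_nonneg_left hj (by positivity)
      have e1 : s / a * (a / s * (G - X) - Q) = G - X - s / a * Q := by field_simp
      have e2 : s / a * (a ^ 2 / 4) = a * s / 4 := by field_simp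
      rw [e1, e2] at h3
      linarith
  have hutil : ∀ j, ∑ t ∈ Finset.range τ, ((γ t).reward j - ∑ i, (S t).dual i * (γ t).cost j i) ≤
      ∑ t ∈ Finset.range τ, ((γ t).reward (x t) - ∑ i, (S t).dual i * (γ t).cost (x t) i) +
        20 * bwkRate K m T δ / ρ := by
    intro j
    have hp : 0 < 1 + 1 / ρ := by positivity
    have e : ∑ t ∈ Finset.range τ, (primalReward ρ (S t).dual (γ t) j -
        primalReward ρ (S t).dual (γ t) (x t)) =
        (∑ t ∈ Finset.range τ, ((γ t).reward j - ∑ i, (S t).dual i * (γ t).cost j i) -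
        ∑ t ∈ Finset.range τ, ((γ t).reward (x t) - ∑ i, (S t).dual i * (γ t).cost (x t) i)) /
          (1 + 1 / ρ) := by
      rw [← Finset.sum_sub_distrib, Finset.sum_div]
      refine Finset.sum_congr rfl fun t _ => ?_
      simp only [primalReward]
      rw [← sub_div]
      ring
    have := hprimal j
    rw [e, div_le_iff₀ hp] at this
    -- Undoing the rescaling of the feedback to [0,1] multiplies the regret by 1 + 1/ρ.
    have h3 : 1 + 1 / ρ ≤ 2 / ρ := by
      rw [← sub_nonneg]
      have : 2 / ρ - (1 + 1 / ρ) = (1 - ρ) / ρ := by field_simp; ring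
      rw [this]
      exact div_nonneg (by linarith) hρ.le
    have h4 : 10 * bwkRate K m T δ * (1 + 1 / ρ) ≤ 10 * bwkRate K m T δ * (2 / ρ) := by gcongr
    have h5 : 10 * bwkRate K m T δ * (2 / ρ) = 20 * bwkRate K m T δ / ρ := by ring
    linarith
  have hmix : ∑ t ∈ Finset.range τ, expect ξ (fun y =>
      (γ t).reward y - ∑ i, (S t).dual i * (γ t).cost y i) ≤
      ∑ t ∈ Finset.range τ, ((γ t).reward (x t) - ∑ i, (S t).dual i * (γ t).cost (x t) i) +
        20 * bwkRate K m T δ / ρ := by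
    simp only [expect]
    rw [Finset.sum_comm]
    simp only [← Finset.mul_sum]
    refine (Finset.sum_le_sum fun j _ => mul_le_mul_of_nonneg_left (hutil j) (ξ.2.1 j)).trans ?_
    rw [← Finset.sum_mul, ξ.2.2, one_mul]
  -- the dual player
  have homd : ∑ t ∈ Finset.range τ, ∑ i, (dualVertex ρ o i - (S t).dual i) *
      (dualCost fb (exp3pMix v T (S t).logW) (γ t) (x t) i - ρ) ≤
      2 * bwkRate K m T δ / ρ := by
    refine (omd_regret (l := fun t => (S t).dual) (g := fun t i =>
      dualCost fb (exp3pMix v T (S t).logW) (γ t) (x t) i - ρ) hρ hreg.omdRate_pos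
      hreg.omdRate_le_one (by rw [hseq0]; rfl) (fun t => by rw [hseq]; rfl) (fun t i => ?_)
      τ o).trans ?_
    · have := dualCost_mem fb (exp3pMix v T (S t).logW) (γ t) (x t) i
      exact abs_le.2 ⟨by linarith [this.1], by linarith [this.2]⟩
    · calc _ ≤ 1 / ρ * (2 * bwkRate K m T δ) := by gcongr
        _ = _ := by ring
  have hdev : ∑ t ∈ Finset.range τ, ∑ i, ((S t).dual i - dualVertex ρ o i) *
      (dualCost fb (exp3pMix v T (S t).logW) (γ t) (x t) i - (γ t).cost (x t) i) ≤
      8 * bwkRate K m T δ / ρ := by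
    refine hDev _ ?_
    have := h2 o
    simp only [dualIncrement, Finset.sum_sub_distrib, ← Finset.mul_sum, Finset.sum_const,
      Finset.card_range, nsmul_eq_mul] at this ⊢
    linarith
  have hdual : ∑ t ∈ Finset.range τ, ∑ i, (S t).dual i * (ρ - (γ t).cost (x t) i) ≤
      10 * bwkRate K m T δ / ρ - (T - τ - 1 / ρ) := by
    -- With u the vertex and ĉ the reported cost: λ(ρ - c) + u(c - ρ) = (u - λ)(ĉ - ρ) + (λ - u)(ĉ -
    -- c). The right side separates the mirror-descent regret from the mean-zero deviation.
    have e : ∑ t ∈ Finset.range τ, ∑ i, (S t).dual i * (ρ - (γ t).cost (x t) i) +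
        ∑ t ∈ Finset.range τ, ∑ i, dualVertex ρ o i * ((γ t).cost (x t) i - ρ) =
        ∑ t ∈ Finset.range τ, ∑ i, (dualVertex ρ o i - (S t).dual i) *
          (dualCost fb (exp3pMix v T (S t).logW) (γ t) (x t) i - ρ) +
        ∑ t ∈ Finset.range τ, ∑ i, ((S t).dual i - dualVertex ρ o i) *
          (dualCost fb (exp3pMix v T (S t).logW) (γ t) (x t) i - (γ t).cost (x t) i) := by
      simp only [← Finset.sum_add_distrib]
      exact Finset.sum_congr rfl fun t _ => Finset.sum_congr rfl fun i _ => by ring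
    have : 10 * bwkRate K m T δ / ρ = 2 * bwkRate K m T δ / ρ + 8 * bwkRate K m T δ / ρ := by ring
    linarith
  -- combination
  have hlag : ∀ t, lagrangian ρ (S t).dual (γ t) ξ = expect ξ (fun y =>
      (γ t).reward y - ∑ i, (S t).dual i * (γ t).cost y i) + ∑ i, (S t).dual i * ρ := by
    intro t
    simp only [lagrangian, expect]
    have : ∑ i, (S t).dual i * ρ = ∑ y, ξ.1 y * ∑ i, (S t).dual i * ρ := by
      rw [← Finset.sum_mul Finset.univ ξ.1, ξ.2.2, one_mul]
    rw [this, ← Finset.sum_add_distrib]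
    refine Finset.sum_congr rfl fun y _ => ?_
    simp only [mul_sub, Finset.sum_sub_distrib]
    ring
  have hsplit : ∑ t ∈ Finset.range τ, ∑ i, (S t).dual i * (ρ - (γ t).cost (x t) i) =
      ∑ t ∈ Finset.range τ, ∑ i, (S t).dual i * ρ -
        ∑ t ∈ Finset.range τ, ∑ i, (S t).dual i * (γ t).cost (x t) i := by
    simp only [mul_sub, Finset.sum_sub_distrib]
  simp only [hlag, Finset.sum_sub_distrib, Finset.sum_add_distrib, Finset.sum_const,
    Finset.card_range, nsmul_eq_mul, mul_one] at hmix ⊢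
  have h6 : 1 / ρ ≤ bwkRate K m T δ / ρ := by gcongr; linarith
  -- The primal regret contributes 20, the dual regret and deviation 2 + 8, and the unspent unit of
  -- budget, worth 1/ρ, contributes 1.
  have e1 : 31 * bwkRate K m T δ / ρ = 20 * bwkRate K m T δ / ρ + 10 * bwkRate K m T δ / ρ +
    bwkRate K m T δ / ρ := by ring
  linarith

/-! ### The failure probability -/

lemma Regime.exp_neg_alpha_sq {T : ℕ} {δ : ℝ} (h : Regime K m T δ) :
    Real.exp (-(exp3pAlpha K T δ ^ 2 / 4)) = δ / (K * T) := by
  have hT : (0 : ℝ) < T := by have := h.two_le; exact_mod_cast (by omega : 0 < T)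
  have hK : (0 : ℝ) < K := by exact_mod_cast h.pos_arms
  have hδ := h.conf_pos
  rw [h.alpha_sq, mul_div_cancel_left₀ _ (by norm_num : (4 : ℝ) ≠ 0), ← Real.log_inv, inv_div,
    Real.exp_log (by positivity)]

/-- Of the three factors δ/(Tm), one supplies δ/(2m) and the other two are each at most 1/2, using T
≥ 2. -/
lemma Regime.exp_neg_le {T : ℕ} {δ : ℝ} (h : Regime K m T δ) :
    Real.exp (-(3 * Real.log (T * m / δ))) ≤ δ / (8 * m) := by
  have hT : (2 : ℝ) ≤ T := by exact_mod_cast h.two_le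
  have hm : (1 : ℝ) ≤ m := by exact_mod_cast h.pos_resources
  have hδ := h.conf_pos
  have hδ1 := h.conf_lt_one
  have e : -(3 * Real.log (T * m / δ)) = (3 : ℕ) * Real.log (δ / (T * m)) := by
    rw [← inv_div δ, Real.log_inv]; push_cast; ring
  rw [e, Real.exp_nat_mul, Real.exp_log (by positivity)]
  have h1 : δ / (T * m) ≤ δ / (2 * m) := by gcongr
  have h2 : δ / (T * m) ≤ 1 / 2 := by
    rw [div_le_div_iff₀ (by positivity) (by norm_num)]
    nlinarith
  have h0 : 0 ≤ δ / (T * m) := by positivity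
  calc (δ / (T * m)) ^ 3 = δ / (T * m) * (δ / (T * m)) ^ 2 := by ring
    _ ≤ δ / (2 * m) * (1 / 2) ^ 2 := by gcongr
    _ = δ / (8 * m) := by field_simp; norm_num

/-- The sum of the normalized exponential supermartingales of the primal and the dual player: a run
is good if it is less than `1`. -/
def badness (T : ℕ) (ρ δ : ℝ) (fb : DualFeedback) {n : ℕ} (γ : Fin n → Input K m v)
    (x : Fin n → Fin K) : ℝ :=
  ∑ j, Real.exp (-(exp3pAlpha K T δ ^ 2 / 4)) *
    Real.exp (runSum T ρ δ fb (estimateIncrement T ρ (exp3pAlpha K T δ / √(K * T)) j) γ x) +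
  ∑ o, Real.exp (-(3 * Real.log (T * m / δ))) *
    Real.exp (runSum T ρ δ fb (dualIncrement T ρ (deviationParam m T ρ δ) fb o) γ x)

lemma badness_nonneg (T : ℕ) (ρ δ : ℝ) (fb : DualFeedback) {n : ℕ} (γ : Fin n → Input K m v)
    (x : Fin n → Fin K) : 0 ≤ badness T ρ δ fb γ x := by
  unfold badness; positivity

/-- The K arm terms cost δ/(KT) each, at most δ/2 in total, and the m + 1 vertex terms at most
δ/(8m) each. This leaves room for one more term of size δ/(8m) in the stochastic case. -/
lemma sum_weight_mul_badness_le {T : ℕ} {ρ δ : ℝ} (hreg : Regime K m T δ) (hρ : 0 < ρ)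
    (fb : DualFeedback) {n : ℕ} (γ : Fin n → Input K m v) :
    ∑ x, weight (metaAlgorithm T ρ δ fb) γ x * badness T ρ δ fb γ x ≤
      δ / 2 + (m + 1) * (δ / (8 * m)) := by
  have hT : (2 : ℝ) ≤ T := by exact_mod_cast hreg.two_le
  have hK : (0 : ℝ) < K := by exact_mod_cast hreg.pos_arms
  have hδ := hreg.conf_pos
  have hs : 0 < √((K : ℝ) * T) := by positivity
  have hA : ∀ j, ∑ x, weight (metaAlgorithm T ρ δ fb) γ x * Real.exp (runSum T ρ δ fb
      (estimateIncrement T ρ (exp3pAlpha K T δ / √(K * T)) j) γ x) ≤ 1 := fun j =>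
    sum_weight_mul_exp_runSum_le hρ (fun s g hs' => sum_mul_exp_estimateIncrement_le hρ
      (div_nonneg hreg.alpha_pos.le hs.le) ((div_le_one hs).2 hreg.alpha_le) j s g hs') n γ
  have hB : ∀ o, ∑ x, weight (metaAlgorithm T ρ δ fb) γ x * Real.exp (runSum T ρ δ fb
      (dualIncrement T ρ (deviationParam m T ρ δ) fb o) γ x) ≤ 1 := fun o =>
    sum_weight_mul_exp_runSum_le hρ (fun s g hs' => sum_mul_exp_dualIncrement_le hρ
      (hreg.deviationParam_pos hρ).le (hreg.deviationParam_mul_le hρ) fb o s g hs') n γ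
  have e : ∑ x, weight (metaAlgorithm T ρ δ fb) γ x * badness T ρ δ fb γ x =
      ∑ j, Real.exp (-(exp3pAlpha K T δ ^ 2 / 4)) *
        ∑ x, weight (metaAlgorithm T ρ δ fb) γ x * Real.exp (runSum T ρ δ fb
          (estimateIncrement T ρ (exp3pAlpha K T δ / √(K * T)) j) γ x) +
      ∑ o, Real.exp (-(3 * Real.log (T * m / δ))) *
        ∑ x, weight (metaAlgorithm T ρ δ fb) γ x * Real.exp (runSum T ρ δ fb
          (dualIncrement T ρ (deviationParam m T ρ δ) fb o) γ x) := by
    simp only [badness, mul_add, Finset.sum_add_distrib, Finset.mul_sum]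
    congr 1 <;>
    · rw [Finset.sum_comm]
      exact Finset.sum_congr rfl fun _ _ => Finset.sum_congr rfl fun _ _ => by ring
  rw [e]
  refine add_le_add ?_ ?_
  · refine (Finset.sum_le_sum fun j _ =>
      mul_le_of_le_one_right (Real.exp_pos _).le (hA j)).trans ?_
    rw [hreg.exp_neg_alpha_sq]
    simp only [Finset.sum_const, Finset.card_univ, Fintype.card_fin, nsmul_eq_mul]
    have : (K : ℝ) * (δ / (K * T)) = δ / T := by field_simp
    rw [this]
    gcongr
  · refine (Finset.sum_le_sum fun o _ =>
      mul_le_of_le_one_right (Real.exp_pos _).le (hB o)).trans ?_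
    simp only [Finset.sum_const, Finset.card_univ, Fintype.card_option, Fintype.card_fin,
      nsmul_eq_mul]
    push_cast
    have := hreg.exp_neg_le
    gcongr

lemma le_of_exp_neg_mul_exp_lt_one {L X : ℝ} (h : Real.exp (-L) * Real.exp X < 1) : X ≤ L := by
  rw [← Real.exp_add, Real.exp_lt_one_iff] at h
  linarith

/-- On good runs the reward is at least the sum of the Lagrangians of any mixture. -/
lemma lagrangian_le_of_badness_lt_one {T : ℕ} {ρ δ : ℝ} (hreg : Regime K m T δ) (hρ : 0 < ρ)
    (hρ1 : ρ ≤ 1) (fb : DualFeedback) (γ : Fin T → Input K m v) (x : Fin T → Fin K)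
    (hbad : badness T ρ δ fb γ x < 1) (ξ : Mixture K) :
    runSum T ρ δ fb (fun s g _ => lagrangian ρ s.dual g ξ - 1) γ x + T ≤
      totalReward γ x + 31 * bwkRate K m T δ / ρ := by
  have hT : 0 < T := by have := hreg.two_le; omega
  -- Periodic extension to infinite sequences allows recursion over natural numbers; the values
  -- beyond the horizon play no role.
  obtain ⟨γ, rfl⟩ : ∃ γ' : ℕ → Input K m v, (fun t : Fin T => γ' t) = γ :=
    ⟨fun n => γ ⟨n % T, Nat.mod_lt _ hT⟩, by funext t; simp [Nat.mod_eq_of_lt t.isLt]⟩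
  obtain ⟨x, rfl⟩ : ∃ x' : ℕ → Fin K, (fun t : Fin T => x' t) = x :=
    ⟨fun n => x ⟨n % T, Nat.mod_lt _ hT⟩, by funext t; simp [Nat.mod_eq_of_lt t.isLt]⟩
  have hexp : ∀ y z : ℝ, 0 ≤ Real.exp y * Real.exp z := fun y z => by positivity
  have h1 : ∀ j, runSum T ρ δ fb (estimateIncrement T ρ (exp3pAlpha K T δ / √(K * T)) j)
      (fun t : Fin T => γ t) (fun t => x t) ≤ exp3pAlpha K T δ ^ 2 / 4 := fun j => by
    refine le_of_exp_neg_mul_exp_lt_one (lt_of_le_of_lt ?_ hbad)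
    refine le_add_of_le_of_nonneg ?_ (Finset.sum_nonneg fun _ _ => hexp _ _)
    exact Finset.single_le_sum (f := fun j => Real.exp (-(exp3pAlpha K T δ ^ 2 / 4)) * Real.exp
      (runSum T ρ δ fb (estimateIncrement T ρ (exp3pAlpha K T δ / √(K * T)) j)
        (fun t : Fin T => γ t) (fun t => x t))) (fun _ _ => hexp _ _) (Finset.mem_univ j)
  have h2 : ∀ o, runSum T ρ δ fb (dualIncrement T ρ (deviationParam m T ρ δ) fb o)
      (fun t : Fin T => γ t) (fun t => x t) ≤ 3 * Real.log (T * m / δ) := fun o => by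
    refine le_of_exp_neg_mul_exp_lt_one (lt_of_le_of_lt ?_ hbad)
    refine le_add_of_nonneg_of_le (Finset.sum_nonneg fun _ _ => hexp _ _) ?_
    exact Finset.single_le_sum (f := fun o => Real.exp (-(3 * Real.log (T * m / δ))) * Real.exp
      (runSum T ρ δ fb (dualIncrement T ρ (deviationParam m T ρ δ) fb o)
        (fun t : Fin T => γ t) (fun t => x t))) (fun _ _ => hexp _ _) (Finset.mem_univ o)
  exact lagrangian_le_totalReward hreg hρ hρ1 fb γ x h1 h2 ξ

/-! ### Adversarial requests -/

lemma totalReward_nonneg {T : ℕ} (γ : Fin T → Input K m v) (x : Fin T → Fin K) :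
    0 ≤ totalReward γ x :=
  Finset.sum_nonneg fun t _ => ((γ t).reward_mem (x t)).1

lemma stoppedReward_le_totalReward {T : ℕ} (ρ : ℝ) (γ : Fin T → Input K m v) (x : Fin T → Fin K) :
    stoppedReward ρ γ x ≤ totalReward γ x :=
  Finset.sum_le_sum fun t _ => by
    split_ifs
    · exact le_rfl
    · exact ((γ t).reward_mem (x t)).1

lemma totalReward_le {T : ℕ} (γ : Fin T → Input K m v) (x : Fin T → Fin K) :
    totalReward γ x ≤ T := by
  refine (Finset.sum_le_card_nsmul Finset.univ _ 1 fun t _ => ((γ t).reward_mem (x t)).2).trans ?_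
  simp

lemma sum_weight_const_mul_totalReward (ξ : Mixture K) :
    ∀ (n : ℕ) (γ : Fin n → Input K m v),
      ∑ x, weight (fun _ _ _ => ξ) γ x * totalReward γ x = ∑ t, expect ξ (γ t).reward
  | 0, γ => by simp [totalReward]
  | n + 1, γ => by
    rw [← Fin.snoc_init_self γ]
    generalize γ (Fin.last n) = g
    generalize hγ' : Fin.init γ = γ'
    change Fin n → Input K m v at γ'
    rw [sum_weight_snoc, Fin.sum_univ_castSucc]
    simp only [totalReward, Fin.sum_univ_castSucc, Fin.snoc_castSucc, Fin.snoc_last]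
    rw [← sum_weight_const_mul_totalReward ξ n γ', ← one_mul (expect ξ g.reward),
      ← sum_weight (fun _ _ _ => ξ) n γ', Finset.sum_mul, ← Finset.sum_add_distrib]
    refine Finset.sum_congr rfl fun x _ => ?_
    rw [← mul_add]
    congr 1
    simp only [mul_add, Finset.sum_add_distrib, ← Finset.sum_mul, ξ.2.2, one_mul]
    rfl

lemma mixture_nonempty (v : Fin K) : Nonempty (Mixture K) := ⟨point v⟩

/-- Dropping the budget only increases the benchmark. The adversarial argument never uses that the
comparator respects it. -/
lemma optFD_le {T : ℕ} {ρ B : ℝ} (γ : Fin T → Input K m v)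
    (h : ∀ ξ : Mixture K, ∑ t, expect ξ (γ t).reward ≤ B) : optFD ρ γ ≤ B := by
  have := mixture_nonempty v
  refine ciSup_le fun ξ => le_trans ?_ (h ξ)
  rw [integral_law, ← sum_weight_const_mul_totalReward]
  exact Finset.sum_le_sum fun x _ =>
    mul_le_mul_of_nonneg_left (stoppedReward_le_totalReward ρ γ x) (weight_nonneg _ γ x)

/-- The mixture `ρ ξ + (1 - ρ) v`. -/
def diluted (v : Fin K) {ρ : ℝ} (hρ : 0 ≤ ρ) (hρ1 : ρ ≤ 1) (ξ : Mixture K) : Mixture K :=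
  ⟨ρ • ξ.1 + (1 - ρ) • (point v).1,
    convex_stdSimplex ℝ (Fin K) ξ.2 (point v).2 hρ (sub_nonneg.2 hρ1) (by ring)⟩

lemma expect_point (v : Fin K) (h : Fin K → ℝ) : expect (point v) h = h v := by
  simp [expect, point, Pi.single_apply]

lemma expect_diluted (v : Fin K) {ρ : ℝ} (hρ : 0 ≤ ρ) (hρ1 : ρ ≤ 1) (ξ : Mixture K)
    (h : Fin K → ℝ) : expect (diluted v hρ hρ1 ξ) h = ρ * expect ξ h + (1 - ρ) * h v := by
  rw [← expect_point v h]
  simp only [expect, diluted, Pi.add_apply, Pi.smul_apply, smul_eq_mul, add_mul,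
    Finset.sum_add_distrib, Finset.mul_sum, mul_assoc]

/-- Costs are at most 1, so the dilution spends at most ρ in expectation on every single request and
the penalty term is nonnegative for every λ. No averaging over requests is needed; the price is the
factor ρ in the reward. -/
lemma le_lagrangian_diluted {ρ : ℝ} (hρ : 0 ≤ ρ) (hρ1 : ρ ≤ 1) {l : Fin m → ℝ} (hl : ∀ i, 0 ≤ l i)
    (g : Input K m v) (ξ : Mixture K) :
    ρ * expect ξ g.reward ≤ lagrangian ρ l g (diluted v hρ hρ1 ξ) := by
  rw [lagrangian, expect_diluted, g.reward_void]
  simp only [g.cost_void, zero_add, sub_zero]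
  -- The unused budget of the void part is moved to the part playing ξ, where ρ - c + (1 - ρ) = 1 -
  -- c is nonnegative.
  have e : (1 - ρ) * ∑ i, l i * ρ = ρ * ∑ y, ξ.1 y * ∑ i, l i * (1 - ρ) := by
    rw [← Finset.sum_mul Finset.univ ξ.1, ξ.2.2, one_mul, ← Finset.sum_mul, ← Finset.sum_mul]
    ring
  rw [e, expect, expect, ← mul_add, ← Finset.sum_add_distrib]
  refine mul_le_mul_of_nonneg_left (Finset.sum_le_sum fun y _ => ?_) hρ
  rw [← mul_add]
  refine mul_le_mul_of_nonneg_left ?_ (ξ.2.1 y)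
  rw [add_assoc, ← Finset.sum_add_distrib]
  refine le_add_of_nonneg_right (Finset.sum_nonneg fun i _ => ?_)
  rw [← mul_add]
  exact mul_nonneg (hl i) (by linarith [(g.cost_mem y i).2])

lemma optFD_sub_le_of_badness_lt_one {T : ℕ} {ρ δ : ℝ} (hreg : Regime K m T δ) (hρ : 0 < ρ)
    (hρ1 : ρ ≤ 1) (fb : DualFeedback) (γ : Fin T → Input K m v) (x : Fin T → Fin K)
    (hbad : badness T ρ δ fb γ x < 1) :
    optFD ρ γ - 1 / ρ * totalReward γ x ≤ 31 * ((1 / ρ) ^ 2 * bwkRate K m T δ) := by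
  rw [sub_le_iff_le_add]
  refine optFD_le γ fun ξ => ?_
  have h := lagrangian_le_of_badness_lt_one hreg hρ hρ1 fb γ x hbad (diluted v hρ.le hρ1 ξ)
  have h2 : ρ * ∑ t, expect ξ (γ t).reward ≤ runSum T ρ δ fb
      (fun s g _ => lagrangian ρ s.dual g (diluted v hρ.le hρ1 ξ) - 1) γ x + T := by
    have eT : (T : ℝ) = ∑ _t : Fin T, (1 : ℝ) := by simp
    rw [runSum, eT, ← Finset.sum_add_distrib, Finset.mul_sum]
    refine Finset.sum_le_sum fun t _ => ?_
    split_ifs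
    · have := le_lagrangian_diluted hρ.le hρ1
        (fun i => ((valid_stateAfter hρ T δ fb t (past γ t) (past x t)).1 i).le) (γ t) ξ
      linarith
    -- An inactive round counts as 1, which is at least ρ times any reward.
    · have := (expect_mem (ξ := ξ) (γ t).reward_mem)
      nlinarith [this.1, this.2]
  have h3 : ∑ t, expect ξ (γ t).reward = 1 / ρ * (ρ * ∑ t, expect ξ (γ t).reward) := by
    field_simp
  rw [h3]
  calc _ ≤ 1 / ρ * (totalReward γ x + 31 * bwkRate K m T δ / ρ) :=
        mul_le_mul_of_nonneg_left (h2.trans h) (by positivity)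
    _ = _ := by ring

/-! ### Measurability -/

@[fun_prop]
lemma measurable_reward (x : Fin K) : Measurable fun g : Input K m v => g.reward x :=
  (measurable_pi_apply x).comp (measurable_fst.comp measurable_subtype_coe)

@[fun_prop]
lemma measurable_cost (x : Fin K) (i : Fin m) : Measurable fun g : Input K m v => g.cost x i :=
  (measurable_pi_apply i).comp ((measurable_pi_apply x).comp
    (measurable_snd.comp measurable_subtype_coe))

lemma measurable_past {A : Type*} [MeasurableSpace A] {n : ℕ} (t : Fin n) :
    Measurable fun γ : Fin n → A => past γ t :=
  measurable_pi_lambda _ fun _ => measurable_pi_apply _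

lemma measurable_snoc {A : Type*} [MeasurableSpace A] {n : ℕ} (γ : Fin n → A) :
    Measurable fun g : A => (Fin.snoc (α := fun _ => A) γ g : Fin (n + 1) → A) := by
  refine measurable_pi_lambda _ fun i => ?_
  refine Fin.lastCases ?_ (fun j => ?_) i
  · simpa using measurable_id'
  · simp

/-- Measurability of a strategy in the requests. -/
def Strategy.IsMeasurable (ψ : Strategy K m v) : Prop :=
  ∀ (t : ℕ) (x : Fin t → Fin K) (a : Fin K), Measurable fun γ => (ψ t γ x).1 a

lemma DynamicPolicy.isMeasurable (ψ : DynamicPolicy K m v) : Strategy.IsMeasurable ψ.1 :=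
  fun t x a => (measurable_pi_apply a).comp (measurable_subtype_coe.comp (ψ.2 t x))

lemma Strategy.IsMeasurable.weight {ψ : Strategy K m v} (hψ : ψ.IsMeasurable) {n : ℕ}
    (x : Fin n → Fin K) : Measurable fun γ : Fin n → Input K m v => weight ψ γ x :=
  Finset.measurable_prod _ fun t _ => (hψ t (past x t) (x t)).comp (measurable_past t)

lemma measurable_exp3pMix {A : Type*} [MeasurableSpace A] (v : Fin K) (T : ℕ) {w : A → Fin K → ℝ}
    (hw : ∀ j, Measurable fun y => w y j) (j : Fin K) :
    Measurable fun y => (exp3pMix v T (w y)).1 j := by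
  change Measurable fun y => (1 - exp3pGamma K T) * (Real.exp (w y j) / ∑ k, Real.exp (w y k)) +
    exp3pGamma K T / K
  fun_prop

lemma measurable_stateAfter (T : ℕ) (ρ δ : ℝ) (fb : DualFeedback) :
    ∀ (n : ℕ) (x : Fin n → Fin K),
      (∀ j, Measurable fun γ : Fin n → Input K m v => (stateAfter T ρ δ fb n γ x).logW j) ∧
      (∀ i, Measurable fun γ : Fin n → Input K m v => (stateAfter T ρ δ fb n γ x).dual i) ∧
      ∀ i, Measurable fun γ : Fin n → Input K m v => (stateAfter T ρ δ fb n γ x).budget i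
  | 0, _ => ⟨fun _ => measurable_const, fun _ => measurable_const, fun _ => measurable_const⟩
  | n + 1, x => by
    obtain ⟨h1, h2, h3⟩ := measurable_stateAfter T ρ δ fb n fun s => x s.castSucc
    have hinit : Measurable fun γ : Fin (n + 1) → Input K m v => fun s : Fin n => γ s.castSucc :=
      measurable_pi_lambda _ fun _ => measurable_pi_apply _
    replace h1 := fun j => (h1 j).comp hinit
    replace h2 := fun i => (h2 i).comp hinit
    replace h3 := fun i => (h3 i).comp hinit
    have h4 := measurable_exp3pMix v T h1
    have hr : ∀ a, Measurable fun γ : Fin (n + 1) → Input K m v => (γ (Fin.last n)).reward a :=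
      fun a => (measurable_reward a).comp (measurable_pi_apply _)
    have hc : ∀ a i, Measurable fun γ : Fin (n + 1) → Input K m v => (γ (Fin.last n)).cost a i :=
      fun a i => (measurable_cost a i).comp (measurable_pi_apply _)
    simp only [Function.comp_def] at h1 h2 h3 h4
    have hd : ∀ i, Measurable fun γ : Fin (n + 1) → Input K m v =>
        dualCost fb (exp3pMix v T (stateAfter T ρ δ fb n (fun s => γ s.castSucc)
          fun s => x s.castSucc).logW) (γ (Fin.last n)) (x (Fin.last n)) i := by
      intro i
      cases fb with
      | expected => simp only [dualCost, expect]; fun_prop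
      | realized => exact hc _ i
    refine ⟨fun j => ?_, fun i => ?_, fun i => ?_⟩
    · simp only [stateAfter, step, exp3pUpdate, primalReward]
      refine (h1 j).add (measurable_const.mul (Measurable.add ?_ ?_))
      · split_ifs
        · fun_prop
        · exact measurable_const
      · fun_prop
    · simp only [stateAfter, step, omdStep, slack]
      fun_prop
    · simp only [stateAfter, step]
      fun_prop

lemma measurableSet_active (T : ℕ) (ρ δ : ℝ) (fb : DualFeedback) {n : ℕ} (x : Fin n → Fin K) :
    MeasurableSet {γ : Fin n → Input K m v | (stateAfter T ρ δ fb n γ x).Active} := by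
  simp only [State.Active, Set.ofPred_forall]
  exact MeasurableSet.iInter fun i =>
    measurableSet_le measurable_const ((measurable_stateAfter T ρ δ fb n x).2.2 i)

lemma isMeasurable_metaAlgorithm (T : ℕ) (ρ δ : ℝ) (fb : DualFeedback) :
    Strategy.IsMeasurable (metaAlgorithm T ρ δ fb : Strategy K m v) := by
  classical
  intro t x a
  have e : (fun γ : Fin t → Input K m v => (metaAlgorithm T ρ δ fb t γ x).1 a) = fun γ =>
      if (stateAfter T ρ δ fb t γ x).Active then
        (exp3pMix v T (stateAfter T ρ δ fb t γ x).logW).1 a else (point v).1 a := by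
    funext γ
    by_cases h : (stateAfter T ρ δ fb t γ x).Active
    · rw [metaAlgorithm_of_active h, if_pos h]
    · rw [metaAlgorithm_of_not_active h, if_neg h]
  rw [e]
  exact Measurable.ite (measurableSet_active T ρ δ fb x)
    (measurable_exp3pMix v T (measurable_stateAfter T ρ δ fb t x).1 a) measurable_const

/-! ### Averages over i.i.d. requests -/

section Average

variable {n : ℕ}

lemma abs_sum_weight_mul_le (ψ : Strategy K m v) (γ : Fin n → Input K m v)
    {F : (Fin n → Fin K) → ℝ} {B : ℝ} (hF : ∀ x, |F x| ≤ B) :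
    |∑ x, weight ψ γ x * F x| ≤ B := by
  refine (Finset.abs_sum_le_sum_abs _ _).trans ?_
  have : ∑ x, weight ψ γ x * B = B := by rw [← Finset.sum_mul, sum_weight, one_mul]
  rw [← this]
  refine Finset.sum_le_sum fun x _ => ?_
  rw [abs_mul, abs_of_nonneg (weight_nonneg ψ γ x)]
  exact mul_le_mul_of_nonneg_left (hF x) (weight_nonneg ψ γ x)

variable (D : Measure (Input K m v)) [IsProbabilityMeasure D]

lemma integrable_of_abs_le {A : Type*} [MeasurableSpace A] {μ : Measure A} [IsFiniteMeasure μ]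
    {F : A → ℝ} {B : ℝ} (hF : Measurable F) (hB : ∀ y, |F y| ≤ B) : Integrable F μ :=
  Integrable.of_bound hF.aestronglyMeasurable B (Filter.Eventually.of_forall hB)

lemma integrable_sum_weight_mul {ψ : Strategy K m v} (hψ : ψ.IsMeasurable)
    {F : (Fin n → Input K m v) → (Fin n → Fin K) → ℝ} {B : ℝ}
    (hF : ∀ x, Measurable fun γ => F γ x) (hB : ∀ γ x, |F γ x| ≤ B) :
    Integrable (fun γ => ∑ x, weight ψ γ x * F γ x) (Measure.pi fun _ => D) :=
  integrable_of_abs_le (Finset.measurable_sum _ fun x _ => (hψ.weight x).mul (hF x))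
    fun γ => abs_sum_weight_mul_le ψ γ (hB γ)

lemma integral_pi_snoc {F : (Fin (n + 1) → Input K m v) → ℝ} (hF : Measurable F) {B : ℝ}
    (hB : ∀ γ, |F γ| ≤ B) : ∫ γ, F γ ∂(Measure.pi fun _ => D) =
      ∫ γ : Fin n → Input K m v, ∫ g, F (Fin.snoc (α := fun _ => Input K m v) γ g) ∂D
        ∂(Measure.pi fun _ => D) := by
  have hmp := (measurePreserving_piFinSuccAbove (fun _ : Fin (n + 1) => D) (Fin.last n)).symm
  rw [← hmp.integral_comp' F, integral_prod_symm]
  · refine integral_congr_ae (Filter.Eventually.of_forall fun γ => ?_)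
    refine integral_congr_ae (Filter.Eventually.of_forall fun g => ?_)
    change F (Fin.insertNth (Fin.last n) g γ) = _
    rw [Fin.insertNth_last']
  · exact integrable_of_abs_le (hF.comp (MeasurableEquiv.measurable _)) fun y => hB _

/-- The average of `F` over i.i.d. requests and the arms of `ψ`. -/
def average (ψ : Strategy K m v) (n : ℕ)
    (F : (Fin n → Input K m v) → (Fin n → Fin K) → ℝ) : ℝ :=
  ∫ γ : Fin n → Input K m v, ∑ x, weight ψ γ x * F γ x ∂(Measure.pi fun _ => D)

/-- The last request is independent of the past, and the last mixture is chosen without seeing it.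
Fubini therefore allows both to be averaged with the past held fixed. -/
lemma average_succ {ψ : Strategy K m v} (hψ : ψ.IsMeasurable)
    {F : (Fin (n + 1) → Input K m v) → (Fin (n + 1) → Fin K) → ℝ} {B : ℝ}
    (hF : ∀ x, Measurable fun γ => F γ x) (hB : ∀ γ x, |F γ x| ≤ B) :
    average D ψ (n + 1) F = average D ψ n fun γ x => ∫ g, ∑ a, (ψ n γ x).1 a *
      F (Fin.snoc (α := fun _ => Input K m v) γ g) (Fin.snoc (α := fun _ => Fin K) x a) ∂D := by
  have hm : Measurable fun γ => ∑ x, weight ψ γ x * F γ x :=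
    Finset.measurable_sum _ fun x _ => (hψ.weight x).mul (hF x)
  rw [average, integral_pi_snoc D hm fun γ => abs_sum_weight_mul_le ψ γ (hB γ)]
  refine integral_congr_ae (Filter.Eventually.of_forall fun γ => ?_)
  simp only [sum_weight_snoc]
  rw [integral_finsetSum]
  · exact Finset.sum_congr rfl fun x _ => integral_const_mul _ _
  · intro x _
    refine Integrable.const_mul (integrable_finsetSum _ fun a _ => Integrable.const_mul ?_ _) _
    exact integrable_of_abs_le ((hF _).comp (measurable_snoc γ)) fun g => hB _ _

/-- The smaller function is only required to be nonnegative, so no measurability has to be proved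
for it, for instance for `stoppedReward`. -/
lemma average_mono {ψ : Strategy K m v} (hψ : ψ.IsMeasurable)
    {F G : (Fin n → Input K m v) → (Fin n → Fin K) → ℝ} {B : ℝ}
    (hF : ∀ γ x, 0 ≤ F γ x) (hG : ∀ x, Measurable fun γ => G γ x) (hB : ∀ γ x, |G γ x| ≤ B)
    (hFG : ∀ γ x, F γ x ≤ G γ x) : average D ψ n F ≤ average D ψ n G :=
  integral_mono_of_nonneg
    (Filter.Eventually.of_forall fun γ =>
      Finset.sum_nonneg fun x _ => mul_nonneg (weight_nonneg ψ γ x) (hF γ x))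
    (integrable_sum_weight_mul D hψ hG hB)
    (Filter.Eventually.of_forall fun γ =>
      Finset.sum_le_sum fun x _ => mul_le_mul_of_nonneg_left (hFG γ x) (weight_nonneg ψ γ x))

lemma average_const (ψ : Strategy K m v) (c : ℝ) : average D ψ n (fun _ _ => c) = c := by
  simp only [average, ← Finset.sum_mul, sum_weight, one_mul]
  simp

end Average

/-! ### Deviations of the requests -/

section Stochastic

variable (D : Measure (Input K m v))

/-- The expected reward of a mixture. -/
def meanReward (ξ : Mixture K) : ℝ := expect ξ fun y => ∫ g, g.reward y ∂D

/-- The expected cost of a mixture. -/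
def meanCost (ξ : Mixture K) (i : Fin m) : ℝ := expect ξ fun y => ∫ g, g.cost y i ∂D

lemma measurable_lagrangian {A : Type*} [MeasurableSpace A] (ρ : ℝ) (ξ : Mixture K)
    {l : A → Fin m → ℝ} {g : A → Input K m v} (hl : ∀ i, Measurable fun y => l y i)
    (hg : Measurable g) : Measurable fun y => lagrangian ρ (l y) (g y) ξ := by
  have hr : ∀ a, Measurable fun y => (g y).reward a := fun a => (measurable_reward a).comp hg
  have hc : ∀ a i, Measurable fun y => (g y).cost a i := fun a i => (measurable_cost a i).comp hg
  simp only [lagrangian, expect]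
  fun_prop

/-- The increments that control the deviation of the Lagrangians from the expected reward. -/
def requestIncrement (ρ θ : ℝ) (ξ : Mixture K) (s : State K m) (g : Input K m v)
    (_x : Fin K) : ℝ :=
  θ * (meanReward D ξ - lagrangian ρ s.dual g ξ) - θ ^ 2 * (2 / ρ) ^ 2

lemma measurable_runSum_requestIncrement (T : ℕ) (ρ δ θ : ℝ) (fb : DualFeedback) (ξ : Mixture K)
    {n : ℕ} (x : Fin n → Fin K) :
    Measurable fun γ : Fin n → Input K m v =>
      runSum T ρ δ fb (requestIncrement D ρ θ ξ) γ x := by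
  classical
  refine Finset.measurable_sum _ fun t _ => ?_
  refine Measurable.ite (measurable_past t (measurableSet_active T ρ δ fb (past x t))) ?_
    measurable_const
  refine Measurable.sub (Measurable.const_mul (Measurable.sub measurable_const ?_) _)
    measurable_const
  exact measurable_lagrangian ρ ξ
    (fun i => ((measurable_stateAfter T ρ δ fb t (past x t)).2.1 i).comp (measurable_past t))
    (measurable_pi_apply t)

variable [IsProbabilityMeasure D]

lemma integral_mem_of_mem {h : Input K m v → ℝ} (hh : ∀ g, h g ∈ Set.Icc (0 : ℝ) 1) :
    ∫ g, h g ∂D ∈ Set.Icc (0 : ℝ) 1 := by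
  refine ⟨integral_nonneg fun g => (hh g).1, ?_⟩
  calc ∫ g, h g ∂D ≤ ∫ _g, (1 : ℝ) ∂D :=
        integral_mono_of_nonneg (Filter.Eventually.of_forall fun g => (hh g).1)
          (integrable_const _) (Filter.Eventually.of_forall fun g => (hh g).2)
    _ = 1 := by simp

lemma abs_le_one_of_mem {y : ℝ} (h : y ∈ Set.Icc (0 : ℝ) 1) : |y| ≤ 1 :=
  abs_le.2 ⟨by linarith [h.1], h.2⟩

lemma integrable_reward (y : Fin K) : Integrable (fun g : Input K m v => g.reward y) D :=
  integrable_of_abs_le (measurable_reward y) fun g => abs_le_one_of_mem (g.reward_mem y)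

lemma integrable_cost (y : Fin K) (i : Fin m) : Integrable (fun g : Input K m v => g.cost y i) D :=
  integrable_of_abs_le (measurable_cost y i) fun g => abs_le_one_of_mem (g.cost_mem y i)

lemma meanReward_mem (ξ : Mixture K) : meanReward D ξ ∈ Set.Icc (0 : ℝ) 1 :=
  expect_mem fun y => integral_mem_of_mem D fun g => g.reward_mem y

lemma abs_expect_le {ξ : Mixture K} {h : Fin K → ℝ} {B : ℝ} (hh : ∀ x, |h x| ≤ B) :
    |expect ξ h| ≤ B := by
  refine (Finset.abs_sum_le_sum_abs _ _).trans ?_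
  have : ∑ x, ξ.1 x * B = B := by rw [← Finset.sum_mul Finset.univ ξ.1, ξ.2.2, one_mul]
  rw [← this]
  refine Finset.sum_le_sum fun x _ => ?_
  rw [abs_mul, abs_of_nonneg (ξ.2.1 x)]
  exact mul_le_mul_of_nonneg_left (hh x) (ξ.2.1 x)

lemma abs_meanReward_sub_lagrangian_le {ρ : ℝ} (hρ : 0 < ρ) (hρ1 : ρ ≤ 1) {s : State K m}
    (hs : s.Valid ρ) (g : Input K m v) (ξ : Mixture K) :
    |meanReward D ξ - lagrangian ρ s.dual g ξ| ≤ 2 / ρ := by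
  have h1 := meanReward_mem D ξ
  have h2 := expect_mem (ξ := ξ) g.reward_mem
  have h3 : |expect ξ fun y => ∑ i, s.dual i * (ρ - g.cost y i)| ≤ 1 / ρ :=
    abs_expect_le fun y => sum_mul_mem (fun i => (hs.1 i).le) hs.sum_dual_le fun i => by
      have := g.cost_mem y i
      exact abs_le.2 ⟨by linarith [this.2], by linarith [this.1]⟩
  have e : lagrangian ρ s.dual g ξ = expect ξ g.reward +
      expect ξ fun y => ∑ i, s.dual i * (ρ - g.cost y i) := by
    simp only [lagrangian, expect, mul_add, Finset.sum_add_distrib]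
  have h4 : 1 ≤ 1 / ρ := by rw [le_div_iff₀ hρ]; linarith
  have h5 : 2 / ρ = 1 / ρ + 1 / ρ := by ring
  have h6 := abs_le.1 h3
  rw [e]
  exact abs_le.2 ⟨by linarith [h1.1, h2.2], by linarith [h1.2, h2.1]⟩

/-- Weak duality: on average the penalty is ⟨l, ρ - mean cost⟩, which is nonnegative for a mixture
that respects the budget in the mean. -/
lemma meanReward_le_integral_lagrangian {ρ : ℝ} {l : Fin m → ℝ} (hl : ∀ i, 0 ≤ l i)
    {ξ : Mixture K} (hξ : ∀ i, meanCost D ξ i ≤ ρ) :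
    meanReward D ξ ≤ ∫ g, lagrangian ρ l g ξ ∂D := by
  have hi : ∀ y i, Integrable (fun g : Input K m v => l i * (ρ - g.cost y i)) D := fun y i =>
    ((integrable_const ρ).sub (integrable_cost D y i)).const_mul _
  have hadd : ∀ y, Integrable
      (fun g : Input K m v => g.reward y + ∑ i, l i * (ρ - g.cost y i)) D := fun y =>
    (integrable_reward D y).add (integrable_finsetSum _ fun i _ => hi y i)
  have e : ∫ g, lagrangian ρ l g ξ ∂D = meanReward D ξ + ∑ i, l i * (ρ - meanCost D ξ i) := by
    simp only [lagrangian, expect]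
    rw [integral_finsetSum _ fun y _ => (hadd y).const_mul _]
    have e1 : ∀ y, ∫ g, ξ.1 y * (g.reward y + ∑ i, l i * (ρ - g.cost y i)) ∂D =
        ξ.1 y * ∫ g, g.reward y ∂D + ∑ i, l i * (ξ.1 y * ρ - ξ.1 y * ∫ g, g.cost y i ∂D) := by
      intro y
      rw [integral_const_mul, integral_add (integrable_reward D y)
        (integrable_finsetSum _ fun i _ => hi y i), integral_finsetSum _ fun i _ => hi y i,
        mul_add, Finset.mul_sum]
      congr 1
      refine Finset.sum_congr rfl fun i _ => ?_
      rw [integral_const_mul, integral_sub (integrable_const ρ) (integrable_cost D y i)]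
      simp
      ring
    rw [Finset.sum_congr rfl fun y _ => e1 y, Finset.sum_add_distrib, Finset.sum_comm]
    congr 1
    refine Finset.sum_congr rfl fun i _ => ?_
    rw [← Finset.mul_sum, Finset.sum_sub_distrib, ← Finset.sum_mul Finset.univ ξ.1, ξ.2.2, one_mul]
    rfl
  rw [e]
  exact le_add_of_nonneg_right
    (Finset.sum_nonneg fun i _ => mul_nonneg (hl i) (sub_nonneg.2 (hξ i)))

lemma requestIncrement_le_one {ρ θ : ℝ} (hρ : 0 < ρ) (hρ1 : ρ ≤ 1) (hθ0 : 0 ≤ θ)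
    (hθ1 : θ * (2 / ρ) ≤ 1) (ξ : Mixture K) {s : State K m} (hs : s.Valid ρ) (g : Input K m v)
    (x : Fin K) : requestIncrement D ρ θ ξ s g x ≤ 1 := by
  have h1 := (abs_le.1 (abs_meanReward_sub_lagrangian_le D hρ hρ1 hs g ξ)).2
  have h2 := mul_le_mul_of_nonneg_left h1 hθ0
  have h3 : 0 ≤ θ ^ 2 * (2 / ρ) ^ 2 := by positivity
  unfold requestIncrement
  linarith

/-- The state is fixed while the request is averaged. The difference from the mean reward then has
mean at most 0 and absolute value at most 2/ρ, so the compensator dominates the second-order term.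
-/
lemma integral_exp_requestIncrement_le {ρ θ : ℝ} (hρ : 0 < ρ) (hρ1 : ρ ≤ 1) (hθ0 : 0 ≤ θ)
    (hθ1 : θ * (2 / ρ) ≤ 1) {ξ : Mixture K} (hξ : ∀ i, meanCost D ξ i ≤ ρ) {s : State K m}
    (hs : s.Valid ρ) (x : Fin K) : ∫ g, Real.exp (requestIncrement D ρ θ ξ s g x) ∂D ≤ 1 := by
  have hb := fun g => abs_meanReward_sub_lagrangian_le D hρ hρ1 hs g ξ
  have hL : Measurable fun g : Input K m v => lagrangian ρ s.dual g ξ :=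
    measurable_lagrangian ρ ξ (fun _ => measurable_const) measurable_id
  have hz : Measurable fun g : Input K m v => meanReward D ξ - lagrangian ρ s.dual g ξ :=
    measurable_const.sub hL
  have hzi := integrable_of_abs_le (μ := D) hz hb
  have hLi : Integrable (fun g : Input K m v => lagrangian ρ s.dual g ξ) D := by
    refine ((integrable_const (meanReward D ξ)).sub hzi).congr
      (Filter.Eventually.of_forall fun g => ?_)
    simp
  set c := θ ^ 2 * (2 / ρ) ^ 2 with hc
  have hmean : ∫ g, (meanReward D ξ - lagrangian ρ s.dual g ξ) ∂D ≤ 0 := by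
    rw [integral_sub (integrable_const _) hLi]
    have := meanReward_le_integral_lagrangian D (fun i => (hs.1 i).le) hξ
    simpa using this
  have hpt : ∀ g, Real.exp (requestIncrement D ρ θ ξ s g x) ≤
      Real.exp (-c) * (1 + c + θ * (meanReward D ξ - lagrangian ρ s.dual g ξ)) := by
    intro g
    rw [requestIncrement, sub_eq_add_neg, add_comm, Real.exp_add]
    refine mul_le_mul_of_nonneg_left ?_ (Real.exp_pos _).le
    have h1 := abs_le.1 (hb g)
    have h2 := exp_le_one_add_add_sq
      ((mul_le_mul_of_nonneg_left h1.2 hθ0).trans hθ1)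
    have h3 : (θ * (meanReward D ξ - lagrangian ρ s.dual g ξ)) ^ 2 ≤ c := by
      rw [mul_pow]
      exact mul_le_mul_of_nonneg_left (sq_le_sq' (by linarith [h1.1]) h1.2) (sq_nonneg θ)
    linarith
  have hint : Integrable (fun g : Input K m v =>
      Real.exp (-c) * (1 + c + θ * (meanReward D ξ - lagrangian ρ s.dual g ξ))) D :=
    ((integrable_const _).add (hzi.const_mul _)).const_mul _
  refine (integral_mono_of_nonneg (Filter.Eventually.of_forall fun g => (Real.exp_pos _).le) hint
    (Filter.Eventually.of_forall hpt)).trans ?_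
  rw [integral_const_mul, integral_add (integrable_const _) (hzi.const_mul _), integral_const_mul]
  simp only [integral_const, probReal_univ, smul_eq_mul, one_mul]
  rw [Real.exp_neg, ← div_eq_inv_mul, div_le_one (Real.exp_pos _)]
  have := Real.add_one_le_exp c
  have := mul_nonpos_of_nonneg_of_nonpos hθ0 hmean
  linarith

/-- A crude bound, needed only for the integrability of the exponential. -/
lemma runSum_requestIncrement_le {T : ℕ} {ρ θ : ℝ} (δ : ℝ) (hρ : 0 < ρ) (hρ1 : ρ ≤ 1) (hθ0 : 0 ≤ θ)
    (hθ1 : θ * (2 / ρ) ≤ 1) (fb : DualFeedback) (ξ : Mixture K) {n : ℕ}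
    (γ : Fin n → Input K m v) (x : Fin n → Fin K) :
    runSum T ρ δ fb (requestIncrement D ρ θ ξ) γ x ≤ n := by
  refine (Finset.sum_le_card_nsmul Finset.univ _ 1 fun t _ => ?_).trans (by simp)
  split_ifs
  · exact requestIncrement_le_one D hρ hρ1 hθ0 hθ1 ξ (valid_stateAfter hρ T δ fb t _ _) _ _
  · exact zero_le_one

lemma average_exp_runSum_requestIncrement_le {T : ℕ} {ρ θ : ℝ} (δ : ℝ) (hρ : 0 < ρ) (hρ1 : ρ ≤ 1)
    (hθ0 : 0 ≤ θ) (hθ1 : θ * (2 / ρ) ≤ 1) (fb : DualFeedback) {ξ : Mixture K}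
    (hξ : ∀ i, meanCost D ξ i ≤ ρ) : ∀ n, average D (metaAlgorithm T ρ δ fb) n
      (fun γ x => Real.exp (runSum T ρ δ fb (requestIncrement D ρ θ ξ) γ x)) ≤ 1
  | 0 => by simp [average, weight, runSum]
  | n + 1 => by
    classical
    have hψ := isMeasurable_metaAlgorithm (m := m) (v := v) T ρ δ fb
    have hbd : ∀ (n : ℕ) (γ : Fin n → Input K m v) (x : Fin n → Fin K),
        |Real.exp (runSum T ρ δ fb (requestIncrement D ρ θ ξ) γ x)| ≤ Real.exp n := by
      intro n γ x
      rw [abs_of_pos (Real.exp_pos _)]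
      exact Real.exp_le_exp.2 (runSum_requestIncrement_le D δ hρ hρ1 hθ0 hθ1 fb ξ γ x)
    have hme : ∀ (n : ℕ) (x : Fin n → Fin K), Measurable fun γ : Fin n → Input K m v =>
        Real.exp (runSum T ρ δ fb (requestIncrement D ρ θ ξ) γ x) := fun n x =>
      Real.measurable_exp.comp (measurable_runSum_requestIncrement D T ρ δ θ fb ξ x)
    rw [average_succ D hψ (hme (n + 1)) (hbd (n + 1))]
    refine (average_mono D hψ (fun γ x => integral_nonneg fun g => Finset.sum_nonneg fun a _ =>
      mul_nonneg ((metaAlgorithm T ρ δ fb n γ x).2.1 a) (Real.exp_pos _).le) (hme n) (hbd n)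
      fun γ x => ?_).trans (average_exp_runSum_requestIncrement_le δ hρ hρ1 hθ0 hθ1 fb hξ n)
    simp only [runSum_snoc, Real.exp_add]
    -- The increment ignores the played arm, so averaging over it changes nothing; `v` stands for an
    -- arbitrary arm.
    have e : ∀ g, ∑ a, (metaAlgorithm T ρ δ fb n γ x).1 a *
        (Real.exp (runSum T ρ δ fb (requestIncrement D ρ θ ξ) γ x) *
          Real.exp (if (stateAfter T ρ δ fb n γ x).Active then
            requestIncrement D ρ θ ξ (stateAfter T ρ δ fb n γ x) g a else 0)) =
        Real.exp (runSum T ρ δ fb (requestIncrement D ρ θ ξ) γ x) *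
          Real.exp (if (stateAfter T ρ δ fb n γ x).Active then
            requestIncrement D ρ θ ξ (stateAfter T ρ δ fb n γ x) g v else 0) := by
      intro g
      have := (metaAlgorithm T ρ δ fb n γ x).2.2
      change ∑ a, (metaAlgorithm T ρ δ fb n γ x).1 a *
        (Real.exp (runSum T ρ δ fb (requestIncrement D ρ θ ξ) γ x) *
          Real.exp (if (stateAfter T ρ δ fb n γ x).Active then
            requestIncrement D ρ θ ξ (stateAfter T ρ δ fb n γ x) g v else 0)) = _
      rw [← Finset.sum_mul Finset.univ, this, one_mul]
    simp only [e]
    rw [integral_const_mul]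
    refine mul_le_of_le_one_right (Real.exp_pos _).le ?_
    split_ifs
    · exact integral_exp_requestIncrement_le D hρ hρ1 hθ0 hθ1 hξ
        (valid_stateAfter hρ T δ fb n γ x) v
    · simp

end Stochastic

/-! ### Dynamic policies -/

/-- The costs so far do not exceed the budget `b`. -/
def Affordable (b : ℝ) {n : ℕ} (γ : Fin n → Input K m v) (x : Fin n → Fin K) : Prop :=
  ∀ i, ∑ s, (γ s).cost (x s) i ≤ b

lemma measurableSet_affordable (b : ℝ) {n : ℕ} (x : Fin n → Fin K) :
    MeasurableSet {γ : Fin n → Input K m v | Affordable b γ x} := by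
  simp only [Affordable, Set.ofPred_forall]
  exact MeasurableSet.iInter fun i => measurableSet_le (Finset.measurable_sum _ fun s _ =>
    (measurable_cost (x s) i).comp (measurable_pi_apply s)) measurable_const

open Classical in
/-- The sum of `φ` over the rounds that begin within the budget `b`. -/
def budgetedSum (b : ℝ) (φ : Input K m v → Fin K → ℝ) {n : ℕ} (γ : Fin n → Input K m v)
    (x : Fin n → Fin K) : ℝ :=
  ∑ t : Fin n, if Affordable b (past γ t) (past x t) then φ (γ t) (x t) else 0

open Classical in
lemma budgetedSum_snoc (b : ℝ) (φ : Input K m v → Fin K → ℝ) {n : ℕ} (γ : Fin n → Input K m v)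
    (g : Input K m v) (x : Fin n → Fin K) (a : Fin K) :
    budgetedSum b φ (Fin.snoc (α := fun _ => Input K m v) γ g)
        (Fin.snoc (α := fun _ => Fin K) x a) =
      budgetedSum b φ γ x + if Affordable b γ x then φ g a else 0 := by
  simp only [budgetedSum]
  rw [Fin.sum_univ_castSucc]
  simp only [past_snoc_castSucc, Fin.snoc_castSucc, Fin.snoc_last]
  have e1 := past_snoc_last γ g
  have e2 := past_snoc_last x a
  congr 1
  change (if Affordable b (n := n) (past _ (Fin.last n)) (past _ (Fin.last n)) then _ else _) = _
  rw [e1, e2]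

lemma measurable_budgetedSum (b : ℝ) {φ : Input K m v → Fin K → ℝ}
    (hφ : ∀ a, Measurable fun g => φ g a) {n : ℕ} (x : Fin n → Fin K) :
    Measurable fun γ : Fin n → Input K m v => budgetedSum b φ γ x := by
  classical
  exact Finset.measurable_sum _ fun t _ => Measurable.ite
    (measurable_past t (measurableSet_affordable b (past x t)))
    ((hφ (x t)).comp (measurable_pi_apply t)) measurable_const

lemma budgetedSum_mem (b : ℝ) {φ : Input K m v → Fin K → ℝ}
    (hφ : ∀ g a, φ g a ∈ Set.Icc (0 : ℝ) 1) {n : ℕ} (γ : Fin n → Input K m v) (x : Fin n → Fin K) :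
    budgetedSum b φ γ x ∈ Set.Icc (0 : ℝ) n := by
  refine ⟨Finset.sum_nonneg fun t _ => ?_,
    (Finset.sum_le_card_nsmul Finset.univ _ 1 fun t _ => ?_).trans (by simp)⟩
  · split_ifs
    · exact (hφ _ _).1
    · exact le_rfl
  · split_ifs
    · exact (hφ _ _).2
    · exact zero_le_one

/-- Testing the budget before the round instead of after it makes the condition a function of the
past, hence independent of the current request. The relaxation admits at most one overshooting
round. -/
lemma stoppedReward_le_budgetedSum {T : ℕ} (ρ : ℝ) (γ : Fin T → Input K m v) (x : Fin T → Fin K) :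
    stoppedReward ρ γ x ≤ budgetedSum (ρ * T) Input.reward γ x := by
  classical
  refine Finset.sum_le_sum fun t _ => ?_
  by_cases h : ∀ i : Fin m, ∑ s ∈ Finset.Iic t, (γ s).cost (x s) i ≤ ρ * T
  · rw [if_pos h, if_pos]
    intro i
    refine le_trans ?_ (h i)
    have e : ∑ s : Fin t, (past γ t s).cost (past x t s) i =
        ∑ s ∈ Finset.univ.map (Fin.castLEEmb t.isLt.le), (γ s).cost (x s) i := by
      rw [Finset.sum_map]
      rfl
    rw [e]
    refine Finset.sum_le_sum_of_subset_of_nonneg (fun s hs => ?_)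
      fun s _ _ => ((γ s).cost_mem (x s) i).1
    obtain ⟨s, -, rfl⟩ := Finset.mem_map.1 hs
    exact Finset.mem_Iic.2 (Fin.le_def.2 s.isLt.le)
  · rw [if_neg h]
    split_ifs
    · exact ((γ t).reward_mem (x t)).1
    · exact le_rfl

/-- A counted round begins with true consumption at most `b` and adds at most 1. The comparison with
the true consumption is carried along to make the induction close. -/
lemma budgetedSum_cost_le {b : ℝ} (hb : 0 ≤ b) (i : Fin m) : ∀ {n : ℕ} (γ : Fin n → Input K m v)
    (x : Fin n → Fin K), budgetedSum b (fun g a => g.cost a i) γ x ≤ ∑ s, (γ s).cost (x s) i ∧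
      budgetedSum b (fun g a => g.cost a i) γ x ≤ b + 1
  | 0, γ, x => by
    simp [budgetedSum]
    linarith
  | n + 1, γ, x => by
    classical
    rw [← Fin.snoc_init_self γ, ← Fin.snoc_init_self x]
    generalize γ (Fin.last n) = g
    generalize x (Fin.last n) = a
    generalize Fin.init γ = γ'
    generalize Fin.init x = x'
    change Fin n → Input K m v at γ'
    change Fin n → Fin K at x'
    obtain ⟨h1, h2⟩ := budgetedSum_cost_le hb i γ' x'
    rw [budgetedSum_snoc, Fin.sum_univ_castSucc]
    simp only [Fin.snoc_castSucc, Fin.snoc_last]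
    have hc := g.cost_mem a i
    split_ifs with h
    · have := h i
      exact ⟨by linarith, by linarith [hc.2]⟩
    · exact ⟨by linarith [hc.1], by linarith⟩

section Policy

variable (D : Measure (Input K m v))

open Classical in
/-- The expected number of rounds that begin within the budget and in which `j` is played. -/
def occupation (ψ : Strategy K m v) (b : ℝ) (n : ℕ) (j : Fin K) : ℝ :=
  ∑ t ∈ Finset.range n, average D ψ t fun γ x => if Affordable b γ x then (ψ t γ x).1 j else 0

lemma occupation_nonneg (ψ : Strategy K m v) (b : ℝ) (n : ℕ) (j : Fin K) :
    0 ≤ occupation D ψ b n j := by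
  refine Finset.sum_nonneg fun t _ => integral_nonneg fun γ => Finset.sum_nonneg fun x _ =>
    mul_nonneg (weight_nonneg ψ γ x) ?_
  dsimp only
  split_ifs
  · exact (ψ t γ x).2.1 j
  · exact le_rfl

variable [IsProbabilityMeasure D]

lemma mixture_abs_le_one (ξ : Mixture K) (j : Fin K) : |ξ.1 j| ≤ 1 :=
  abs_le_one_of_mem ⟨ξ.2.1 j, (Finset.single_le_sum (f := ξ.1) (fun k _ => ξ.2.1 k)
    (Finset.mem_univ j)).trans_eq ξ.2.2⟩

/-- A Wald-type identity: whether a round counts and which arm it plays are decided independently of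
its request. A dynamic policy thus enters only through its occupation vector, and the same vector
serves for rewards, costs and the number of counted rounds. -/
lemma average_budgetedSum {ψ : Strategy K m v} (hψ : ψ.IsMeasurable) (b : ℝ)
    {φ : Input K m v → Fin K → ℝ} (hφ : ∀ a, Measurable fun g => φ g a)
    (hφ1 : ∀ g a, φ g a ∈ Set.Icc (0 : ℝ) 1) : ∀ n : ℕ,
      average D ψ n (budgetedSum b φ) = ∑ j, occupation D ψ b n j * ∫ g, φ g j ∂D
  | 0 => by simp [average, budgetedSum, occupation]
  | n + 1 => by
    classical
    have hbd : ∀ (n : ℕ) (γ : Fin n → Input K m v) (x : Fin n → Fin K),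
        |budgetedSum b φ γ x| ≤ n := fun n γ x => by
      have := budgetedSum_mem b hφ1 γ x
      exact abs_le.2 ⟨by linarith [this.1, this.2], this.2⟩
    rw [average_succ D hψ (measurable_budgetedSum b hφ) (hbd (n + 1))]
    have hint : ∀ a, Integrable (fun g => φ g a) D := fun a =>
      integrable_of_abs_le (hφ a) fun g => abs_le_one_of_mem (hφ1 g a)
    have hstep : ∀ (γ : Fin n → Input K m v) (x : Fin n → Fin K),
        ∫ g, ∑ a, (ψ n γ x).1 a * budgetedSum b φ (Fin.snoc (α := fun _ => Input K m v) γ g)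
          (Fin.snoc (α := fun _ => Fin K) x a) ∂D = budgetedSum b φ γ x +
            ∑ j, (if Affordable b γ x then (ψ n γ x).1 j else 0) * ∫ g, φ g j ∂D := by
      intro γ x
      simp only [budgetedSum_snoc]
      have e : ∀ g, ∑ a, (ψ n γ x).1 a *
          (budgetedSum b φ γ x + if Affordable b γ x then φ g a else 0) = budgetedSum b φ γ x +
            ∑ j, (if Affordable b γ x then (ψ n γ x).1 j else 0) * φ g j := by
        intro g
        simp only [mul_add, Finset.sum_add_distrib]
        rw [← Finset.sum_mul Finset.univ, (ψ n γ x).2.2, one_mul]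
        congr 1
        refine Finset.sum_congr rfl fun j _ => ?_
        split_ifs <;> ring
      simp only [e]
      rw [integral_add (integrable_const _)
        (integrable_finsetSum _ fun j _ => (hint j).const_mul _),
        integral_finsetSum _ fun j _ => (hint j).const_mul _]
      simp only [integral_const_mul]
      simp
    simp only [hstep]
    have hq : ∀ j, Integrable (fun γ : Fin n → Input K m v => ∑ x, weight ψ γ x *
        (if Affordable b γ x then (ψ n γ x).1 j else 0)) (Measure.pi fun _ => D) := fun j => by
      refine integrable_sum_weight_mul D hψ (B := 1) (fun x => Measurable.ite
        (measurableSet_affordable b x) (hψ n x j) measurable_const) fun γ x => ?_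
      split_ifs
      · exact mixture_abs_le_one _ j
      · simp
    have esplit : ∀ γ : Fin n → Input K m v, ∑ x, weight ψ γ x * (budgetedSum b φ γ x +
        ∑ j, (if Affordable b γ x then (ψ n γ x).1 j else 0) * ∫ g, φ g j ∂D) =
        ∑ x, weight ψ γ x * budgetedSum b φ γ x + ∑ j, (∑ x, weight ψ γ x *
          (if Affordable b γ x then (ψ n γ x).1 j else 0)) * ∫ g, φ g j ∂D := by
      intro γ
      simp only [mul_add, Finset.sum_add_distrib, Finset.mul_sum, Finset.sum_mul]
      congr 1
      rw [Finset.sum_comm]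
      exact Finset.sum_congr rfl fun j _ => Finset.sum_congr rfl fun x _ => by ring
    have ih := average_budgetedSum hψ b hφ hφ1 n
    simp only [average] at ih ⊢
    simp only [esplit]
    rw [integral_add (integrable_sum_weight_mul D hψ (measurable_budgetedSum b hφ) (hbd n))
      (integrable_finsetSum _ fun j _ => (hq j).mul_const _),
      integral_finsetSum _ fun j _ => (hq j).mul_const _, ih, ← Finset.sum_add_distrib]
    refine Finset.sum_congr rfl fun j _ => ?_
    rw [integral_mul_const, ← add_mul, occupation, occupation, Finset.sum_range_succ]
    rfl

lemma average_budgetedSum_le {ψ : Strategy K m v} (hψ : ψ.IsMeasurable) (b : ℝ)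
    {φ : Input K m v → Fin K → ℝ} (hφ1 : ∀ g a, φ g a ∈ Set.Icc (0 : ℝ) 1) {n : ℕ} {B : ℝ}
    (hB : ∀ (γ : Fin n → Input K m v) x, budgetedSum b φ γ x ≤ B) :
    average D ψ n (budgetedSum b φ) ≤ B := by
  rw [← average_const D (n := n) ψ B]
  exact average_mono D hψ (B := |B|) (fun γ x => (budgetedSum_mem b hφ1 γ x).1)
    (fun x => measurable_const) (fun γ x => le_rfl) hB

/-- The mixture with masses `q` on the arms and the remaining mass on the void arm. -/
def complete (v : Fin K) (q : Fin K → ℝ) (hq : ∀ j, 0 ≤ q j) (hq1 : ∑ j, q j ≤ 1) : Mixture K :=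
  ⟨fun j => q j + (1 - ∑ k, q k) * (point v).1 j,
    fun j => add_nonneg (hq j) (mul_nonneg (by linarith) ((point v).2.1 j)), by
      rw [Finset.sum_add_distrib, ← Finset.mul_sum, (point v).2.2]; ring⟩

lemma expect_complete (v : Fin K) (q : Fin K → ℝ) (hq : ∀ j, 0 ≤ q j) (hq1 : ∑ j, q j ≤ 1)
    {h : Fin K → ℝ} (hv : h v = 0) : expect (complete v q hq hq1) h = ∑ j, q j * h j := by
  have e : expect (complete v q hq hq1) h = ∑ j, q j * h j + (1 - ∑ k, q k) *
      expect (point v) h := by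
    simp only [expect, complete, add_mul, Finset.sum_add_distrib, Finset.mul_sum, mul_assoc]
  rw [e, expect_point, hv, mul_zero, add_zero]

/-- Every dynamic policy is dominated by a mixture that respects the budget on average. -/
lemma exists_mixture_of_dynamicPolicy {T : ℕ} (hT : 0 < T) {ρ : ℝ} (hρ : 0 < ρ)
    (ψ : DynamicPolicy K m v) : ∃ ξ : Mixture K, (∀ i, meanCost D ξ i ≤ ρ) ∧
      ∫ γ : Fin T → Input K m v, (∫ x, stoppedReward ρ γ x ∂(law ψ.1 γ)) ∂(Measure.pi fun _ => D) ≤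
        T * meanReward D ξ + 1 / ρ := by
  have hT' : (0 : ℝ) < T := by exact_mod_cast hT
  have hb : 0 < ρ * T := by positivity
  have hψ := ψ.isMeasurable
  set q := occupation D ψ.1 (ρ * T) T with hq
  have hq0 : ∀ j, 0 ≤ q j := fun j => occupation_nonneg D ψ.1 _ T j
  have hqT : ∑ j, q j ≤ T := by
    have h1 := average_budgetedSum D hψ (ρ * T) (φ := fun _ _ => 1) (fun _ => measurable_const)
      (fun _ _ => ⟨zero_le_one, le_rfl⟩) T
    have h2 := average_budgetedSum_le D hψ (ρ * T) (n := T) (φ := fun _ _ => 1)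
      (fun _ _ => ⟨zero_le_one, le_rfl⟩)
      (fun γ x => (budgetedSum_mem _ (fun _ _ => ⟨zero_le_one, le_rfl⟩) γ x).2)
    rw [h1] at h2
    simpa using h2
  have hR := average_budgetedSum D hψ (ρ * T) (φ := Input.reward) measurable_reward
    Input.reward_mem T
  have hRT := average_budgetedSum_le D hψ (ρ * T) (n := T) (φ := Input.reward) Input.reward_mem
    (fun γ x => (budgetedSum_mem _ Input.reward_mem γ x).2)
  have hC : ∀ i, ∑ j, q j * ∫ g, g.cost j i ∂D ≤ ρ * T + 1 := fun i => by
    have h1 := average_budgetedSum D hψ (ρ * T) (φ := fun g a => g.cost a i)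
      (fun a => measurable_cost a i) (fun g a => g.cost_mem a i) T
    rw [← h1]
    exact average_budgetedSum_le D hψ (ρ * T) (fun g a => g.cost_mem a i)
      fun γ x => (budgetedSum_cost_le hb.le i γ x).2
  have hV : ∫ γ : Fin T → Input K m v, (∫ x, stoppedReward ρ γ x ∂(law ψ.1 γ))
      ∂(Measure.pi fun _ => D) ≤ average D ψ.1 T (budgetedSum (ρ * T) Input.reward) := by
    simp only [integral_law]
    refine average_mono D hψ (B := T) (fun γ x => Finset.sum_nonneg fun t _ => ?_)
      (measurable_budgetedSum _ measurable_reward) (fun γ x => ?_) (stoppedReward_le_budgetedSum ρ)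
    · split_ifs
      · exact ((γ t).reward_mem (x t)).1
      · exact le_rfl
    · have := budgetedSum_mem (ρ * T) Input.reward_mem γ x
      exact abs_le.2 ⟨by linarith [this.1, this.2], this.2⟩
  rw [hR] at hV hRT
  -- Scaling by ρ/(ρT + 1) instead of 1/T compensates for the overshoot: mean costs at most ρT + 1
  -- become at most ρ, and the total mass stays below 1.
  have hk : 0 < ρ / (ρ * T + 1) := by positivity
  have hk1 : ρ / (ρ * T + 1) * T ≤ 1 := by
    rw [div_mul_eq_mul_div, div_le_one (by positivity)]
    linarith
  have hq1 : ∑ j, ρ / (ρ * T + 1) * q j ≤ 1 := by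
    rw [← Finset.mul_sum]
    exact (mul_le_mul_of_nonneg_left hqT hk.le).trans hk1
  refine ⟨complete v (fun j => ρ / (ρ * T + 1) * q j) (fun j => mul_nonneg hk.le (hq0 j)) hq1,
    fun i => ?_, hV.trans ?_⟩
  · rw [meanCost, expect_complete _ _ _ _ (by simp [Input.cost_void])]
    simp only [mul_assoc, ← Finset.mul_sum]
    refine (mul_le_mul_of_nonneg_left (hC i) hk.le).trans_eq ?_
    field_simp
  · rw [meanReward, expect_complete _ _ _ _ (by simp [Input.reward_void])]
    simp only [mul_assoc, ← Finset.mul_sum]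
    generalize ∑ j, q j * ∫ g, g.reward j ∂D = V at *
    -- The reward lost by the scaling is V/(ρT + 1), which is at most 1/ρ because V ≤ T.
    have e : V - T * (ρ / (ρ * T + 1) * V) = V / (ρ * T + 1) := by field_simp; ring
    have h2 : V / (ρ * T + 1) ≤ 1 / ρ := by
      rw [div_le_div_iff₀ (by positivity) hρ]
      nlinarith
    linarith

lemma dynamicPolicy_nonempty : Nonempty (DynamicPolicy K m v) :=
  ⟨⟨fun _ _ _ => point v, fun _ _ => measurable_const⟩⟩

lemma exists_mixture_optDP_le {T : ℕ} (hT : 0 < T) {ρ : ℝ} (hρ : 0 < ρ) :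
    ∃ ξ : Mixture K, (∀ i, meanCost D ξ i ≤ ρ) ∧
      optDP T ρ D ≤ T * meanReward D ξ + 1 / ρ + 1 := by
  have := dynamicPolicy_nonempty (K := K) (m := m) (v := v)
  -- The supremum need not be attained, so a policy within 1 of it is fixed. The resulting mixture
  -- does not depend on the run, and one supermartingale suffices.
  obtain ⟨ψ, hψ⟩ := exists_lt_of_lt_ciSup (sub_one_lt (optDP T ρ D))
  obtain ⟨ξ, hξ, h⟩ := exists_mixture_of_dynamicPolicy D hT hρ ψ
  exact ⟨ξ, hξ, by linarith⟩

lemma optDP_le {T : ℕ} (ρ : ℝ) : optDP T ρ D ≤ T := by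
  have := dynamicPolicy_nonempty (K := K) (m := m) (v := v)
  refine ciSup_le fun ψ => ?_
  simp only [integral_law]
  have := average_mono D (n := T) ψ.isMeasurable (F := stoppedReward ρ) (G := fun _ _ => (T : ℝ))
    (B := T) (fun γ x => Finset.sum_nonneg fun t _ => by
      split_ifs
      · exact ((γ t).reward_mem (x t)).1
      · exact le_rfl) (fun x => measurable_const) (fun γ x => by simp)
    fun γ x => (stoppedReward_le_totalReward ρ γ x).trans (totalReward_le γ x)
  rwa [average_const] at this

/-! ### Stochastic requests -/

/-- A bound on conditional success probabilities by an explicit integrable function can be averaged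
in this way even when the function takes negative values. -/
lemma ofReal_integral_le_lintegral {A : Type*} [MeasurableSpace A] {μ : Measure A} {F : A → ℝ}
    (hF : Integrable F μ) : ENNReal.ofReal (∫ y, F y ∂μ) ≤ ∫⁻ y, ENNReal.ofReal (F y) ∂μ := by
  have h1 : ∫ y, F y ∂μ ≤ ∫ y, max (F y) 0 ∂μ :=
    integral_mono hF hF.pos_part fun y => le_max_left _ _
  refine (ENNReal.ofReal_le_ofReal h1).trans ?_
  rw [ofReal_integral_eq_lintegral_ofReal hF.pos_part
    (Filter.Eventually.of_forall fun y => le_max_right _ _)]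
  refine lintegral_mono fun y => ?_
  simp

lemma meanReward_sub_le {T : ℕ} {ρ δ : ℝ} (hreg : Regime K m T δ) (hρ : 0 < ρ) (hρ1 : ρ ≤ 1)
    (fb : DualFeedback) (γ : Fin T → Input K m v) (x : Fin T → Fin K) (ξ : Mixture K)
    (hbad : badness T ρ δ fb γ x < 1)
    (hdev : runSum T ρ δ fb (requestIncrement D ρ (deviationParam m T ρ δ) ξ) γ x ≤
      3 * Real.log (T * m / δ)) :
    T * meanReward D ξ - totalReward γ x ≤ 39 * bwkRate K m T δ / ρ := by
  classical
  have h1 := lagrangian_le_of_badness_lt_one hreg hρ hρ1 fb γ x hbad ξ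
  have h2 : runSum T ρ δ fb (fun s g _ => meanReward D ξ - lagrangian ρ s.dual g ξ) γ x ≤
      8 * bwkRate K m T δ / ρ := by
    refine hreg.le_of_deviation hρ le_rfl (le_trans ?_ hdev)
    -- The compensator is subtracted here in all T rounds but accrues only in active ones; the
    -- difference has the favourable sign.
    have eT : (T : ℝ) * (deviationParam m T ρ δ ^ 2 * (2 / ρ) ^ 2) =
      ∑ _t : Fin T, deviationParam m T ρ δ ^ 2 * (2 / ρ) ^ 2 := by simp
    have hc : 0 ≤ deviationParam m T ρ δ ^ 2 * (2 / ρ) ^ 2 := by positivity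
    rw [runSum, runSum, eT, Finset.mul_sum, ← Finset.sum_sub_distrib]
    refine Finset.sum_le_sum fun t _ => ?_
    split_ifs
    · exact le_rfl
    · linarith
  have h3 : T * meanReward D ξ ≤
      runSum T ρ δ fb (fun s g _ => meanReward D ξ - lagrangian ρ s.dual g ξ) γ x +
      (runSum T ρ δ fb (fun s g _ => lagrangian ρ s.dual g ξ - 1) γ x + T) := by
    have eT : (T : ℝ) = ∑ _t : Fin T, (1 : ℝ) := by simp
    rw [eT, runSum, runSum, ← Finset.sum_add_distrib, ← Finset.sum_add_distrib, Finset.sum_mul]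
    refine Finset.sum_le_sum fun t _ => ?_
    -- In active rounds the Lagrangians cancel; an inactive round counts as 1, which is at least the
    -- mean reward.
    have := (meanReward_mem D ξ).2
    split_ifs <;> linarith
  have e : 39 * bwkRate K m T δ / ρ = 8 * bwkRate K m T δ / ρ + 31 * bwkRate K m T δ / ρ := by
    ring
  linarith

lemma le_lintegral_law_stochastic {T : ℕ} {ρ δ : ℝ} (hreg : Regime K m T δ) (hρ : 0 < ρ)
    (hρ1 : ρ ≤ 1) (fb : DualFeedback) :
    ENNReal.ofReal (1 - δ) ≤ ∫⁻ γ : Fin T → Input K m v, law (metaAlgorithm T ρ δ fb) γ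
      {x | optDP T ρ D - totalReward γ x ≤ 40 * (bwkRate K m T δ / ρ)}
        ∂(Measure.pi fun _ => D) := by
  have hT : 0 < T := by have := hreg.two_le; omega
  have hm : (1 : ℝ) ≤ m := by exact_mod_cast hreg.pos_resources
  have hδ := hreg.conf_pos
  obtain ⟨ξ, hξ, hopt⟩ := exists_mixture_optDP_le D hT hρ
  have hθ0 := (hreg.deviationParam_pos hρ).le
  have hθ1 := hreg.deviationParam_mul_le hρ
  set θ := deviationParam m T ρ δ with hθ
  set p := Real.exp (-(3 * Real.log (T * m / δ))) with hp
  have hp0 : 0 < p := Real.exp_pos _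
  set E : (Fin T → Input K m v) → (Fin T → Fin K) → ℝ := fun γ x =>
    Real.exp (runSum T ρ δ fb (requestIncrement D ρ θ ξ) γ x) with hE
  have hEle : average D (metaAlgorithm T ρ δ fb) T E ≤ 1 :=
    average_exp_runSum_requestIncrement_le D δ hρ hρ1 hθ0 hθ1 fb hξ T
  have hEint : Integrable (fun γ => ∑ x, weight (metaAlgorithm T ρ δ fb) γ x * E γ x)
      (Measure.pi fun _ => D) := by
    refine integrable_sum_weight_mul D (isMeasurable_metaAlgorithm T ρ δ fb) (B := Real.exp T)
      (fun x => Real.measurable_exp.comp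
        (measurable_runSum_requestIncrement D T ρ δ θ fb ξ x)) fun γ x => ?_
    rw [abs_of_pos (Real.exp_pos _)]
    exact Real.exp_le_exp.2 (runSum_requestIncrement_le D δ hρ hρ1 hθ0 hθ1 fb ξ γ x)
  set δ₁ := δ / 2 + (m + 1) * (δ / (8 * m)) with hδ₁
  have hG : Integrable (fun γ : Fin T → Input K m v =>
      1 - δ₁ - p * ∑ x, weight (metaAlgorithm T ρ δ fb) γ x * E γ x) (Measure.pi fun _ => D) :=
    (integrable_const _).sub (hEint.const_mul _)
  have hpδ : p ≤ δ / (8 * m) := hreg.exp_neg_le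
  calc ENNReal.ofReal (1 - δ)
      ≤ ENNReal.ofReal (∫ γ : Fin T → Input K m v,
          (1 - δ₁ - p * ∑ x, weight (metaAlgorithm T ρ δ fb) γ x * E γ x)
          ∂(Measure.pi fun _ => D)) := by
        refine ENNReal.ofReal_le_ofReal ?_
        rw [integral_sub (integrable_const _) (hEint.const_mul _), integral_const_mul]
        simp only [integral_const, probReal_univ, smul_eq_mul, one_mul]
        have h1 : p * average D (metaAlgorithm T ρ δ fb) T E ≤ p * 1 :=
          mul_le_mul_of_nonneg_left hEle hp0.le
        -- The m + 1 dual vertices and the single request term share the second half of the failure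
        -- probability.
        have h2 : (m + 2) * (δ / (8 * m)) ≤ δ / 2 := by
          rw [mul_div_assoc', div_le_iff₀ (by positivity)]
          nlinarith
        change _ ≤ 1 - δ₁ - p * average D (metaAlgorithm T ρ δ fb) T E
        linarith
    _ ≤ ∫⁻ γ : Fin T → Input K m v, ENNReal.ofReal
          (1 - δ₁ - p * ∑ x, weight (metaAlgorithm T ρ δ fb) γ x * E γ x)
          ∂(Measure.pi fun _ => D) := ofReal_integral_le_lintegral hG
    _ ≤ _ := by
        -- The expectation of `badness` is bounded for each request sequence separately. The request
        -- term is bounded only on average, so its conditional expectation is kept until after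
        -- integration over γ.
        refine lintegral_mono fun γ => ?_
        refine le_trans (ENNReal.ofReal_le_ofReal ?_) (le_law_of_forall (metaAlgorithm T ρ δ fb) γ
          (B := fun x => badness T ρ δ fb γ x + p * E γ x)
          (fun x => add_nonneg (badness_nonneg T ρ δ fb γ x)
            (mul_nonneg hp0.le (Real.exp_pos _).le)) fun x hx => ?_)
        · have h1 := sum_weight_mul_badness_le hreg hρ fb γ
          have h2 : ∑ x, weight (metaAlgorithm T ρ δ fb) γ x *
              (badness T ρ δ fb γ x + p * E γ x) =
              ∑ x, weight (metaAlgorithm T ρ δ fb) γ x * badness T ρ δ fb γ x +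
              p * ∑ x, weight (metaAlgorithm T ρ δ fb) γ x * E γ x := by
            simp only [mul_add, Finset.sum_add_distrib, Finset.mul_sum]
            congr 1
            exact Finset.sum_congr rfl fun x _ => by ring
          rw [h2]
          linarith
        · have hb0 := badness_nonneg T ρ δ fb γ x
          have he0 : 0 < p * E γ x := mul_pos hp0 (Real.exp_pos _)
          have h3 := meanReward_sub_le D hreg hρ hρ1 fb γ x ξ (by linarith)
            (le_of_exp_neg_mul_exp_lt_one (by linarith : p * E γ x < 1))
          have h4 := hreg.five_le_rate
          have h5 : 2 / ρ ≤ bwkRate K m T δ / ρ := by gcongr; linarith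
          have h6 : 1 + 1 / ρ ≤ 2 / ρ := by
            have : 1 ≤ 1 / ρ := by rw [le_div_iff₀ hρ]; linarith
            have : 2 / ρ = 1 / ρ + 1 / ρ := by ring
            linarith
          -- The extra unit absorbs the loss 1 + 1/ρ from replacing the best dynamic policy by a
          -- mixture.
          have e : 40 * (bwkRate K m T δ / ρ) = 39 * bwkRate K m T δ / ρ +
            bwkRate K m T δ / ρ := by ring
          rw [Set.mem_ofPred_eq]
          linarith

end Policy

/-! ### Adversarial guarantee -/

lemma le_law_adversarial {T : ℕ} {ρ δ : ℝ} (hreg : Regime K m T δ) (hρ : 0 < ρ)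
    (hρ1 : ρ ≤ 1) (fb : DualFeedback) (γ : Fin T → Input K m v) :
    ENNReal.ofReal (1 - δ) ≤ law (metaAlgorithm T ρ δ fb) γ
      {x | optFD ρ γ - 1 / ρ * totalReward γ x ≤ 40 * ((1 / ρ) ^ 2 * bwkRate K m T δ)} := by
  have hm : (1 : ℝ) ≤ m := by exact_mod_cast hreg.pos_resources
  have hδ := hreg.conf_pos
  refine le_trans (ENNReal.ofReal_le_ofReal ?_) (le_law_of_forall (metaAlgorithm T ρ δ fb) γ
    (badness_nonneg T ρ δ fb γ) fun x hx =>
      (optFD_sub_le_of_badness_lt_one hreg hρ hρ1 fb γ x hx).trans ?_)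
  · have h1 := sum_weight_mul_badness_le hreg hρ fb γ
    have h2 : (m + 1) * (δ / (8 * m)) ≤ δ / 2 := by
      rw [mul_div_assoc', div_le_iff₀ (by positivity)]
      nlinarith
    linarith
  · have : 0 ≤ (1 / ρ) ^ 2 * bwkRate K m T δ :=
      mul_nonneg (sq_nonneg _) (Real.sqrt_nonneg _)
    linarith

lemma optFD_le_horizon {T : ℕ} (ρ : ℝ) (γ : Fin T → Input K m v) : optFD ρ γ ≤ T := by
  refine optFD_le γ fun ξ => ?_
  refine (Finset.sum_le_card_nsmul Finset.univ _ 1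
    fun t _ => (expect_mem (γ t).reward_mem).2).trans (by simp)

end

end BwK

/-! ### Main theorem: reduction to long horizons -/

theorem mainTheorem7 :
    ∃ C : ℝ, 0 < C ∧
      ∀ (K m T : ℕ) (v : Fin K) (ρ δ : ℝ) (fb : BwK.DualFeedback),
        1 ≤ m → 2 ≤ T → 0 < ρ → ρ ≤ 1 → 0 < δ →
          (∀ γ : Fin T → BwK.Input K m v,
            ENNReal.ofReal (1 - δ) ≤
              BwK.law (BwK.metaAlgorithm T ρ δ fb) γ
                {x | BwK.optFD ρ γ - (1 / ρ) * BwK.totalReward γ x ≤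
                  C * ((1 / ρ) ^ 2 * √(K * T * Real.log (T * m / δ)))}) ∧
          (∀ D : Measure (BwK.Input K m v), IsProbabilityMeasure D →
            ENNReal.ofReal (1 - δ) ≤
              ∫⁻ γ : Fin T → BwK.Input K m v,
                BwK.law (BwK.metaAlgorithm T ρ δ fb) γ
                  {x | BwK.optDP T ρ D - BwK.totalReward γ x ≤
                    C * (√(K * T * Real.log (T * m / δ)) / ρ)}
                ∂(Measure.pi fun _ => D)) := by
  refine ⟨40, by norm_num, fun K m T v ρ δ fb hm hT hρ hρ1 hδ => ?_⟩
  -- For δ ≥ 1 the required probability is 0.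
  rcases le_or_gt 1 δ with hδ1 | hδ1
  · rw [ENNReal.ofReal_of_nonpos (by linarith)]
    exact ⟨fun _ => zero_le, fun _ _ => zero_le⟩
  by_cases hhor : 100 * (K : ℝ) * Real.log (T * m / δ) ≤ T
  · have hreg : BwK.Regime K m T δ := ⟨v.pos, hm, hT, hδ, hδ1, hhor⟩
    exact ⟨BwK.le_law_adversarial hreg hρ hρ1 fb,
      fun D _ => BwK.le_lintegral_law_stochastic D hreg hρ hρ1 fb⟩
  · have hT' : (2 : ℝ) ≤ T := by exact_mod_cast hT
    -- For a short horizon T² is less than 100 K T log(Tm/δ). Both bounds then exceed T, which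
    -- dominates either benchmark, so they hold on every run.
    have hrate : (T : ℝ) ≤ 10 * √(K * T * Real.log (T * m / δ)) := by
      have : (T : ℝ) / 10 ≤ √(K * T * Real.log (T * m / δ)) :=
        Real.le_sqrt_of_sq_le (by nlinarith)
      linarith
    have hN := Real.sqrt_nonneg (K * T * Real.log (T * m / δ))
    have hinv : 1 ≤ 1 / ρ := by rw [le_div_iff₀ hρ]; linarith
    have hone : ENNReal.ofReal (1 - δ) ≤ 1 := ENNReal.ofReal_le_one.2 (by linarith)
    refine ⟨fun γ => ?_, fun D _ => ?_⟩
    · have hS : {x | BwK.optFD ρ γ - (1 / ρ) * BwK.totalReward γ x ≤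
          40 * ((1 / ρ) ^ 2 * √(K * T * Real.log (T * m / δ)))} = Set.univ := by
        refine Set.eq_univ_of_forall fun x => ?_
        rw [Set.mem_ofPred_eq]
        have h1 := BwK.optFD_le_horizon ρ γ
        have h2 := mul_nonneg (by linarith : 0 ≤ 1 / ρ) (BwK.totalReward_nonneg γ x)
        have h3 : √(K * T * Real.log (T * m / δ)) ≤
            (1 / ρ) ^ 2 * √(K * T * Real.log (T * m / δ)) :=
          le_mul_of_one_le_left hN (one_le_pow₀ hinv)
        linarith
      rw [hS, measure_univ]
      exact hone
    · have hS : ∀ γ : Fin T → BwK.Input K m v, {x | BwK.optDP T ρ D - BwK.totalReward γ x ≤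
          40 * (√(K * T * Real.log (T * m / δ)) / ρ)} = Set.univ := by
        refine fun γ => Set.eq_univ_of_forall fun x => ?_
        rw [Set.mem_ofPred_eq]
        have h1 := BwK.optDP_le D (T := T) ρ
        have h2 := BwK.totalReward_nonneg γ x
        have h3 : √(K * T * Real.log (T * m / δ)) ≤ √(K * T * Real.log (T * m / δ)) / ρ := by
          rw [le_div_iff₀ hρ]
          exact mul_le_of_le_one_right hN hρ1
        linarith
      simp only [hS, measure_univ, lintegral_one]
      exact hone
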